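/- Let $D=(V,A)$ be a finite digraph, i.e. $A$ is a set of ordered pairs of distinct vertices of the finite set $V$. A directed $u,v$-path is a sequence of distinct vertices from $u$ to $v$ in which consecutive vertices are joined by an arc; its length is its number of arcs or, if $D$ carries nonnegative real arc weights, the sum of the weights of its arcs. A set $S\subseteq V$ is a mutual-visibility set if for all $x,y\in S$ there exist a shortest directed $x,y$-path $P$ and a shortest directed $y,x$-path $Q$ such that $(S\cap V(P))\cup(S\cap V(Q))=\{x,y\}$. Proposition. Given $D$ by adjacency lists (with the weights of the arcs, in the weighted case) and a list of the elements of $S\subseteq V$, it can be decided whether $S$ is a mutual-visibility set of $D$ 1. in $O(|S|\cdot(|V|+|A|))$ time, if $D$ is unweighted; 2. in $O(|S|\cdot(|A|+|V|\log|V|))$ time, if $D$ has nonnegative real arc weights. Here time is the number of steps of a random access machine that, at unit cost per step, counts and compares on integers, reads and writes array cells, and adds and compares arc weights. In each case a single program answers correctly on all inputs, and $O(f)$ means at most $C\cdot(f+1)$ steps with an absolute constant $C$ (the summand $1$ matters only where $f$ vanishes, that is, if $S=\emptyset$ or, in 2, if $|V|\le 1$). -/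

import Mathlib

open scoped NNReal

namespace MutualVisibility

/-! ## Directed paths and mutual-visibility sets -/

section Digraphs

variable {V : Type*}

/-- `p` is the vertex sequence of a directed path from `u` to `v`: its vertices are pairwise
distinct and consecutive vertices are joined by an arc. -/
structure IsDirectedPath (D : Digraph V) (u v : V) (p : List V) : Prop where
  chain : p.IsChain D.Adj
  nodup : p.Nodup
  head_eq : p.head? = some u
  last_eq : p.getLast? = some v

/-- The length of a path in an unweighted digraph: its number of arcs. -/
def numArcs (p : List V) : ℕ := p.length - 1

/-- The length of a path in a digraph whose arc `(u, v)` has weight `w u v`: the sum of the weights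
of its arcs. -/
noncomputable def pathWeight (w : V → V → ℝ≥0) : List V → ℝ≥0
  | [] => 0
  | [_] => 0
  | a :: b :: l => w a b + pathWeight w (b :: l)

/-- `p` is a shortest directed `u,v`-path with respect to the length function `len`. -/
def IsShortestPath {β : Type*} [LE β] (D : Digraph V) (len : List V → β) (u v : V) (p : List V) :
    Prop :=
  IsDirectedPath D u v p ∧ ∀ q, IsDirectedPath D u v q → len p ≤ len q

/-- `S` is a mutual-visibility set of `D`, where path lengths are measured by `len`: for all
`x, y ∈ S` there are a shortest `x,y`-path `P` and a shortest `y,x`-path `Q` with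
`(S ∩ V(P)) ∪ (S ∩ V(Q)) = {x, y}`. -/
def IsMutualVisibilitySet {β : Type*} [LE β] (D : Digraph V) (len : List V → β) (S : Set V) :
    Prop :=
  ∀ x ∈ S, ∀ y ∈ S, ∃ P Q : List V, IsShortestPath D len x y P ∧ IsShortestPath D len y x Q ∧
    (S ∩ {z | z ∈ P}) ∪ (S ∩ {z | z ∈ Q}) = {x, y}

/-- The number `|A|` of arcs. -/
noncomputable def arcCount (D : Digraph V) : ℕ := {a : V × V | D.Adj a.1 a.2}.ncard

end Digraphs

/-! ## Random access machines

A machine has integer registers and integer arrays, and registers and arrays for arc weights.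
Arrays have random access: a cell is addressed by the content of an integer register. On integers
the machine can only count up and down and compare, so that in `t` steps no integer grows by more
than `t` beyond the input and the constants of the program; on weights it can only add and compare
(the comparison-addition model). Each instruction and each evaluation of a test costs one unit of
time. -/

/-- The memory of the machine. -/
structure State where
  /-- integer registers -/
  reg : ℕ → ℕ
  /-- integer arrays: `arr a i` is cell `i` of array `a` -/
  arr : ℕ → ℕ → ℕ
  /-- weight registers -/
  wreg : ℕ → ℝ≥0
  /-- weight arrays: `warr a i` is cell `i` of weight array `a` -/
  warr : ℕ → ℕ → ℝ≥0

/-- Elementary instructions; `x y z i` name registers and `a` names an array. -/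
inductive Instr where
  | skip
  | const (x k : ℕ)
  | copy (x y : ℕ)
  | succ (x : ℕ)
  | pred (x : ℕ)
  | load (x a i : ℕ)
  | store (a i x : ℕ)
  | wzero (x : ℕ)
  | wcopy (x y : ℕ)
  | wadd (x y z : ℕ)
  | wload (x a i : ℕ)
  | wstore (a i x : ℕ)

/-- The effect of an instruction on the memory. -/
noncomputable def Instr.run (s : State) : Instr → State
  | .skip => s
  | .const x k => { s with reg := Function.update s.reg x k }
  | .copy x y => { s with reg := Function.update s.reg x (s.reg y) }
  | .succ x => { s with reg := Function.update s.reg x (s.reg x + 1) }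
  | .pred x => { s with reg := Function.update s.reg x (s.reg x - 1) }
  | .load x a i => { s with reg := Function.update s.reg x (s.arr a (s.reg i)) }
  | .store a i x =>
      { s with arr := Function.update s.arr a (Function.update (s.arr a) (s.reg i) (s.reg x)) }
  | .wzero x => { s with wreg := Function.update s.wreg x 0 }
  | .wcopy x y => { s with wreg := Function.update s.wreg x (s.wreg y) }
  | .wadd x y z => { s with wreg := Function.update s.wreg x (s.wreg y + s.wreg z) }
  | .wload x a i => { s with wreg := Function.update s.wreg x (s.warr a (s.reg i)) }
  | .wstore a i x =>
      { s with warr := Function.update s.warr a (Function.update (s.warr a) (s.reg i) (s.wreg x)) }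

/-- Elementary tests on registers. -/
inductive Test where
  | eq (x y : ℕ)
  | lt (x y : ℕ)
  | wle (x y : ℕ)

/-- The test succeeds in the memory `s`. -/
def Test.Holds (s : State) : Test → Prop
  | .eq x y => s.reg x = s.reg y
  | .lt x y => s.reg x < s.reg y
  | .wle x y => s.wreg x ≤ s.wreg y

/-- Programs: instructions, sequential composition, branching and while-loops. -/
inductive Prog where
  | instr (c : Instr)
  | seq (p q : Prog)
  | branch (b : Test) (p q : Prog)
  | loop (b : Test) (p : Prog)

/-- `Exec p s t s'`: started in the memory `s`, the program `p` halts after exactly `t` steps with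
memory `s'`. -/
inductive Exec : Prog → State → ℕ → State → Prop where
  | instr (c : Instr) (s : State) : Exec (.instr c) s 1 (c.run s)
  | seq {p q : Prog} {s s' s'' : State} {t t' : ℕ} :
      Exec p s t s' → Exec q s' t' s'' → Exec (.seq p q) s (t + t') s''
  | branch_true {b : Test} {p q : Prog} {s s' : State} {t : ℕ} :
      b.Holds s → Exec p s t s' → Exec (.branch b p q) s (t + 1) s'
  | branch_false {b : Test} {p q : Prog} {s s' : State} {t : ℕ} :
      ¬ b.Holds s → Exec q s t s' → Exec (.branch b p q) s (t + 1) s'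
  | loop_true {b : Test} {p : Prog} {s s' s'' : State} {t t' : ℕ} :
      b.Holds s → Exec p s t s' → Exec (.loop b p) s' t' s'' →
        Exec (.loop b p) s (t + t' + 1) s''
  | loop_false {b : Test} {p : Prog} {s : State} :
      ¬ b.Holds s → Exec (.loop b p) s 1 s

/-- Started in the memory `s`, the program `p` halts after at most `T` steps, leaving in register
`0` the answer to the question whether `Q` holds: `1` for yes, `0` for no. -/
def DecidesWithin (p : Prog) (s : State) (T : ℝ) (Q : Prop) : Prop :=
  ∃ (t : ℕ) (s' : State), Exec p s t s' ∧ (t : ℝ) ≤ T ∧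
    (Q → s'.reg 0 = 1) ∧ (¬ Q → s'.reg 0 = 0)

/-! ## Input format: adjacency lists stored in arrays -/

/-- `adj u` lists the out-neighbours of `u`, each once and in any order. -/
def IsAdjacencyList {n : ℕ} (D : Digraph (Fin n)) (adj : Fin n → List (Fin n)) : Prop :=
  ∀ u, (adj u).Nodup ∧ ∀ v, v ∈ adj u ↔ D.Adj u v

/-- `l` lists the elements of `S`, each once and in any order. -/
def IsListing {n : ℕ} (S : Finset (Fin n)) (l : List (Fin n)) : Prop :=
  l.Nodup ∧ ∀ v, v ∈ l ↔ v ∈ S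

/-- The memory that holds an instance with vertices `0, …, n - 1` at the start of a computation.
Register `0` holds `n` and register `1` holds the size of the candidate set, listed in array `2`.
Array `1` is the concatenation of the adjacency lists of the vertices `0, …, n - 1`, and array `0`
holds the positions at which these lists begin: that of `u` fills the cells of array `1` from
position `arr 0 u` up to, but not including, position `arr 0 (u + 1)`. Weight array `0` holds, at
the same position as in array `1`, the weight of the arc. Everything else is zero. -/
noncomputable def inputState {n : ℕ} (adj : Fin n → List (Fin n)) (w : Fin n → Fin n → ℝ≥0)
    (l : List (Fin n)) : State where
  reg x := if x = 0 then n else if x = 1 then l.length else 0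
  arr a i :=
    if a = 0 then (if i ≤ n then ∑ u : Fin n with u.val < i, (adj u).length else 0)
    else if a = 1 then
      (((List.finRange n).flatMap adj).map (fun v : Fin n => v.val)).getD i 0
    else if a = 2 then (l.map (fun v : Fin n => v.val)).getD i 0
    else 0
  wreg _ := 0
  warr a i :=
    if a = 0 then ((List.finRange n).flatMap (fun u => (adj u).map (w u))).getD i 0 else 0

end MutualVisibility

set_option linter.unusedSectionVars false

namespace MutualVisibility

/-! ## A program logic with time budgets -/

/-! The two paths demanded of a pair can be chosen independently of each other, so mutual visibility
is a condition on ordered pairs: for all x, y in S some shortest x,y-path meets S only in x and y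
(`isMutualVisibilitySet_iff`). Fix x and compare two distances from x: f, the ordinary one, and g,
the distance after deletion of all arcs that leave a vertex of S \ {x}. A walk of the second kind
can meet S \ {x} only at its end, and since weights are nonnegative it can be shortened to a path of
no greater weight. Hence x sees y exactly if g y is finite and g y ≤ f y
(`isShortestPath_iff_dist`). So S is tested by two single-source distance computations for each x in
S, with O(|V|) additional work per x.

Both cases of the theorem use the same label-setting algorithm. Its invariant `Labels` needs only an
ordered monoid in which adding a weight never decreases a sum: a vertex that has been extracted with
minimal label is final. The queue is abstract. `QueueSpec` prescribes the effect and the amortized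
cost of its operations, L for an extraction and c for the others, and `wp_sssp` derives a total of
order c(|A| + |V|) + L|V|. With unit weights a first-in-first-out queue has constant c and L,
because its labels are sorted and never differ by more than one.

For real weights c has to be constant and L logarithmic; this is achieved by hollow heaps. To
decrease a label, a new node is made for the vertex. The old node stays where it is as a hollow node
and keeps at most two children, those of largest rank; the others move to the new node. No tree is
cut. A full node of rank r has children of all ranks below r, so every node of rank r ≥ 2, full or
hollow, has children of the ranks r - 1 and r - 2, and its tree has at least 2^⌊r/2⌋ nodes
(`HeapTree.two_pow_le_card`). At most one node is made per relaxation, so there are at most |A| + 1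
≤ |V|² + 1 nodes and all ranks are O(log |V|). An extraction destroys hollow roots, links full roots
of equal rank, and is left with O(log |V|) roots; a potential linear in the numbers of stacked roots
and of nodes pays for everything else.

Time is handled by a program logic whose assertions speak of the remaining budget. A potential is
then a part of the budget that the invariant reserves, and termination of loops comes for free. -/

/-- Started in `s` with the budget `T`, the program `p` halts within the budget, and the final
memory and the rest of the budget satisfy `Q`. -/
def WP (p : Prog) (Q : ℕ → State → Prop) (T : ℕ) (s : State) : Prop :=
  ∃ t s', Exec p s t s' ∧ t ≤ T ∧ Q (T - t) s'

theorem WP.mono {p : Prog} {Q R : ℕ → State → Prop} {T : ℕ} {s : State} (h : WP p Q T s)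
    (hQR : ∀ T s, Q T s → R T s) : WP p R T s := by
  obtain ⟨t, s', h1, h2, h3⟩ := h
  exact ⟨t, s', h1, h2, hQR _ _ h3⟩

theorem wp_instr {c : Instr} {Q : ℕ → State → Prop} {T : ℕ} {s : State} (hT : 1 ≤ T)
    (h : Q (T - 1) (c.run s)) : WP (.instr c) Q T s :=
  ⟨1, _, .instr c s, hT, h⟩

theorem wp_seq {p q : Prog} {Q : ℕ → State → Prop} {T : ℕ} {s : State}
    (h : WP p (WP q Q) T s) : WP (.seq p q) Q T s := by
  obtain ⟨t, s', h1, h2, t', s'', h3, h4, h5⟩ := h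
  exact ⟨t + t', s'', .seq h1 h3, by omega, by rwa [Nat.sub_add_eq]⟩

theorem wp_branch {b : Test} {p q : Prog} {Q : ℕ → State → Prop} {T : ℕ} {s : State} (hT : 1 ≤ T)
    (hp : b.Holds s → WP p Q (T - 1) s) (hq : ¬ b.Holds s → WP q Q (T - 1) s) :
    WP (.branch b p q) Q T s := by
  by_cases hb : b.Holds s
  · obtain ⟨t, s', h1, h2, h3⟩ := hp hb
    exact ⟨t + 1, s', .branch_true hb h1, by omega, by
      rwa [show T - (t + 1) = T - 1 - t by omega]⟩
  · obtain ⟨t, s', h1, h2, h3⟩ := hq hb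
    exact ⟨t + 1, s', .branch_false hb h1, by omega, by
      rwa [show T - (t + 1) = T - 1 - t by omega]⟩

/-- The rule for loops: the budget is the termination measure. -/
theorem wp_loop {b : Test} {p : Prog} {Q : ℕ → State → Prop} (I : ℕ → State → Prop) {T : ℕ}
    {s : State} (h0 : I T s)
    (h : ∀ T s, I T s → 1 ≤ T ∧ (b.Holds s → WP p I (T - 1) s) ∧ (¬ b.Holds s → Q (T - 1) s)) :
    WP (.loop b p) Q T s := by
  induction T using Nat.strong_induction_on generalizing s with
  | _ T ih =>
    obtain ⟨hT, h1, h2⟩ := h T s h0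
    by_cases hb : b.Holds s
    · obtain ⟨t, s', e, ht, hI⟩ := h1 hb
      -- The test alone costs one step, so the budget strictly decreases in every round, whatever
      -- the body does.
      obtain ⟨t', s'', e', ht', hQ⟩ := ih (T - 1 - t) (by omega) hI
      exact ⟨t + t' + 1, s'', .loop_true hb e e', by omega, by
        rwa [show T - (t + t' + 1) = T - 1 - t - t' by omega]⟩
    · exact ⟨1, s, .loop_false hb, hT, h2 hb⟩

/-- The memory after a list of instructions. -/
noncomputable def runs (cs : List Instr) (s : State) : State := cs.foldl (fun s c => c.run s) s

/-- Straight-line code. -/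
def block : List Instr → Prog
  | [] => .instr .skip
  | c :: cs => .seq (.instr c) (block cs)

/-- The extra unit is the price of the `skip` that ends every block; an empty block costs one step.
-/
theorem wp_block {cs : List Instr} {Q : ℕ → State → Prop} {T : ℕ} {s : State}
    (hT : cs.length + 1 ≤ T) (h : Q (T - (cs.length + 1)) (runs cs s)) : WP (block cs) Q T s := by
  induction cs generalizing T s with
  | nil => exact wp_instr hT h
  | cons c cs ih =>
    simp only [List.length_cons] at hT h
    refine wp_seq (wp_instr (by omega) (ih (by omega) ?_))
    rwa [show T - 1 - (cs.length + 1) = T - (cs.length + 1 + 1) by omega]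

/-- Sequential composition of a list of programs. -/
def seqs : List Prog → Prog
  | [] => .instr .skip
  | [p] => p
  | p :: q :: l => .seq p (seqs (q :: l))

/-- The memories agree on the part that is reserved for the main program: integer registers below
`10`, integer arrays below `8` and weight arrays below `2`. -/
structure SameMain (s s' : State) : Prop where
  reg : ∀ r < 10, s'.reg r = s.reg r
  arr : ∀ a < 8, s'.arr a = s.arr a
  warr : ∀ a < 2, s'.warr a = s.warr a

theorem SameMain.trans {s s' s'' : State} (h : SameMain s s') (h' : SameMain s' s'') :
    SameMain s s'' :=
  ⟨fun r hr => (h'.reg r hr).trans (h.reg r hr), fun r hr => (h'.arr r hr).trans (h.arr r hr),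
    fun r hr => (h'.warr r hr).trans (h.warr r hr)⟩

/-- The memories agree on the part that is reserved for the priority queue. -/
structure SameQueue (s s' : State) : Prop where
  reg : ∀ r, 10 ≤ r → s'.reg r = s.reg r
  arr : ∀ a, 8 ≤ a → s'.arr a = s.arr a
  warr : ∀ a, 2 ≤ a → s'.warr a = s.warr a
  wreg : s'.wreg 1 = s.wreg 1

theorem SameQueue.trans {s s' s'' : State} (h : SameQueue s s') (h' : SameQueue s' s'') :
    SameQueue s s'' :=
  ⟨fun r hr => (h'.reg r hr).trans (h.reg r hr), fun r hr => (h'.arr r hr).trans (h.arr r hr),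
    fun r hr => (h'.warr r hr).trans (h.warr r hr), h'.wreg.trans h.wreg⟩

/-! ## Weighted walks and shortest paths -/

/-- A weighted digraph in compressed form: the arcs leaving the vertex `u < n` are numbered
`off u, …, off (u + 1) - 1`; the arc `e` ends in `head e` and has weight `wt e`. -/
structure CSR (β : Type*) where
  n : ℕ
  off : ℕ → ℕ
  head : ℕ → ℕ
  wt : ℕ → β

/-- The positions of a compressed digraph are monotone and its arcs end in vertices. -/
structure CSR.Valid {β : Type*} (G : CSR β) : Prop where
  mono : ∀ u < G.n, G.off u ≤ G.off (u + 1)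
  head_lt : ∀ e < G.off G.n, G.head e < G.n

/-- The compressed digraph `G` stores the digraph `D` with the weights `w`. -/
structure Represents {β : Type*} (G : CSR β) {n : ℕ} (D : Digraph (Fin n))
    (w : Fin n → Fin n → β) : Prop where
  n_eq : G.n = n
  exists_arc : ∀ u v : Fin n, D.Adj u v →
    ∃ e, G.off u ≤ e ∧ e < G.off (u + 1) ∧ G.head e = v ∧ G.wt e = w u v
  arc : ∀ (u : Fin n) (e : ℕ), G.off u ≤ e → e < G.off (u + 1) →
    ∃ v : Fin n, G.head e = v ∧ D.Adj u v ∧ G.wt e = w u v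

section

variable {β : Type*} [AddCommMonoid β]

/-- `Walk G B x v c`: there is a walk of weight `c` from `x` to `v` that uses no arc leaving a
vertex of `B`. -/
inductive Walk (G : CSR β) (B : Set ℕ) (x : ℕ) : ℕ → β → Prop where
  | nil : Walk G B x x 0
  | step {u e : ℕ} {c : β} : Walk G B x u c → u ∉ B → u < G.n → G.off u ≤ e → e < G.off (u + 1) →
      Walk G B x (G.head e) (c + G.wt e)

/-- The sum of the arc weights of a path. -/
def pathLen {V : Type*} (w : V → V → β) : List V → β
  | [] => 0
  | [_] => 0
  | a :: b :: l => w a b + pathLen w (b :: l)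

theorem pathLen_concat {V : Type*} (w : V → V → β) (l : List V) (a b : V) :
    pathLen w (l ++ [a] ++ [b]) = pathLen w (l ++ [a]) + w a b := by
  induction l with
  | nil => simp [pathLen]
  | cons c l ih =>
    cases l with
    | nil => simp [pathLen]
    | cons d l =>
      simp only [List.cons_append, pathLen, add_assoc] at ih ⊢
      rw [ih]

variable {n : ℕ} {D : Digraph (Fin n)} {w : Fin n → Fin n → β} {G : CSR β}

/-- Only the vertices that the path leaves are constrained, so its last vertex may lie in `B`. Walks
grow at their end, hence the induction from the back of the list. -/
theorem walk_of_path (hG : Represents G D w) {B : Set ℕ} {x : Fin n} (p : List (Fin n)) :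
    ∀ v : Fin n, p.IsChain D.Adj → p.head? = some x → p.getLast? = some v →
    (∀ z ∈ p.dropLast, (z : ℕ) ∉ B) → Walk G B x v (pathLen w p) := by
  induction p using List.reverseRecOn with
  | nil => simp
  | append_singleton p b ih =>
    intro v hc hh hl hB
    have hb : b = v := by simpa using hl
    subst hb
    rcases List.eq_nil_or_concat p with rfl | ⟨q, a, rfl⟩
    · have : b = x := by simpa using hh
      subst this
      exact .nil
    · rw [List.concat_eq_append] at *
      rw [pathLen_concat]
      have h1 := List.isChain_append.1 hc
      have hab : D.Adj a b := by simpa using h1.2.2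
      obtain ⟨e, he1, he2, he3, he4⟩ := hG.exists_arc a b hab
      rw [← he3, ← he4]
      refine .step (ih a h1.1 ?_ (by simp) ?_) ?_ (by rw [hG.n_eq]; exact a.2) he1 he2
      · cases q <;> simpa using hh
      · intro z hz
        refine hB z ?_
        simp only [List.dropLast_concat, List.mem_append] at hz ⊢
        exact Or.inl hz
      · exact hB a (by simp)

variable [LinearOrder β] [IsOrderedAddMonoid β] [CanonicallyOrderedAdd β]

/-- Nonnegativity of the weights, in the form needed to cut a closed detour off a walk. -/
theorem pathLen_append_le {V : Type*} (w : V → V → β) (l m : List V) :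
    pathLen w l ≤ pathLen w (l ++ m) := by
  induction l with
  | nil => simp [pathLen]
  | cons c l ih =>
    cases l with
    | nil => simp [pathLen]
    | cons d l => simpa [pathLen] using add_le_add_right ih (w c d)

/-- `f` assigns to each vertex its distance from `x` with respect to the walks that use no arc
leaving a vertex of `B`, and `⊤` to the vertices that are not reached by such walks. -/
structure IsDist (G : CSR β) (B : Set ℕ) (x : ℕ) (f : ℕ → WithTop β) : Prop where
  walk : ∀ v < G.n, ∀ c : β, f v = c → Walk G B x v c
  le : ∀ v < G.n, ∀ c : β, Walk G B x v c → f v ≤ c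

/-- If the next vertex of the walk already lies on the path built so far, that path is cut off
there, which does not increase its weight; otherwise the path is extended. The end is the only
vertex that may belong to `B`, because an arc leaves every other one. -/
theorem Walk.exists_path (hG : Represents G D w) {B : Set ℕ} {x : Fin n} {v : ℕ} {c : β}
    (h : Walk G B x v c) :
    ∃ v' : Fin n, v = v' ∧ ∃ p, IsDirectedPath D x v' p ∧ (∀ z ∈ p, z = v' ∨ (z : ℕ) ∉ B) ∧
      pathLen w p ≤ c := by
  induction h with
  | nil => exact ⟨x, rfl, [x], ⟨by simp, by simp, by simp, by simp⟩, by simp, by simp [pathLen]⟩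
  | @step u e c _ huB hu he1 he2 ih =>
    obtain ⟨u', rfl, p, hp, hpB, hpc⟩ := ih
    obtain ⟨v, hv, huv, hw⟩ := hG.arc u' e he1 he2
    refine ⟨v, hv, ?_⟩
    have hB : ∀ z ∈ p, (z : ℕ) ∉ B := by
      intro z hz
      rcases hpB z hz with rfl | h
      · exact huB
      · exact h
    by_cases hvp : v ∈ p
    · obtain ⟨a, b, rfl⟩ := List.append_of_mem hvp
      have e1 : a ++ v :: b = (a ++ [v]) ++ b := by simp
      rw [e1] at hp hpc hB
      refine ⟨a ++ [v], ⟨hp.chain.left_of_append, (List.nodup_append.1 hp.nodup).1, ?_, by simp⟩,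
        ?_, ?_⟩
      · have := hp.head_eq
        cases a <;> simpa using this
      · intro z hz
        exact Or.inr (hB z (by simp only [List.mem_append] at hz ⊢; tauto))
      · exact (pathLen_append_le w _ b).trans (hpc.trans le_self_add)
    · have hne : p ≠ [] := by
        rintro rfl
        simpa using hp.head_eq
      obtain ⟨q, a, rfl⟩ : ∃ q a, p = q ++ [a] := ⟨_, _, (List.dropLast_append_getLast hne).symm⟩
      have ha : a = u' := by simpa using hp.last_eq
      subst ha
      refine ⟨q ++ [a] ++ [v], ⟨?_, ?_, ?_, by simp⟩, ?_, ?_⟩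
      · refine List.isChain_append.2 ⟨hp.chain, by simp, ?_⟩
        simp
        exact huv
      · refine List.nodup_append.2 ⟨hp.nodup, by simp, ?_⟩
        intro z hz b hb
        simp only [List.mem_singleton] at hb
        subst hb
        rintro rfl
        exact hvp hz
      · have := hp.head_eq
        cases q <;> simpa using this
      · intro z hz
        rw [List.mem_append, List.mem_singleton] at hz
        rcases hz with hz | hz
        · exact Or.inr (hB z hz)
        · exact Or.inl hz
      · rw [pathLen_concat, hw]
        exact add_le_add_left hpc _

/-- A path from x to y that meets S only in its ends is a walk for `g`, and if it is shortest, its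
weight is at most `f y`. Conversely, a path extracted from an optimal walk for `g` avoids S between
its ends, and `g y ≤ f y` makes it shortest among all paths. The case y = x is included. -/
theorem isShortestPath_iff_dist (hG : Represents G D w) {S : Finset (Fin n)} {x y : Fin n}
    (hx : x ∈ S) (hy : y ∈ S) {f g : ℕ → WithTop β} (hf : IsDist G ∅ x f)
    (hg : IsDist G {v | v ≠ x ∧ ∃ z ∈ S, (z : ℕ) = v} x g) :
    (∃ p, IsShortestPath D (pathLen w) x y p ∧ (S : Set (Fin n)) ∩ {z | z ∈ p} = {x, y}) ↔
      g y ≠ ⊤ ∧ g y ≤ f y := by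
  have hn : (y : ℕ) < G.n := by rw [hG.n_eq]; exact y.2
  constructor
  · rintro ⟨p, ⟨hp, hmin⟩, hS⟩
    have hw : g y ≤ pathLen w p := by
      refine hg.le y hn _ (walk_of_path hG p y hp.chain hp.head_eq hp.last_eq ?_)
      rintro z hz ⟨hzx, z', hz', hzz⟩
      have hz'' : z' = z := Fin.ext hzz
      subst hz''
      -- A vertex of S \ {x} that the path leaves would have to be y; but y is the last vertex and
      -- occurs only once.
      have : z' ∈ (S : Set (Fin n)) ∩ {z | z ∈ p} := ⟨hz', List.dropLast_subset _ hz⟩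
      rw [hS] at this
      rcases this with h | h
      · exact hzx (by rw [h])
      · simp only [Set.mem_singleton_iff] at h
        subst h
        have hne : p ≠ [] := by rintro rfl; simp at hz
        obtain ⟨q, a, rfl⟩ : ∃ q a, p = q ++ [a] :=
          ⟨_, _, (List.dropLast_append_getLast hne).symm⟩
        have ha : a = z' := by simpa using hp.last_eq
        subst ha
        have := List.nodup_append.1 hp.nodup
        simp only [List.dropLast_concat] at hz
        exact this.2.2 a hz a (by simp) rfl
    refine ⟨fun h => by simp [h] at hw, hw.trans ?_⟩
    cases hfy : f y with
    | top => simp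
    | coe c =>
      obtain ⟨v, hv, q, hq, -, hqc⟩ := (hf.walk y hn c hfy).exists_path hG
      have : y = v := Fin.ext hv
      subst this
      exact_mod_cast (hmin q hq).trans hqc
  · rintro ⟨h1, h2⟩
    obtain ⟨c, hc⟩ := WithTop.ne_top_iff_exists.1 h1
    obtain ⟨v, hv, p, hp, hpB, hpc⟩ := (hg.walk y hn c hc.symm).exists_path hG
    have : y = v := Fin.ext hv
    subst this
    refine ⟨p, ⟨hp, fun q hq => ?_⟩, ?_⟩
    · have h3 := hf.le y hn _ (walk_of_path hG q y hq.chain hq.head_eq hq.last_eq (by simp))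
      rw [← hc] at h2
      exact hpc.trans (by exact_mod_cast h2.trans h3)
    · ext z
      constructor
      · rintro ⟨hzS, hzp⟩
        rcases hpB z hzp with h | h
        · exact Or.inr h
        · left
          by_contra hzx
          exact h ⟨fun h' => hzx (Fin.ext h'), z, hzS, rfl⟩
      · rintro (h | h)
        · rw [h]; exact ⟨hx, List.mem_of_mem_head? hp.head_eq⟩
        · rw [h]; exact ⟨hy, List.mem_of_getLast? hp.last_eq⟩

end

/-- The ends of a path between vertices of S lie in S, so the condition on the union is equivalent
to the same condition on each path; and the path Q for (x, y) may serve as the path P for (y, x). -/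
theorem isMutualVisibilitySet_iff {β V : Type*} [LE β] {D : Digraph V} {len : List V → β}
    {S : Set V} : IsMutualVisibilitySet D len S ↔ ∀ x ∈ S, ∀ y ∈ S,
      ∃ p, IsShortestPath D len x y p ∧ S ∩ {z | z ∈ p} = {x, y} := by
  constructor
  · intro h x hx y hy
    obtain ⟨P, Q, hP, -, hS⟩ := h x hx y hy
    refine ⟨P, hP, subset_antisymm (hS ▸ Set.subset_union_left) ?_⟩
    rintro z (hz | hz)
    · rw [hz]; exact ⟨hx, List.mem_of_mem_head? hP.1.head_eq⟩
    · rw [hz]; exact ⟨hy, List.mem_of_getLast? hP.1.last_eq⟩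
  · intro h x hx y hy
    obtain ⟨P, hP, hPS⟩ := h x hx y hy
    obtain ⟨Q, hQ, hQS⟩ := h y hy x hx
    exact ⟨P, Q, hP, hQ, by rw [hPS, hQS, Set.pair_comm y x, Set.union_self]⟩

theorem numArcs_eq_pathLen {V : Type*} (p : List V) : numArcs p = pathLen (fun _ _ => 1) p := by
  induction p with
  | nil => rfl
  | cons a p ih =>
    cases p with
    | nil => rfl
    | cons b l =>
      simp only [pathLen, ← ih]
      simp [numArcs, add_comm]

theorem pathWeight_eq_pathLen {V : Type*} (w : V → V → ℝ≥0) (p : List V) :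
    pathWeight w p = pathLen w p := by
  induction p with
  | nil => rfl
  | cons a p ih =>
    cases p with
    | nil => rfl
    | cons b l => simp only [pathLen, pathWeight, ih]

/-! ## Label-setting computation of distances -/

section Labels

variable {β : Type*} [AddCommMonoid β] [LinearOrder β] [IsOrderedAddMonoid β]
  [CanonicallyOrderedAdd β]

/-- The invariant of the label-setting algorithm: `f` are the labels, `P` is the set of the labelled
vertices that have not been scanned, `done` is the set of the vertices whose scan has begun, `u` is
the last of them, `cur` bounds their labels and the arcs of `u` from number `e` on have not been
relaxed. -/
structure Labels (G : CSR β) (B : Set ℕ) (x : ℕ) (f : ℕ → WithTop β) (P done : Finset ℕ) (cur : β)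
    (u e : ℕ) : Prop where
  walk : ∀ v < G.n, ∀ c : β, f v = c → Walk G B x v c
  source : f x ≤ (0 : β)
  mem_iff : ∀ v < G.n, v ∈ P ↔ f v ≠ ⊤ ∧ v ∉ done
  lt : ∀ v ∈ P, v < G.n
  done_lt : ∀ v ∈ done, v < G.n
  done_le : ∀ v ∈ done, f v ≤ cur
  le : ∀ v ∈ P, cur ≤ f v
  relaxed : ∀ v ∈ done, v ∉ B → ∀ a, G.off v ≤ a → a < G.off (v + 1) → ¬ (v = u ∧ e ≤ a) →
    ∀ c : β, f v = c → f (G.head a) ≤ (c + G.wt a : β)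

variable {G : CSR β} {B : Set ℕ} {x : ℕ} {f : ℕ → WithTop β} {P done : Finset ℕ} {cur : β}
  {u e : ℕ}

theorem Labels.init (G : CSR β) (B : Set ℕ) {x : ℕ} (hx : x < G.n) :
    Labels G B x (Function.update (fun _ => ⊤) x ((0 : β) : WithTop β)) {x} ∅ 0 0 0 where
  walk v _ c h := by
    by_cases hv : v = x
    · subst hv
      rw [Function.update_self] at h
      rw [← WithTop.coe_inj.1 h]
      exact .nil
    · rw [Function.update_of_ne hv] at h
      simp at h
  source := by simp
  mem_iff v _ := by
    by_cases hv : v = x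
    · subst hv; simp
    · simp [hv]
  lt := by simpa using hx
  done_lt := by simp
  done_le := by simp
  le := by simp
  relaxed := by simp

/-- The hypothesis `hu` says that the previous scan is complete or was not required, so nothing is
lost when the single exception in `relaxed` is handed over to the new vertex. -/
theorem Labels.extract (h : Labels G B x f P done cur u e) (hu : u ∈ done → G.off (u + 1) ≤ e ∨ u ∈ B)
    {u' : ℕ} (hu' : u' ∈ P) {c : β} (hc : f u' = c) (hmin : ∀ v ∈ P, f u' ≤ f v) :
    Labels G B x f (P.erase u') (insert u' done) c u' (G.off u') where
  walk := h.walk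
  source := h.source
  mem_iff v hv := by
    rw [Finset.mem_erase, h.mem_iff v hv, Finset.mem_insert]
    tauto
  lt v hv := h.lt v (Finset.mem_of_mem_erase hv)
  done_lt v hv := by
    rcases Finset.mem_insert.1 hv with rfl | hv
    · exact h.lt _ hu'
    · exact h.done_lt v hv
  done_le v hv := by
    rcases Finset.mem_insert.1 hv with rfl | hv
    · exact hc.le
    · exact (h.done_le v hv).trans ((h.le u' hu').trans hc.le)
  le v hv := hc ▸ hmin v (Finset.mem_of_mem_erase hv)
  relaxed v hv hB a h1 h2 h3 := by
    rcases Finset.mem_insert.1 hv with rfl | hv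
    · exact absurd ⟨rfl, h1⟩ h3
    · refine h.relaxed v hv hB a h1 h2 ?_
      rintro ⟨rfl, h4⟩
      rcases hu hv with h5 | h5
      · omega
      · exact hB h5

/-- The precondition of the queue operation `relax`: a vertex that has left the queue is never
improved, so a queue does not have to support reinsertion. -/
theorem Labels.head_cases (h : Labels G B x f P done cur u e) {v : ℕ} (hv : v < G.n) (b : β) :
    v ∈ P ∨ f v = ⊤ ∨ f v ≤ (cur + b : β) := by
  by_cases h1 : f v = ⊤
  · exact Or.inr (Or.inl h1)
  by_cases h2 : v ∈ done
  · exact Or.inr (Or.inr ((h.done_le v h2).trans (by exact_mod_cast le_self_add)))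
  · exact Or.inl ((h.mem_iff v hv).2 ⟨h1, h2⟩)

theorem Labels.relax (h : Labels G B x f P done cur u e) (hu : u ∈ done) (huB : u ∉ B)
    (hcur : f u = cur) (he : G.off u ≤ e) (he' : e < G.off (u + 1)) (hn : G.head e < G.n) :
    Labels G B x (Function.update f (G.head e) (min (f (G.head e)) (cur + G.wt e : β)))
      (if ((cur + G.wt e : β) : WithTop β) < f (G.head e) then insert (G.head e) P else P) done cur u
      (e + 1) := by
  set v := G.head e with hv
  set b : β := cur + G.wt e with hb
  have hw : Walk G B x v b := (h.walk u (h.done_lt u hu) cur hcur).step huB (h.done_lt u hu) he he'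
  by_cases hlt : (b : WithTop β) < f v
  · rw [if_pos hlt, min_eq_right hlt.le]
    -- Labels of `done` are at most `cur`, and adding a weight to `cur` does not decrease it; hence
    -- an improved vertex is not in `done`.
    have hvd : v ∉ done := fun hvd =>
      not_lt.2 ((h.done_le v hvd).trans (by exact_mod_cast le_self_add)) hlt
    have hle : ∀ z, Function.update f v (b : WithTop β) z ≤ f z := by
      intro z
      by_cases hz : z = v
      · subst hz; simpa using hlt.le
      · rw [Function.update_of_ne hz]
    refine ⟨?_, (hle x).trans h.source, ?_, ?_, h.done_lt, ?_, ?_, ?_⟩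
    · intro z hz c hc
      by_cases hzv : z = v
      · subst hzv
        rw [Function.update_self] at hc
        rwa [← WithTop.coe_inj.1 hc]
      · rw [Function.update_of_ne hzv] at hc
        exact h.walk z hz c hc
    · intro z hz
      by_cases hzv : z = v
      · subst hzv; simpa using hvd
      · rw [Function.update_of_ne hzv, Finset.mem_insert, ← h.mem_iff z hz]
        tauto
    · intro z hz
      rcases Finset.mem_insert.1 hz with rfl | hz
      · exact hn
      · exact h.lt z hz
    · exact fun z hz => (hle z).trans (h.done_le z hz)
    · intro z hz
      by_cases hzv : z = v
      · subst hzv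
        rw [Function.update_self]
        exact_mod_cast le_self_add
      · rw [Function.update_of_ne hzv]
        exact h.le z ((Finset.mem_insert.1 hz).resolve_left hzv)
    · intro z hz hB a h1 h2 h3 c hc
      have hzv : z ≠ v := by rintro rfl; exact hvd hz
      rw [Function.update_of_ne hzv] at hc
      -- The arc that has just been relaxed is the only one whose inequality is new; for the others
      -- labels have only decreased at the heads.
      by_cases hae : z = u ∧ a = e
      · obtain ⟨rfl, rfl⟩ := hae
        have : c = cur := WithTop.coe_inj.1 (hc.symm.trans hcur)
        rw [this, ← hv, Function.update_self]
      · refine (hle _).trans (h.relaxed z hz hB a h1 h2 ?_ c hc)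
        omega
  · rw [if_neg hlt, min_eq_left (not_lt.1 hlt), Function.update_eq_self]
    refine { h with relaxed := ?_ }
    intro z hz hB a h1 h2 h3 c hc
    by_cases hae : z = u ∧ a = e
    · obtain ⟨rfl, rfl⟩ := hae
      have : c = cur := WithTop.coe_inj.1 (hc.symm.trans hcur)
      rw [this]
      exact not_lt.1 hlt
    · refine h.relaxed z hz hB a h1 h2 ?_ c hc
      omega

/-- When the queue is empty, every vertex with a finite label has been scanned unless it is in `B`.
So the inequality between label and weight propagates along any admissible walk. -/
theorem Labels.isDist (h : Labels G B x f ∅ done cur u e)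
    (hu : u ∈ done → G.off (u + 1) ≤ e ∨ u ∈ B) : IsDist G B x f := by
  refine ⟨h.walk, fun v _ c hw => ?_⟩
  clear * - h hw hu
  induction hw with
  | nil => exact h.source
  | @step z a c _ hB hz h1 h2 ih =>
    have hne : f z ≠ ⊤ := fun ht => by simp [ht] at ih
    obtain ⟨c', hc'⟩ := WithTop.ne_top_iff_exists.1 hne
    have hd : z ∈ done := by
      by_contra hd
      simpa using (h.mem_iff z hz).2 ⟨hne, hd⟩
    refine (h.relaxed z hd hB a h1 h2 ?_ c' hc'.symm).trans ?_
    · rintro ⟨rfl, h3⟩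
      rcases hu hd with h4 | h4
      · omega
      · exact hB h4
    · rw [← hc'] at ih
      have : c' ≤ c := by exact_mod_cast ih
      exact_mod_cast add_le_add_left this _

end Labels

/-! ## The algorithm over an abstract priority queue -/

/-- The operations of a priority queue whose elements are vertices. Register `4` holds the source,
`5` an arc, `9` a vertex (the end of this arc in `relax`), `10` the extracted vertex; register `11`
tells whether a vertex was extracted. -/
structure QueueProgs where
  init : Prog
  extract : Prog
  relax : Prog
  save : Prog
  compare : Prog

/-- The memory holds the compressed digraph `G`. -/
structure Input {β : Type*} (G : CSR β) (wtOk : (ℕ → ℝ≥0) → Prop) (s : State) : Prop where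
  n : s.reg 0 = G.n
  zero : s.reg 2 = 0
  off : s.arr 0 = G.off
  head : s.arr 1 = G.head
  wt : wtOk (s.warr 0)

section

variable {β : Type*} [AddCommMonoid β] [LinearOrder β] [IsOrderedAddMonoid β]
  [CanonicallyOrderedAdd β]

/-- The specification of a priority queue on the digraph `G`: extractions have amortized cost `L`,
the other operations `c`. In `A j f P cur k s`, the number `j` counts the calls of `relax`, `f` are
the labels, `P` is the set of vertices in the queue, `cur` is the label of the last extracted vertex
and `k` is the potential of the queue. -/
structure QueueSpec (q : QueueProgs) (G : CSR β) (wtOk : (ℕ → ℝ≥0) → Prop) (c L : ℕ) where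
  A : ℕ → (ℕ → WithTop β) → Finset ℕ → β → ℕ → State → Prop
  Saved : State → ℕ → WithTop β → Prop
  congr : ∀ {j f P cur k s s'}, A j f P cur k s → SameQueue s s' → A j f P cur k s'
  idle : ∀ {j f P cur k s}, A j f P cur k s → ∀ r, s.arr 15 r = 0
  saved_congr : ∀ {s s' y g}, Saved s y g → s'.arr 4 = s.arr 4 → s'.arr 5 = s.arr 5 →
    s'.warr 1 = s.warr 1 → Saved s' y g
  init : ∀ {T s K}, Input G wtOk s → (∀ r, s.arr 15 r = 0) → s.reg 4 < G.n →
    K + c * (G.n + 1) ≤ T → WP q.init (fun T' s' => SameMain s s' ∧ ∃ k,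
      A 0 (Function.update (fun _ => ⊤) (s.reg 4) ((0 : β) : WithTop β)) {s.reg 4} 0 k s' ∧
        K + k ≤ T') T s
  extract : ∀ {T s K j f P cur k}, Input G wtOk s → A j f P cur k s → j ≤ G.off G.n →
    K + k + L ≤ T → WP q.extract (fun T' s' => SameMain s s' ∧
      ((P = ∅ ∧ s'.reg 11 = 0 ∧ (∃ b k', A j f P b k' s') ∧ K ≤ T') ∨
        ∃ u ∈ P, s'.reg 10 = u ∧ 0 < s'.reg 11 ∧ (∀ v ∈ P, f u ≤ f v) ∧ ∃ k' b, f u = (b : β) ∧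
          A j f (P.erase u) b k' s' ∧ K + k' ≤ T')) T s
  relax : ∀ {T s K j f P cur k}, Input G wtOk s → A j f P cur k s → s.reg 5 < G.off G.n →
    s.reg 9 = G.head (s.reg 5) → s.reg 9 < G.n →
    (s.reg 9 ∈ P ∨ f (s.reg 9) = ⊤ ∨ f (s.reg 9) ≤ (cur + G.wt (s.reg 5) : β)) →
    K + k + c ≤ T → WP q.relax (fun T' s' => SameMain s s' ∧ s'.reg 10 = s.reg 10 ∧ ∃ k',
      A (j + 1) (Function.update f (s.reg 9) (min (f (s.reg 9)) (cur + G.wt (s.reg 5) : β)))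
        (if ((cur + G.wt (s.reg 5) : β) : WithTop β) < f (s.reg 9) then insert (s.reg 9) P else P)
        cur k' s' ∧ K + k' ≤ T') T s
  save : ∀ {T s j f P cur k}, Input G wtOk s → A j f P cur k s → s.reg 9 < G.n → c ≤ T →
    WP q.save (fun T' s' => SameQueue s s' ∧ (∀ r < 8, s'.reg r = s.reg r) ∧
      (∀ a < 4, s'.arr a = s.arr a) ∧ s'.warr 0 = s.warr 0 ∧ Saved s' (s.reg 9) (f (s.reg 9)) ∧
      (∀ z ≠ s.reg 9, ∀ g, Saved s z g → Saved s' z g) ∧ T ≤ T' + c) T s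
  compare : ∀ {T s j f P cur k g}, Input G wtOk s → A j f P cur k s → s.reg 9 < G.n →
    Saved s (s.reg 9) g → f (s.reg 9) ≥ g → c ≤ T →
    WP q.compare (fun T' s' => SameQueue s s' ∧ (∀ r < 8, s'.reg r = s.reg r) ∧
      (∀ a < 8, s'.arr a = s.arr a) ∧ (∀ a < 2, s'.warr a = s.warr a) ∧
      (0 < s'.reg 8 ↔ f (s.reg 9) ≠ ⊤ ∧ f (s.reg 9) ≤ g) ∧ T ≤ T' + c) T s

/-- Relax all arcs that leave the extracted vertex. -/
def scan (q : QueueProgs) : Prog :=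
  seqs [block [.load 5 0 10, .copy 6 10, .succ 6, .load 6 0 6],
    .loop (.lt 5 6) (seqs [block [.load 9 1 5], q.relax, block [.succ 5]])]

/-- Compute the distances from the vertex in register `4` with respect to the walks that use no arc
leaving a vertex that is marked in array `3`. -/
def sssp (q : QueueProgs) : Prog :=
  seqs [q.init, q.extract, .loop (.lt 2 11)
    (seqs [block [.load 8 3 10], .branch (.eq 8 2) (scan q) (block []), q.extract])]

/-- Remove all marks. -/
def clearMarks : Prog :=
  seqs [block [.const 5 0], .loop (.lt 5 0) (block [.store 3 5 2, .succ 5])]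

/-- Save the labels of the vertices of the candidate set and mark these vertices. -/
def saveAll (q : QueueProgs) : Prog :=
  seqs [block [.const 5 0, .const 6 1], .loop (.lt 5 1)
    (seqs [block [.load 9 2 5, .store 3 9 6], q.save, block [.succ 5]])]

/-- Compare the labels of the vertices of the candidate set with the saved ones. -/
def compareAll (q : QueueProgs) : Prog :=
  seqs [block [.const 5 0], .loop (.lt 5 1)
    (seqs [block [.load 9 2 5], q.compare, .branch (.lt 2 8) (block []) (block [.const 7 0]),
      block [.succ 5]])]

/-- Test whether the vertex number `i` of the candidate set, where `i` is in register `3`, sees all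
vertices of the candidate set. -/
def testVertex (q : QueueProgs) : Prog :=
  seqs [block [.load 4 2 3], clearMarks, sssp q, saveAll q, block [.store 3 4 2], sssp q,
    compareAll q, block [.succ 3]]

/-- Decide whether the candidate set is a mutual-visibility set. -/
def decideMV (q : QueueProgs) : Prog :=
  seqs [block [.const 3 0, .const 7 1], .loop (.lt 3 1) (testVertex q), block [.copy 0 7]]

/-- The memories agree on the data that the computation of distances leaves unchanged. -/
structure SameData (s s' : State) : Prop where
  reg : ∀ r < 10, r ≠ 5 → r ≠ 6 → r ≠ 8 → r ≠ 9 → s'.reg r = s.reg r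
  arr : ∀ a < 8, s'.arr a = s.arr a
  warr : ∀ a < 2, s'.warr a = s.warr a

theorem SameData.trans {s s' s'' : State} (h : SameData s s') (h' : SameData s' s'') :
    SameData s s'' :=
  ⟨fun r h1 h2 h3 h4 h5 => (h'.reg r h1 h2 h3 h4 h5).trans (h.reg r h1 h2 h3 h4 h5),
    fun r hr => (h'.arr r hr).trans (h.arr r hr), fun r hr => (h'.warr r hr).trans (h.warr r hr)⟩

theorem SameMain.sameData {s s' : State} (h : SameMain s s') : SameData s s' :=
  ⟨fun r hr _ _ _ _ => h.reg r hr, h.arr, h.warr⟩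

theorem SameData.input {G : CSR β} {wtOk : (ℕ → ℝ≥0) → Prop} {s s' : State} (h : SameData s s')
    (hs : Input G wtOk s) : Input G wtOk s' :=
  ⟨by rw [h.reg 0 (by simp) (by simp) (by simp) (by simp) (by simp), hs.n],
    by rw [h.reg 2 (by simp) (by simp) (by simp) (by simp) (by simp), hs.zero],
    by rw [h.arr 0 (by simp), hs.off], by rw [h.arr 1 (by simp), hs.head],
    by rw [h.warr 0 (by simp)]; exact hs.wt⟩

variable {q : QueueProgs} {G : CSR β} {wtOk : (ℕ → ℝ≥0) → Prop} {c L : ℕ}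

theorem CSR.Valid.off_le (hG : G.Valid) {u v : ℕ} (huv : u ≤ v) (hv : v ≤ G.n) :
    G.off u ≤ G.off v := by
  induction v, huv using Nat.le_induction with
  | base => rfl
  | succ v _ ih => exact (ih (by omega)).trans (hG.mono v (by omega))

theorem CSR.Valid.sum_deg_le (hG : G.Valid) :
    ∑ u ∈ Finset.range G.n, (G.off (u + 1) - G.off u) ≤ G.off G.n := by
  have h : ∀ v ≤ G.n, ∑ u ∈ Finset.range v, (G.off (u + 1) - G.off u) ≤ G.off v := by
    intro v hv
    induction v with
    | zero => simp
    | succ v ih =>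
      rw [Finset.sum_range_succ]
      have := ih (by omega)
      have := hG.mono v (by omega)
      omega
  exact h _ le_rfl

/-- Each arc is charged `c + 5`: the relaxation, the loop test, and two blocks of one instruction.
The 6 covers the initial block and the last loop test. -/
theorem wp_scan (hq : QueueSpec q G wtOk c L) (hG : G.Valid) {B : Set ℕ} {x : ℕ} {T K j k : ℕ}
    {s : State} {f : ℕ → WithTop β} {P done : Finset ℕ} {cur : β} {u : ℕ} (hs : Input G wtOk s)
    (hA : hq.A j f P cur k s) (hd : Labels G B x f P done cur u (G.off u)) (hu : u ∈ done)
    (hcur : f u = cur) (huB : u ∉ B) (hreg : s.reg 10 = u)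
    (hT : K + k + 6 + (c + 5) * (G.off (u + 1) - G.off u) ≤ T) :
    WP (scan q) (fun T' s' => SameData s s' ∧ ∃ k' f' P',
      hq.A (j + (G.off (u + 1) - G.off u)) f' P' cur k' s' ∧
        Labels G B x f' P' done cur u (G.off (u + 1)) ∧ K + k' ≤ T') T s := by
  have hun := hd.done_lt u hu
  have hmono := hG.mono u hun
  refine wp_seq (wp_block (by simp; omega) ?_)
  generalize hs1 : runs _ s = s1
  have h5 : s1.reg 5 = G.off u := by rw [← hs1]; simp [runs, Instr.run, hreg, hs.off]
  have h6 : s1.reg 6 = G.off (u + 1) := by rw [← hs1]; simp [runs, Instr.run, hreg, hs.off]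
  have hM : SameData s s1 := by
    rw [← hs1]
    refine ⟨?_, fun _ _ => rfl, fun _ _ => rfl⟩
    intro r h1 h2 h3 h4 h5
    simp [runs, Instr.run, h2, h3]
  have hQ : SameQueue s s1 := by
    rw [← hs1]
    refine ⟨?_, fun _ _ => rfl, fun _ _ => rfl, rfl⟩
    intro r hr
    simp [runs, Instr.run, show r ≠ 5 by omega, show r ≠ 6 by omega]
  refine wp_loop (fun T s' => SameData s s' ∧ s'.reg 10 = u ∧ s'.reg 6 = G.off (u + 1) ∧
    G.off u ≤ s'.reg 5 ∧ s'.reg 5 ≤ G.off (u + 1) ∧ ∃ k' f' P',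
      hq.A (j + (s'.reg 5 - G.off u)) f' P' cur k' s' ∧
      Labels G B x f' P' done cur u (s'.reg 5) ∧ f' u = cur ∧
      K + k' + 1 + (c + 5) * (G.off (u + 1) - s'.reg 5) ≤ T) ?_ ?_
  · refine ⟨hM, by rw [hQ.reg 10 (by simp), hreg], h6, h5.ge, by omega, k, f, P, ?_, ?_, hcur, ?_⟩
    · rw [h5, Nat.sub_self]; exact hq.congr hA hQ
    · rw [h5]; exact hd
    · rw [h5]; simp; omega
  · clear hM hQ h5 h6 hs1
    rintro T s2 ⟨hM, h10, h6, hlo, hhi, k', f', P', hA', hd', hc', hT'⟩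
    refine ⟨by omega, fun hb => ?_, fun hb => ?_⟩
    · simp only [Test.Holds] at hb
      have hlt : s2.reg 5 < G.off (u + 1) := by omega
      have hm : s2.reg 5 < G.off G.n := hlt.trans_le (hG.off_le (by omega) le_rfl)
      obtain ⟨d, hdd⟩ : ∃ d, G.off (u + 1) - s2.reg 5 = d + 1 := ⟨_, (Nat.succ_pred (by omega)).symm⟩
      rw [hdd, mul_add, mul_one] at hT'
      refine wp_seq (wp_block (by simp; omega) ?_)
      generalize hs3 : runs _ s2 = s3
      have i9 : s3.reg 9 = G.head (s2.reg 5) := by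
        rw [← hs3]; simp [runs, Instr.run, (hM.input hs).head]
      have i5 : s3.reg 5 = s2.reg 5 := by rw [← hs3]; simp [runs, Instr.run]
      have i6 : s3.reg 6 = s2.reg 6 := by rw [← hs3]; simp [runs, Instr.run]
      have iM : SameData s2 s3 := by
        rw [← hs3]
        refine ⟨?_, fun _ _ => rfl, fun _ _ => rfl⟩
        intro r h1 h2 h3 h4 h5
        simp [runs, Instr.run, h5]
      have iQ : SameQueue s2 s3 := by
        rw [← hs3]
        refine ⟨?_, fun _ _ => rfl, fun _ _ => rfl, rfl⟩
        intro r hr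
        simp [runs, Instr.run, show r ≠ 9 by omega]
      have hn : G.head (s2.reg 5) < G.n := hG.head_lt _ hm
      refine wp_seq (WP.mono (hq.relax (K := K + 3 + (c + 5) * d) ((hM.trans iM).input hs)
        (hq.congr hA' iQ) (by rw [i5]; exact hm) (by rw [i9, i5]) (by rw [i9]; exact hn)
        (by rw [i9]; exact hd'.head_cases hn _) (by simp; omega)) ?_)
      rintro T4 s4 ⟨jM, j10, k4, hA4, hT4⟩
      refine wp_block (by simp; omega) ?_
      generalize hs5 : runs _ s4 = s5
      have l5 : s5.reg 5 = s2.reg 5 + 1 := by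
        rw [← hs5]; simp [runs, Instr.run, jM.reg 5, i5]
      have l6 : s5.reg 6 = s2.reg 6 := by
        rw [← hs5]; simp [runs, Instr.run, jM.reg 6, i6]
      have lM : SameData s4 s5 := by
        rw [← hs5]
        refine ⟨?_, fun _ _ => rfl, fun _ _ => rfl⟩
        intro r h1 h2 h3 h4 h5
        simp [runs, Instr.run, h2]
      have lQ : SameQueue s4 s5 := by
        rw [← hs5]
        refine ⟨?_, fun _ _ => rfl, fun _ _ => rfl, rfl⟩
        intro r hr
        simp [runs, Instr.run, show r ≠ 5 by omega]
      rw [i9, i5] at hA4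
      have hr := hd'.relax hu huB hc' hlo hlt hn
      have hA5 := hq.congr hA4 lQ
      rw [show j + (s2.reg 5 - G.off u) + 1 = j + (s5.reg 5 - G.off u) by omega] at hA5
      refine ⟨hM.trans (iM.trans (jM.sameData.trans lM)), ?_, by omega, by omega, by omega, k4, _, _,
        hA5, ?_, ?_, ?_⟩
      · rw [lQ.reg 10 (by simp), j10, iQ.reg 10 (by simp), h10]
      · rw [l5]; exact hr
      -- Even an arc whose head is `u` could not change the label of `u`, since `cur` is at most
      -- `cur` plus a weight.
      · by_cases huv : u = G.head (s2.reg 5)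
        · rw [← huv, Function.update_self, hc', min_eq_left]
          exact_mod_cast le_self_add
        · rw [Function.update_of_ne huv, hc']
      · have : G.off (u + 1) - s5.reg 5 = d := by omega
        rw [this]
        simp only [List.length_cons, List.length_nil]
        omega
    · simp only [Test.Holds] at hb
      have h5 : s2.reg 5 = G.off (u + 1) := by omega
      rw [h5] at hA' hd'
      exact ⟨hM, k', f', P', hA', hd', by omega⟩

end

/-! ### Cost and correctness of one distance computation -/

section

variable {β : Type*} [AddCommMonoid β] [LinearOrder β] [IsOrderedAddMonoid β]
  [CanonicallyOrderedAdd β] {q : QueueProgs} {G : CSR β} {wtOk : (ℕ → ℝ≥0) → Prop} {c L : ℕ}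

/-- The invariant of the main loop of `sssp`, at a moment when `extract` has just been called. -/
def SsspInv (hq : QueueSpec q G wtOk c L) (B : Set ℕ) (x K : ℕ) (s₀ : State) (T : ℕ) (s : State) :
    Prop :=
  SameData s₀ s ∧ ∃ j f P cur k done u, hq.A j f P cur k s ∧
    ((s.reg 11 = 0 ∧ K + 1 ≤ T ∧ IsDist G B x f) ∨
      (0 < s.reg 11 ∧ s.reg 10 = u ∧ u ∈ done ∧ f u = (cur : β) ∧
        Labels G B x f P done cur u (G.off u) ∧
        j + (G.off (u + 1) - G.off u) +
          ∑ v ∈ Finset.range G.n \ done, (G.off (v + 1) - G.off v) ≤ G.off G.n ∧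
        K + k + ((c + 5) * (G.off (u + 1) - G.off u) + (L + 12)) + 1 +
          ∑ v ∈ Finset.range G.n \ done, ((c + 5) * (G.off (v + 1) - G.off v) + (L + 12)) ≤ T))

/-- Both sums run over the vertices not yet extracted and reserve, for each of them, its out-degree
in the count of relaxations and the cost of its scan and of the next extraction. An extraction takes
the share of one vertex out of the sums and makes it available for this vertex. -/
theorem wp_extract_ssspInv (hq : QueueSpec q G wtOk c L) {B : Set ℕ} {x K : ℕ} {s₀ : State}
    {T : ℕ} {s : State} (h₀ : Input G wtOk s₀) (hs : SameData s₀ s) {j k : ℕ}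
    {f : ℕ → WithTop β} {P done : Finset ℕ} {cur : β} {u e : ℕ} (hA : hq.A j f P cur k s)
    (hd : Labels G B x f P done cur u e) (hu : u ∈ done → G.off (u + 1) ≤ e ∨ u ∈ B)
    (hj : j + ∑ v ∈ Finset.range G.n \ done, (G.off (v + 1) - G.off v) ≤ G.off G.n)
    (hT : K + 1 + ∑ v ∈ Finset.range G.n \ done, ((c + 5) * (G.off (v + 1) - G.off v) + (L + 12)) +
      k + L ≤ T) :
    WP q.extract (SsspInv hq B x K s₀) T s := by
  refine (hq.extract (hs.input h₀) hA (by omega) hT).mono ?_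
  rintro T' s' ⟨hM, ⟨rfl, h11, ⟨b, k', hA'⟩, hT'⟩ | ⟨u', hu', h10, h11, hmin, k', b, hb, hA', hT'⟩⟩
  · exact ⟨hs.trans hM.sameData, j, f, ∅, b, k', done, u, hA', Or.inl ⟨h11, by omega,
      hd.isDist hu⟩⟩
  · refine ⟨hs.trans hM.sameData, j, f, _, b, k', insert u' done, u', hA', Or.inr ⟨h11, h10,
      by simp, hb, hd.extract hu hu' hb hmin, ?_, ?_⟩⟩
    · have hmem : u' ∈ Finset.range G.n \ done := Finset.mem_sdiff.2
        ⟨Finset.mem_range.2 (hd.lt u' hu'), ((hd.mem_iff u' (hd.lt u' hu')).1 hu').2⟩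
      rw [← Finset.add_sum_erase _ _ hmem, ← Finset.sdiff_insert] at hj
      omega
    · have hmem : u' ∈ Finset.range G.n \ done := Finset.mem_sdiff.2
        ⟨Finset.mem_range.2 (hd.lt u' hu'), ((hd.mem_iff u' (hd.lt u' hu')).1 hu').2⟩
      rw [← Finset.add_sum_erase _ _ hmem, ← Finset.sdiff_insert] at hT'
      omega

/-- Each vertex is extracted at most once, so the out-degrees add up to at most the number of arcs,
and one further extraction finds the queue empty. The count `j` of relaxations is tracked because
the cost of an extraction may depend on a bound for it. -/
theorem wp_sssp (hq : QueueSpec q G wtOk c L) (hG : G.Valid) {B : Set ℕ} {T K : ℕ} {s : State}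
    (hs : Input G wtOk s) (hidle : ∀ r, s.arr 15 r = 0) (hx : s.reg 4 < G.n)
    (hB : ∀ v < G.n, v ∈ B ↔ s.arr 3 v ≠ 0)
    (hT : K + (c + 5) * G.off G.n + (c + L + 12) * (G.n + 1) ≤ T) :
    WP (sssp q) (fun T' s' => SameData s s' ∧ K ≤ T' ∧ ∃ j f P cur k, hq.A j f P cur k s' ∧
      IsDist G B (s.reg 4) f) T s := by
  have hsum : ∑ v ∈ Finset.range G.n \ ∅, ((c + 5) * (G.off (v + 1) - G.off v) + (L + 12)) ≤
      (c + 5) * G.off G.n + (L + 12) * G.n := by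
    rw [Finset.sdiff_empty, Finset.sum_add_distrib, ← Finset.mul_sum]
    simp only [Finset.sum_const, Finset.card_range, smul_eq_mul]
    rw [mul_comm G.n]
    exact Nat.add_le_add_right (Nat.mul_le_mul_left _ hG.sum_deg_le) _
  refine wp_seq ((hq.init (K := K + 1 + L + ((c + 5) * G.off G.n + (L + 12) * G.n)) hs hidle hx
    (by nlinarith)).mono ?_)
  rintro T1 s1 ⟨hM1, k1, hA1, hT1⟩
  refine wp_seq ((wp_extract_ssspInv hq (K := K) hs hM1.sameData hA1
    (Labels.init G B hx) (by simp) ?_ ?_).mono ?_)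
  · simpa using hG.sum_deg_le
  · omega
  intro T2 s2 hI
  refine wp_loop (SsspInv hq B (s.reg 4) K s) hI ?_
  clear hI hA1 hT1 hM1 hT
  rintro T s2 ⟨hM, j, f, P, cur, k, done, u, hA, h⟩
  have hz : s2.reg 2 = 0 := (hM.input hs).zero
  refine ⟨by omega, fun hb => ?_, fun hb => ?_⟩
  · simp only [Test.Holds, hz] at hb
    obtain ⟨-, h10, hud, hcur, hd, hj, hT⟩ := h.resolve_left (by omega)
    refine wp_seq (wp_block (by simp; omega) ?_)
    generalize hs3 : runs _ s2 = s3
    have iM : SameData s2 s3 := by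
      rw [← hs3]
      refine ⟨?_, fun _ _ => rfl, fun _ _ => rfl⟩
      intro r h1 h2 h3 h4 h5
      simp [runs, Instr.run, h4]
    have iQ : SameQueue s2 s3 := by
      rw [← hs3]
      refine ⟨?_, fun _ _ => rfl, fun _ _ => rfl, rfl⟩
      intro r hr
      simp [runs, Instr.run, show r ≠ 8 by omega]
    have i8 : s3.reg 8 = s.arr 3 u := by
      rw [← hs3]; simp [runs, Instr.run, h10, hM.arr 3]
    have iz : s3.reg 2 = 0 := ((hM.trans iM).input hs).zero
    have hun := hd.done_lt u hud
    have i10 : s3.reg 10 = u := by rw [iQ.reg 10 (by simp), h10]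
    refine wp_seq (wp_branch (by simp; omega) (fun hb => ?_) (fun hb => ?_))
    · simp only [Test.Holds, iz, i8] at hb
      refine (wp_scan hq hG (K := K + 1 + L + ∑ v ∈ Finset.range G.n \ done,
          ((c + 5) * (G.off (v + 1) - G.off v) + (L + 12))) ((hM.trans iM).input hs)
          (hq.congr hA iQ) hd hud hcur (by rw [hB u hun]; simpa using hb) i10
          (by simp; omega)).mono ?_
      rintro T4 s4 ⟨jM, k', f', P', hA', hd', hT'⟩
      exact wp_extract_ssspInv hq hs (hM.trans (iM.trans jM)) hA' hd' (fun _ => Or.inl le_rfl)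
        (by omega) (by omega)
    · simp only [Test.Holds, iz, i8] at hb
      refine wp_block (by simp; omega) ?_
      exact wp_extract_ssspInv hq hs (hM.trans iM) (hq.congr hA iQ) hd
        (fun _ => Or.inr ((hB u hun).2 hb)) (by omega) (by simp; omega)
  · simp only [Test.Holds, hz] at hb
    obtain ⟨-, h1, h2⟩ := h.resolve_right (by omega)
    exact ⟨hM, by omega, j, f, P, cur, k, hA, h2⟩

end

/-! ### The visibility test for one source and the loop over all sources -/

/-- The memories agree on the input, on the loop counter and on the source vertex. -/
structure SameInput (s s' : State) : Prop where
  reg : ∀ r < 5, s'.reg r = s.reg r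
  arr : ∀ a < 3, s'.arr a = s.arr a
  warr : s'.warr 0 = s.warr 0

theorem SameInput.trans {s s' s'' : State} (h : SameInput s s') (h' : SameInput s' s'') :
    SameInput s s'' :=
  ⟨fun r hr => (h'.reg r hr).trans (h.reg r hr), fun r hr => (h'.arr r hr).trans (h.arr r hr),
    h'.warr.trans h.warr⟩

theorem SameInput.input {β : Type*} {G : CSR β} {wtOk : (ℕ → ℝ≥0) → Prop} {s s' : State}
    (h : SameInput s s') (hs : Input G wtOk s) : Input G wtOk s' :=
  ⟨by rw [h.reg 0 (by simp), hs.n], by rw [h.reg 2 (by simp), hs.zero],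
    by rw [h.arr 0 (by simp), hs.off], by rw [h.arr 1 (by simp), hs.head],
    by rw [h.warr]; exact hs.wt⟩

theorem SameData.sameInput {s s' : State} (h : SameData s s') : SameInput s s' :=
  ⟨fun r hr => h.reg r (by omega) (by omega) (by omega) (by omega) (by omega),
    fun a ha => h.arr a (by omega), h.warr 0 (by simp)⟩

theorem wp_clearMarks {T : ℕ} {s : State} (hz : s.reg 2 = 0) (hT : 4 * s.reg 0 + 3 ≤ T) :
    WP clearMarks (fun T' s' => SameInput s s' ∧ s'.reg 7 = s.reg 7 ∧ SameQueue s s' ∧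
      (∀ v < s.reg 0, s'.arr 3 v = 0) ∧ T ≤ T' + (4 * s.reg 0 + 3)) T s := by
  refine wp_seq (wp_block (by simp; omega) ?_)
  refine wp_loop (fun T' s' => SameInput s s' ∧ s'.reg 7 = s.reg 7 ∧ SameQueue s s' ∧
    s'.reg 5 ≤ s.reg 0 ∧ (∀ v < s'.reg 5, s'.arr 3 v = 0) ∧
    T ≤ T' + (4 * s'.reg 5 + 2) ∧ 4 * (s.reg 0 - s'.reg 5) + 1 ≤ T') ?_ ?_
  · refine ⟨⟨?_, fun _ _ => rfl, rfl⟩, rfl, ⟨?_, fun _ _ => rfl, fun _ _ => rfl, rfl⟩, ?_, ?_, ?_, ?_⟩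
    · intro r hr
      simp [runs, Instr.run, show r ≠ 5 by omega]
    · intro r hr
      simp [runs, Instr.run, show r ≠ 5 by omega]
    · simp [runs, Instr.run]
    · simp [runs, Instr.run]
    · simp [runs, Instr.run]; omega
    · simp [runs, Instr.run]; omega
  · rintro T s1 ⟨hI, h7, hQ, hle, hm, hT1, hT2⟩
    have h0 := hI.reg 0 (by simp)
    refine ⟨by omega, fun hb => ?_, fun hb => ?_⟩
    · simp only [Test.Holds, h0] at hb
      refine wp_block (by simp; omega) ?_
      refine ⟨hI.trans ⟨?_, ?_, rfl⟩, h7, hQ.trans ⟨?_, ?_, fun _ _ => rfl, rfl⟩, ?_, ?_, ?_, ?_⟩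
      · intro r hr
        simp [runs, Instr.run, show r ≠ 5 by omega]
      · intro a ha
        simp [runs, Instr.run, show a ≠ 3 by omega]
      · intro r hr
        simp [runs, Instr.run, show r ≠ 5 by omega]
      · intro a ha
        simp [runs, Instr.run, show a ≠ 3 by omega]
      · simp [runs, Instr.run]; omega
      · intro v hv
        simp [runs, Instr.run] at hv
        by_cases h : v = s1.reg 5
        · simp [runs, Instr.run, h, hI.reg 2, hz]
        · simp [runs, Instr.run, h, hm v (by omega)]
      · simp [runs, Instr.run]; omega
      · simp [runs, Instr.run]; omega
    · simp only [Test.Holds, h0] at hb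
      exact ⟨hI, h7, hQ, fun v hv => hm v (by omega), by omega⟩

section

variable {β : Type*} [AddCommMonoid β] [LinearOrder β] [IsOrderedAddMonoid β]
  [CanonicallyOrderedAdd β] {q : QueueProgs} {G : CSR β} {wtOk : (ℕ → ℝ≥0) → Prop} {c L : ℕ}

theorem Walk.mono {B B' : Set ℕ} (hB : B' ⊆ B) {x v : ℕ} {b : β} (h : Walk G B x v b) :
    Walk G B' x v b := by
  induction h with
  | nil => exact .nil
  | step _ h1 h2 h3 h4 ih => exact .step ih (fun h => h1 (hB h)) h2 h3 h4

/-- Blocking more vertices does not shorten distances. This meets the precondition of `compare`,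
that the saved label is at most the current one. -/
theorem IsDist.anti {B B' : Set ℕ} (hB : B' ⊆ B) {x v : ℕ} {f g : ℕ → WithTop β}
    (hf : IsDist G B' x f) (hg : IsDist G B x g) (hv : v < G.n) : f v ≤ g v := by
  cases h : g v with
  | top => simp
  | coe b => exact hf.le v hv b ((hg.walk v hv b h).mono hB)

theorem wp_saveAll (hq : QueueSpec q G wtOk c L) {T : ℕ} {s : State} (hs : Input G wtOk s)
    (hl : ∀ i < s.reg 1, s.arr 2 i < G.n) {j k : ℕ} {f : ℕ → WithTop β} {P : Finset ℕ} {cur : β}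
    (hA : hq.A j f P cur k s) (hm : ∀ v < G.n, s.arr 3 v = 0)
    (hT : (c + 6) * s.reg 1 + 4 ≤ T) :
    WP (saveAll q) (fun T' s' => SameInput s s' ∧ s'.reg 7 = s.reg 7 ∧ SameQueue s s' ∧
      (∀ i < s.reg 1, hq.Saved s' (s.arr 2 i) (f (s.arr 2 i))) ∧
      (∀ v < G.n, s'.arr 3 v ≠ 0 ↔ ∃ i < s.reg 1, s.arr 2 i = v) ∧
      T ≤ T' + ((c + 6) * s.reg 1 + 4)) T s := by
  refine wp_seq (wp_block (by simp; omega) ?_)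
  refine wp_loop (fun T' s' => SameInput s s' ∧ s'.reg 7 = s.reg 7 ∧ SameQueue s s' ∧
    s'.reg 6 = 1 ∧ s'.reg 5 ≤ s.reg 1 ∧
    (∀ i < s'.reg 5, hq.Saved s' (s.arr 2 i) (f (s.arr 2 i))) ∧
    (∀ v < G.n, s'.arr 3 v ≠ 0 ↔ ∃ i < s'.reg 5, s.arr 2 i = v) ∧
    T ≤ T' + ((c + 6) * s'.reg 5 + 3) ∧ (c + 6) * (s.reg 1 - s'.reg 5) + 1 ≤ T') ?_ ?_
  · refine ⟨⟨?_, fun _ _ => rfl, rfl⟩, rfl, ⟨?_, fun _ _ => rfl, fun _ _ => rfl, rfl⟩, ?_, ?_, ?_, ?_,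
      ?_, ?_⟩
    · intro r hr
      simp [runs, Instr.run, show r ≠ 5 by omega, show r ≠ 6 by omega]
    · intro r hr
      simp [runs, Instr.run, show r ≠ 5 by omega, show r ≠ 6 by omega]
    · simp [runs, Instr.run]
    · simp [runs, Instr.run]
    · simp [runs, Instr.run]
    · simp [runs, Instr.run]
      exact hm
    · simp [runs, Instr.run]; omega
    · simp [runs, Instr.run]; omega
  · rintro T s1 ⟨hI, h7, hQ, h6, hle, hS, hM, hT1, hT2⟩
    have h1 := hI.reg 1 (by simp)
    refine ⟨by omega, fun hb => ?_, fun hb => ?_⟩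
    · simp only [Test.Holds, h1] at hb
      obtain ⟨d, hd⟩ : ∃ d, s.reg 1 - s1.reg 5 = d + 1 := ⟨_, (Nat.succ_pred (by omega)).symm⟩
      rw [hd, mul_add, mul_one] at hT2
      refine wp_seq (wp_block (by simp; omega) ?_)
      generalize hs2 : runs _ s1 = s2
      have i5 : s2.reg 5 = s1.reg 5 := by rw [← hs2]; simp [runs, Instr.run]
      have i9 : s2.reg 9 = s.arr 2 (s1.reg 5) := by
        rw [← hs2]; simp [runs, Instr.run, hI.arr 2]
      have iI : SameInput s1 s2 := by
        rw [← hs2]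
        refine ⟨fun r hr => ?_, fun a ha => ?_, rfl⟩
        · simp [runs, Instr.run, show r ≠ 9 by omega]
        · simp [runs, Instr.run, show a ≠ 3 by omega]
      have iQ : SameQueue s1 s2 := by
        rw [← hs2]
        refine ⟨fun r hr => ?_, fun a ha => ?_, fun _ _ => rfl, rfl⟩
        · simp [runs, Instr.run, show r ≠ 9 by omega]
        · simp [runs, Instr.run, show a ≠ 3 by omega]
      have i7 : s2.reg 7 = s1.reg 7 := by rw [← hs2]; simp [runs, Instr.run]
      have i6 : s2.reg 6 = 1 := by rw [← hs2]; simp [runs, Instr.run, h6]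
      have i3 : s2.arr 3 = Function.update (s1.arr 3) (s.arr 2 (s1.reg 5)) 1 := by
        rw [← hs2]; simp [runs, Instr.run, hI.arr 2, h6]
      have i4 : s2.arr 4 = s1.arr 4 ∧ s2.arr 5 = s1.arr 5 ∧ s2.warr 1 = s1.warr 1 := by
        rw [← hs2]; simp [runs, Instr.run]
      clear hs2
      refine wp_seq (WP.mono (hq.save ((hI.trans iI).input hs) (hq.congr hA (hQ.trans iQ))
        (by rw [i9]; exact hl _ hb) (by simp; omega)) ?_)
      rintro T3 s3 ⟨jQ, jr, ja, jw, jS, jS', jT⟩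
      refine wp_block (by simp at jT ⊢; omega) ?_
      generalize hs4 : runs _ s3 = s4
      have k5 : s4.reg 5 = s1.reg 5 + 1 := by rw [← hs4]; simp [runs, Instr.run, jr 5, i5]
      have kr : ∀ r, r ≠ 5 → s4.reg r = s3.reg r := by
        intro r hr
        rw [← hs4]; simp [runs, Instr.run, hr]
      have ka : s4.arr = s3.arr := by rw [← hs4]; rfl
      have kw : s4.warr = s3.warr := by rw [← hs4]; rfl
      have kw' : s4.wreg = s3.wreg := by rw [← hs4]; rfl
      clear hs4
      refine ⟨hI.trans (iI.trans ⟨fun r hr => ?_, fun a ha => ?_, ?_⟩), ?_,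
        hQ.trans (iQ.trans (jQ.trans ⟨fun r hr => kr r (by omega), fun _ _ => by rw [ka],
          fun _ _ => by rw [kw], by rw [kw']⟩)), ?_, by omega, ?_, ?_, ?_, ?_⟩
      · rw [kr r (by omega), jr r (by omega)]
      · rw [ka, ja a (by omega)]
      · rw [kw, jw]
      · rw [kr 7 (by simp), jr 7 (by simp), i7, h7]
      · rw [kr 6 (by simp), jr 6 (by simp), i6]
      · intro i hi
        refine hq.saved_congr (s := s3) ?_ (by rw [ka]) (by rw [ka]) (by rw [kw])
        -- Equal vertices have equal labels, so this step needs no distinctness of the list: the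
        -- label just saved is also the right one for an earlier index with the same vertex.
        by_cases h : s.arr 2 i = s2.reg 9
        · rw [h]; exact jS
        · refine jS' _ h _ (hq.saved_congr (hS i ?_) i4.1 i4.2.1 i4.2.2)
          by_contra hh
          have : i = s1.reg 5 := by omega
          exact h (by rw [i9, this])
      · intro v hv
        rw [ka, ja 3 (by simp), i3, k5]
        by_cases h : v = s.arr 2 (s1.reg 5)
        · rw [h, Function.update_self]
          exact ⟨fun _ => ⟨_, Nat.lt_succ_self _, rfl⟩, fun _ => one_ne_zero⟩
        · rw [Function.update_of_ne h, hM v hv]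
          constructor
          · rintro ⟨i, hi, hiv⟩
            exact ⟨i, by omega, hiv⟩
          · rintro ⟨i, hi, hiv⟩
            refine ⟨i, ?_, hiv⟩
            by_contra hh
            have : i = s1.reg 5 := by omega
            exact h (by rw [← hiv, this])
      · rw [k5, mul_add, mul_one]
        simp only [List.length_cons, List.length_nil] at jT ⊢
        omega
      · rw [show s.reg 1 - s4.reg 5 = d by omega]
        simp only [List.length_cons, List.length_nil] at jT ⊢
        omega
    · simp only [Test.Holds, h1] at hb
      have h5 : s1.reg 5 = s.reg 1 := by omega
      rw [h5] at hS hM hT1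
      exact ⟨hI, h7, hQ, hS, hM, by omega⟩

/-- Here `f` are the labels of the restricted computation, still held by the queue, and `g` are the
saved unrestricted ones. Register `7` is only ever cleared, so it accumulates a conjunction over
successive sources. -/
theorem wp_compareAll (hq : QueueSpec q G wtOk c L) {T : ℕ} {s : State} (hs : Input G wtOk s)
    (hl : ∀ i < s.reg 1, s.arr 2 i < G.n) {j k : ℕ} {f g : ℕ → WithTop β} {P : Finset ℕ} {cur : β}
    (hA : hq.A j f P cur k s) (hgf : ∀ v < G.n, g v ≤ f v)
    (hS : ∀ i < s.reg 1, hq.Saved s (s.arr 2 i) (g (s.arr 2 i)))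
    (hT : (c + 8) * s.reg 1 + 3 ≤ T) :
    WP (compareAll q) (fun T' s' => SameInput s s' ∧ SameQueue s s' ∧
      ((∀ i < s.reg 1, f (s.arr 2 i) ≠ ⊤ ∧ f (s.arr 2 i) ≤ g (s.arr 2 i)) →
        s'.reg 7 = s.reg 7) ∧
      ((¬ ∀ i < s.reg 1, f (s.arr 2 i) ≠ ⊤ ∧ f (s.arr 2 i) ≤ g (s.arr 2 i)) →
        s'.reg 7 = 0) ∧ T ≤ T' + ((c + 8) * s.reg 1 + 3)) T s := by
  refine wp_seq (wp_block (by simp; omega) ?_)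
  refine wp_loop (fun T' s' => SameInput s s' ∧ SameQueue s s' ∧ s'.reg 5 ≤ s.reg 1 ∧
    s'.arr 4 = s.arr 4 ∧ s'.arr 5 = s.arr 5 ∧ s'.warr 1 = s.warr 1 ∧
    ((∀ i < s'.reg 5, f (s.arr 2 i) ≠ ⊤ ∧ f (s.arr 2 i) ≤ g (s.arr 2 i)) →
        s'.reg 7 = s.reg 7) ∧
    ((¬ ∀ i < s'.reg 5, f (s.arr 2 i) ≠ ⊤ ∧ f (s.arr 2 i) ≤ g (s.arr 2 i)) →
        s'.reg 7 = 0) ∧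
    T ≤ T' + ((c + 8) * s'.reg 5 + 2) ∧ (c + 8) * (s.reg 1 - s'.reg 5) + 1 ≤ T') ?_ ?_
  · refine ⟨⟨?_, fun _ _ => rfl, rfl⟩, ⟨?_, fun _ _ => rfl, fun _ _ => rfl, rfl⟩, ?_, rfl, rfl, rfl,
      ?_, ?_, ?_, ?_⟩
    · intro r hr
      simp [runs, Instr.run, show r ≠ 5 by omega]
    · intro r hr
      simp [runs, Instr.run, show r ≠ 5 by omega]
    · simp [runs, Instr.run]
    · simp [runs, Instr.run]
    · simp [runs, Instr.run]
    · simp [runs, Instr.run]; omega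
    · simp [runs, Instr.run]; omega
  · rintro T s1 ⟨hI, hQ, hle, h4, h5, hw, hyes, hno, hT1, hT2⟩
    have h1 := hI.reg 1 (by simp)
    refine ⟨by omega, fun hb => ?_, fun hb => ?_⟩
    · simp only [Test.Holds, h1] at hb
      obtain ⟨d, hd⟩ : ∃ d, s.reg 1 - s1.reg 5 = d + 1 := ⟨_, (Nat.succ_pred (by omega)).symm⟩
      rw [hd, mul_add, mul_one] at hT2
      refine wp_seq (wp_block (by simp; omega) ?_)
      generalize hs2 : runs _ s1 = s2
      have ir : ∀ r, r ≠ 9 → s2.reg r = s1.reg r := by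
        intro r hr
        rw [← hs2]; simp [runs, Instr.run, hr]
      have i9 : s2.reg 9 = s.arr 2 (s1.reg 5) := by
        rw [← hs2]; simp [runs, Instr.run, hI.arr 2]
      have ia : s2.arr = s1.arr := by rw [← hs2]; rfl
      have iw : s2.warr = s1.warr := by rw [← hs2]; rfl
      have iw' : s2.wreg = s1.wreg := by rw [← hs2]; rfl
      clear hs2
      have iI : SameInput s s2 := hI.trans ⟨fun r hr => ir r (by omega), fun _ _ => by rw [ia],
        by rw [iw]⟩
      have iQ : SameQueue s s2 := hQ.trans ⟨fun r hr => ir r (by omega), fun _ _ => by rw [ia],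
        fun _ _ => by rw [iw], by rw [iw']⟩
      refine wp_seq (WP.mono (hq.compare (iI.input hs) (hq.congr hA iQ) (by rw [i9]; exact hl _ hb)
        (g := g (s2.reg 9)) ?_ ?_ (by simp; omega)) ?_)
      · rw [i9]
        exact hq.saved_congr (hS _ hb) (by rw [ia, h4]) (by rw [ia, h5]) (by rw [iw, hw])
      · rw [i9]; exact hgf _ (hl _ hb)
      rintro T3 s3 ⟨jQ, jr, ja, jw, j8, jT⟩
      rw [i9] at j8
      have jI : SameInput s s3 := iI.trans ⟨fun r hr => jr r (by omega), fun a ha => ja a (by omega),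
        jw 0 (by simp)⟩
      have hz : s3.reg 2 = 0 := (jI.input hs).zero
      -- Both outcomes of the comparison lead to the same invariant; they differ only in what
      -- happens to register `7`.
      have key : ∀ s4 : State, (∀ r, r ≠ 7 → r ≠ 5 → s4.reg r = s3.reg r) → s4.arr = s3.arr →
          s4.warr = s3.warr → s4.wreg = s3.wreg → s4.reg 5 = s3.reg 5 + 1 →
          ((f (s.arr 2 (s1.reg 5)) ≠ ⊤ ∧ f (s.arr 2 (s1.reg 5)) ≤ g (s.arr 2 (s1.reg 5))) →
            s4.reg 7 = s3.reg 7) →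
          (¬(f (s.arr 2 (s1.reg 5)) ≠ ⊤ ∧ f (s.arr 2 (s1.reg 5)) ≤ g (s.arr 2 (s1.reg 5))) →
            s4.reg 7 = 0) → SameInput s s4 ∧ SameQueue s s4 ∧ s4.reg 5 ≤ s.reg 1 ∧
          s4.arr 4 = s.arr 4 ∧ s4.arr 5 = s.arr 5 ∧ s4.warr 1 = s.warr 1 ∧
          ((∀ i < s4.reg 5, f (s.arr 2 i) ≠ ⊤ ∧ f (s.arr 2 i) ≤ g (s.arr 2 i)) →
              s4.reg 7 = s.reg 7) ∧
          ((¬ ∀ i < s4.reg 5, f (s.arr 2 i) ≠ ⊤ ∧ f (s.arr 2 i) ≤ g (s.arr 2 i)) →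
              s4.reg 7 = 0) := by
        intro s4 kr ka kw kw' k5 kyes kno
        have k5' : s4.reg 5 = s1.reg 5 + 1 := by rw [k5, jr 5 (by simp), ir 5 (by simp)]
        have k7 : s3.reg 7 = s1.reg 7 := by rw [jr 7 (by simp), ir 7 (by simp)]
        rw [k7] at kyes
        refine ⟨jI.trans ⟨fun r hr => ?_, fun _ _ => by rw [ka], by rw [kw]⟩,
          (iQ.trans jQ).trans ⟨fun r hr => kr r (by omega) (by omega), fun _ _ => by rw [ka],
          fun _ _ => by rw [kw], by rw [kw']⟩, by omega, ?_, ?_, ?_, ?_, ?_⟩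
        · exact kr r (by omega) (by omega)
        · rw [ka, ja 4 (by simp), ia, h4]
        · rw [ka, ja 5 (by simp), ia, h5]
        · rw [kw, jw 1 (by simp), iw, hw]
        · intro h
          rw [kyes (h _ (by omega)), hyes (fun i hi => h i (by omega))]
        · intro h
          by_cases hc : f (s.arr 2 (s1.reg 5)) ≠ ⊤ ∧ f (s.arr 2 (s1.reg 5)) ≤ g (s.arr 2 (s1.reg 5))
          · rw [kyes hc]
            refine hno (fun h' => h fun i hi => ?_)
            by_cases hi' : i = s1.reg 5
            · rw [hi']; exact hc
            · exact h' i (by omega)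
          · exact kno hc
      have l5 : s3.reg 5 = s1.reg 5 := by rw [jr 5 (by simp), ir 5 (by simp)]
      simp only [List.length_cons, List.length_nil] at jT
      refine wp_seq (wp_branch (by omega) (fun hb => ?_) (fun hb => ?_))
      · simp only [Test.Holds, hz] at hb
        refine wp_block (by simp; omega) (wp_block (by simp; omega) ?_)
        have := key (runs [.succ 5] s3) (fun r hr hr' => by simp [runs, Instr.run, hr']) rfl rfl rfl
          (by simp [runs, Instr.run]) (fun _ => by simp [runs, Instr.run])
          (fun h => absurd (j8.1 hb) h)
        obtain ⟨a1, a2, a3, a4, a5, a6, a7, a8⟩ := this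
        refine ⟨a1, a2, a3, a4, a5, a6, a7, a8, ?_, ?_⟩
        · have : (runs [.succ 5] (runs [] s3)).reg 5 = s1.reg 5 + 1 := by simp [runs, Instr.run, l5]
          rw [this, mul_add, mul_one]
          simp only [List.length_cons, List.length_nil]
          omega
        · have : s.reg 1 - (runs [.succ 5] (runs [] s3)).reg 5 = d := by
            simp [runs, Instr.run]; omega
          rw [this]
          simp only [List.length_cons, List.length_nil]
          omega
      · simp only [Test.Holds, hz] at hb
        refine wp_block (by simp; omega) (wp_block (by simp; omega) ?_)
        have := key (runs [.succ 5] (runs [.const 7 0] s3))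
          (fun r hr hr' => by simp [runs, Instr.run, hr, hr']) rfl rfl rfl
          (by simp [runs, Instr.run]) (fun h => absurd (j8.2 h) hb)
          (fun h => by simp [runs, Instr.run])
        obtain ⟨a1, a2, a3, a4, a5, a6, a7, a8⟩ := this
        refine ⟨a1, a2, a3, a4, a5, a6, a7, a8, ?_, ?_⟩
        · have : (runs [.succ 5] (runs [.const 7 0] s3)).reg 5 = s1.reg 5 + 1 := by
            simp [runs, Instr.run, l5]
          rw [this, mul_add, mul_one]
          simp only [List.length_cons, List.length_nil]
          omega
        · have : s.reg 1 - (runs [.succ 5] (runs [.const 7 0] s3)).reg 5 = d := by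
            simp [runs, Instr.run]; omega
          rw [this]
          simp only [List.length_cons, List.length_nil]
          omega
    · simp only [Test.Holds, h1] at hb
      have h5 : s1.reg 5 = s.reg 1 := by omega
      rw [h5] at hyes hno hT1
      exact ⟨hI, hQ, hyes, hno, by omega⟩

end

section

variable {β : Type*} [AddCommMonoid β] [LinearOrder β] [IsOrderedAddMonoid β]
  [CanonicallyOrderedAdd β] {q : QueueProgs} {G : CSR β} {wtOk : (ℕ → ℝ≥0) → Prop} {c L : ℕ}

/-- A bound on the cost of `sssp`. -/
def ssspCost (G : CSR β) (c L : ℕ) : ℕ := (c + 5) * G.off G.n + (c + L + 12) * (G.n + 1)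

/-- A bound on the cost of `testVertex` for a candidate set of size `N`. -/
def testCost (G : CSR β) (c L N : ℕ) : ℕ :=
  2 * ssspCost G c L + 4 * G.n + (c + 6) * N + (c + 8) * N + 16

/-- The predicate `vis` separates program verification from graph theory: `hvis` is all that is
needed of the comparison of the two distance functions. -/
theorem wp_testVertex (hq : QueueSpec q G wtOk c L) (hG : G.Valid) {T K : ℕ} {s : State}
    (hs : Input G wtOk s) (hidle : ∀ r, s.arr 15 r = 0) (hl : ∀ i < s.reg 1, s.arr 2 i < G.n)
    (h3 : s.reg 3 < s.reg 1) {x : ℕ} (hx : s.arr 2 (s.reg 3) = x) (vis : ℕ → Prop)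
    (hvis : ∀ f g, IsDist G ∅ x f → IsDist G {v | v ≠ x ∧ ∃ j < s.reg 1, s.arr 2 j = v} x g →
      ∀ j < s.reg 1, (g (s.arr 2 j) ≠ ⊤ ∧ g (s.arr 2 j) ≤ f (s.arr 2 j) ↔ vis (s.arr 2 j)))
    (hT : K + testCost G c L (s.reg 1) ≤ T) :
    WP (testVertex q) (fun T' s' => (∀ r < 3, s'.reg r = s.reg r) ∧ s'.reg 3 = s.reg 3 + 1 ∧
      (∀ a < 3, s'.arr a = s.arr a) ∧ s'.warr 0 = s.warr 0 ∧ (∀ r, s'.arr 15 r = 0) ∧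
      ((∀ j < s.reg 1, vis (s.arr 2 j)) → s'.reg 7 = s.reg 7) ∧
      ((¬ ∀ j < s.reg 1, vis (s.arr 2 j)) → s'.reg 7 = 0) ∧ K ≤ T') T s := by
  have hxn : x < G.n := hx ▸ hl _ h3
  unfold testCost at hT
  refine wp_seq (wp_block (by simp; omega) ?_)
  generalize hs1 : runs _ s = s1
  have r1 : ∀ r, r ≠ 4 → s1.reg r = s.reg r := by
    intro r hr
    rw [← hs1]; simp [runs, Instr.run, hr]
  have r14 : s1.reg 4 = x := by rw [← hs1]; simp [runs, Instr.run, hx]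
  have a1 : s1.arr = s.arr := by rw [← hs1]; rfl
  have w1 : s1.warr = s.warr := by rw [← hs1]; rfl
  clear hs1
  have in1 : Input G wtOk s1 := ⟨by rw [r1 0 (by simp), hs.n], by rw [r1 2 (by simp), hs.zero],
    by rw [a1, hs.off], by rw [a1, hs.head], by rw [w1]; exact hs.wt⟩
  have n1 := in1.n
  refine wp_seq ((wp_clearMarks in1.zero (by simp; omega)).mono ?_)
  rintro T2 s2 ⟨i2, r27, q2, m2, t2⟩
  rw [n1] at m2 t2
  simp only [List.length_cons, List.length_nil] at t2
  have in2 := i2.input in1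
  have h24 : s2.reg 4 = x := by rw [i2.reg 4 (by simp), r14]
  refine wp_seq ((wp_sssp hq hG (K := T2 - ssspCost G c L) (B := ∅) in2
    (by rw [q2.arr 15 (by simp), a1]; exact hidle) (by rw [h24]; exact hxn)
    (by intro v hv; simpa using m2 v hv) (by unfold ssspCost at *; omega)).mono ?_)
  rintro T3 s3 ⟨i3, t3, j, f, P, cur, k, hA3, hf⟩
  rw [h24] at hf
  have in3 := i3.input in2
  have i3' := i2.trans i3.sameInput
  have e31 : s3.reg 1 = s.reg 1 := by rw [i3'.reg 1 (by simp), r1 1 (by simp)]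
  have e32 : s3.arr 2 = s.arr 2 := by rw [i3'.arr 2 (by simp), a1]
  have e37 : s3.reg 7 = s.reg 7 := by
    rw [i3.reg 7 (by simp) (by simp) (by simp) (by simp) (by simp), r27, r1 7 (by simp)]
  refine wp_seq ((wp_saveAll hq in3 (by rw [e31, e32]; exact hl) hA3 (by
    intro v hv; rw [i3.arr 3 (by simp)]; exact m2 v hv) (by rw [e31]; omega)).mono ?_)
  rintro T4 s4 ⟨i4, r47, q4, sv4, m4, t4⟩
  rw [e31] at sv4 m4 t4
  rw [e32] at sv4 m4
  refine wp_seq (wp_block (by simp; omega) ?_)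
  generalize hs5 : runs _ s4 = s5
  have h44 : s4.reg 4 = x := by rw [i4.reg 4 (by simp), i3.sameInput.reg 4 (by simp), h24]
  have h42 : s4.reg 2 = 0 := (i4.input in3).zero
  have r5 : s5.reg = s4.reg := by rw [← hs5]; rfl
  have a5 : ∀ a, a ≠ 3 → s5.arr a = s4.arr a := by
    intro a ha
    rw [← hs5]; simp [runs, Instr.run, ha]
  have a53 : s5.arr 3 = Function.update (s4.arr 3) x 0 := by
    rw [← hs5]; simp [runs, Instr.run, h44, h42]
  have w5 : s5.warr = s4.warr := by rw [← hs5]; rfl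
  clear hs5
  have i5 : SameInput s4 s5 := ⟨fun _ _ => by rw [r5], fun a ha => a5 a (by omega), by rw [w5]⟩
  have in5 := i5.input (i4.input in3)
  refine wp_seq ((wp_sssp hq hG (K := T4 - 2 - ssspCost G c L)
    (B := {v | v ≠ x ∧ ∃ j < s.reg 1, s.arr 2 j = v}) in5
    (by rw [a5 15 (by simp), q4.arr 15 (by simp)]; exact hq.idle hA3)
    (by rw [r5, h44]; exact hxn) ?_
    (by simp only [List.length_cons, List.length_nil]; unfold ssspCost at *; omega)).mono ?_)
  -- All of S is marked at this point except for the source, whose mark has just been removed; so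
  -- the marks describe S \ {x}.
  · intro v hv
    rw [a53]
    by_cases h : v = x
    · subst h; simp
    · rw [Function.update_of_ne h, m4 v hv]
      simp [h]
  rintro T6 s6 ⟨i6, t6, j', g, P', cur', k', hA6, hg⟩
  rw [r5, h44] at hg
  have in6 := i6.input in5
  have i6' := i4.trans (i5.trans i6.sameInput)
  have e61 : s6.reg 1 = s.reg 1 := by rw [i6'.reg 1 (by simp), e31]
  have e62 : s6.arr 2 = s.arr 2 := by rw [i6'.arr 2 (by simp), e32]
  have e67 : s6.reg 7 = s.reg 7 := by
    rw [i6.reg 7 (by simp) (by simp) (by simp) (by simp) (by simp), r5, r47, e37]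
  refine wp_seq ((wp_compareAll hq in6 (by rw [e61, e62]; exact hl) hA6
    (fun v hv => hf.anti (Set.empty_subset _) hg hv) ?_ (by rw [e61]; omega)).mono ?_)
  · intro i hi
    rw [e61] at hi
    rw [e62]
    refine hq.saved_congr (sv4 i hi) ?_ ?_ ?_
    · rw [i6.arr 4 (by simp), a5 4 (by simp)]
    · rw [i6.arr 5 (by simp), a5 5 (by simp)]
    · rw [i6.warr 1 (by simp), w5]
  rintro T7 s7 ⟨i7, q7, y7, n7, t7⟩
  rw [e61] at y7 n7 t7
  rw [e62] at y7 n7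
  have hiff : (∀ i < s.reg 1, g (s.arr 2 i) ≠ ⊤ ∧ g (s.arr 2 i) ≤ f (s.arr 2 i)) ↔
      ∀ j < s.reg 1, vis (s.arr 2 j) :=
    forall₂_congr fun i hi => hvis f g hf hg i hi
  rw [hiff] at y7 n7
  have i7' := i3'.trans (i6'.trans i7)
  refine wp_block (by simp; omega) ⟨?_, ?_, ?_, ?_, ?_, ?_, ?_, ?_⟩
  · intro r hr
    simp [runs, Instr.run, show r ≠ 3 by omega, i7'.reg r (by omega), r1 r (by omega)]
  · simp [runs, Instr.run, i7'.reg 3, r1 3]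
  · intro a ha
    simp [runs, Instr.run, i7'.arr a ha, a1]
  · simp [runs, Instr.run, i7'.warr, w1]
  · intro r
    simp [runs, Instr.run, q7.arr 15, hq.idle hA6]
  · intro h
    simp [runs, Instr.run, y7 h, e67]
  · intro h
    simp [runs, Instr.run, n7 h]
  · simp only [List.length_cons, List.length_nil]
    omega

/-- Register `7` starts with 1 and holds the verdict on the sources treated so far. The unit added
to `testCost` is the loop test. -/
theorem wp_decideMV (hq : QueueSpec q G wtOk c L) (hG : G.Valid) {T : ℕ} {s : State}
    (hs : Input G wtOk s) (hidle : ∀ r, s.arr 15 r = 0) (hl : ∀ i < s.reg 1, s.arr 2 i < G.n)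
    (vis : ℕ → ℕ → Prop)
    (hvis : ∀ i < s.reg 1, ∀ f g, IsDist G ∅ (s.arr 2 i) f →
      IsDist G {v | v ≠ s.arr 2 i ∧ ∃ j < s.reg 1, s.arr 2 j = v} (s.arr 2 i) g →
      ∀ j < s.reg 1, (g (s.arr 2 j) ≠ ⊤ ∧ g (s.arr 2 j) ≤ f (s.arr 2 j) ↔
        vis (s.arr 2 i) (s.arr 2 j)))
    (hT : s.reg 1 * (testCost G c L (s.reg 1) + 1) + 6 ≤ T) :
    WP (decideMV q) (fun _ s' =>
      ((∀ i < s.reg 1, ∀ j < s.reg 1, vis (s.arr 2 i) (s.arr 2 j)) → s'.reg 0 = 1) ∧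
      ((¬ ∀ i < s.reg 1, ∀ j < s.reg 1, vis (s.arr 2 i) (s.arr 2 j)) → s'.reg 0 = 0)) T s := by
  refine wp_seq (wp_block (by simp; omega) ?_)
  refine wp_seq (wp_loop (fun T s' => (∀ r < 3, s'.reg r = s.reg r) ∧ s'.reg 3 ≤ s.reg 1 ∧
      (∀ a < 3, s'.arr a = s.arr a) ∧ s'.warr 0 = s.warr 0 ∧ (∀ r, s'.arr 15 r = 0) ∧
      ((∀ i < s'.reg 3, ∀ j < s.reg 1, vis (s.arr 2 i) (s.arr 2 j)) → s'.reg 7 = 1) ∧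
      ((¬ ∀ i < s'.reg 3, ∀ j < s.reg 1, vis (s.arr 2 i) (s.arr 2 j)) → s'.reg 7 = 0) ∧
      (s.reg 1 - s'.reg 3) * (testCost G c L (s.reg 1) + 1) + 3 ≤ T) ?_ ?_)
  · refine ⟨?_, ?_, ?_, ?_, ?_, ?_, ?_, ?_⟩
    · intro r hr
      simp [runs, Instr.run, show r ≠ 3 by omega, show r ≠ 7 by omega]
    · simp [runs, Instr.run]
    · intro a ha
      simp [runs, Instr.run]
    · simp [runs, Instr.run]
    · simpa [runs, Instr.run] using hidle
    · simp [runs, Instr.run]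
    · simp [runs, Instr.run]
    · simp [runs, Instr.run]
      omega
  · rintro T s1 ⟨hr, h3, ha, hw, hi, hy, hn, hT⟩
    have h1 := hr 1 (by simp)
    refine ⟨by omega, fun hb => ?_, fun hb => ?_⟩
    · simp only [Test.Holds, h1] at hb
      obtain ⟨d, hd⟩ : ∃ d, s.reg 1 - s1.reg 3 = d + 1 := ⟨_, (Nat.succ_pred (by omega)).symm⟩
      rw [hd, add_mul, one_mul] at hT
      have in1 : Input G wtOk s1 := ⟨by rw [hr 0 (by simp), hs.n], by rw [hr 2 (by simp), hs.zero],
        by rw [ha 0 (by simp), hs.off], by rw [ha 1 (by simp), hs.head], by rw [hw]; exact hs.wt⟩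
      have a2 := ha 2 (by simp)
      refine (wp_testVertex hq hG (K := d * (testCost G c L (s.reg 1) + 1) + 3) in1 hi
        (by rw [h1, a2]; exact hl) (by rw [h1]; exact hb) rfl (vis (s.arr 2 (s1.reg 3))) ?_
        (by rw [h1]; omega)).mono ?_
      · rw [h1, a2]
        exact hvis _ hb
      rintro T2 s2 ⟨jr, j3, ja, jw, ji, jy, jn, jT⟩
      rw [h1, a2] at jy jn
      refine ⟨fun r h => (jr r h).trans (hr r h), by omega, fun a h => (ja a h).trans (ha a h),
        jw.trans hw, ji, fun h => ?_, fun h => ?_, ?_⟩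
      · rw [jy (h _ (by omega)), hy (fun i hi => h i (by omega))]
      · by_cases hc : ∀ j < s.reg 1, vis (s.arr 2 (s1.reg 3)) (s.arr 2 j)
        · rw [jy hc]
          refine hn (fun h' => h fun i hi => ?_)
          by_cases he : i = s1.reg 3
          · rw [he]; exact hc
          · exact h' i (by omega)
        · exact jn hc
      · rw [show s.reg 1 - s2.reg 3 = d by omega]
        exact jT
    · simp only [Test.Holds, h1] at hb
      have h5 : s1.reg 3 = s.reg 1 := by omega
      rw [h5] at hy hn
      refine wp_block (by simp; omega) ⟨fun h => ?_, fun h => ?_⟩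
      · simp [runs, Instr.run, hy h]
      · simp [runs, Instr.run, hn h]

end

/-! ## First-in-first-out queues for unweighted digraphs -/

/-- Breadth-first search: array `8` tells whether a vertex has been reached, array `9` holds the
labels, and the cells of array `10` from position `reg 12` up to, but not including, position
`reg 13` hold the queue; register `15` holds the label of the last extracted vertex. -/
def fifo : QueueProgs where
  init := seqs [block [.const 14 0], .loop (.lt 14 0) (block [.store 8 14 2, .succ 14]),
    block [.const 16 1, .store 8 4 16, .store 9 4 2, .const 12 0, .const 13 1, .store 10 12 4,
      .const 15 0]]
  extract := .branch (.lt 12 13) (block [.load 10 10 12, .load 15 9 10, .const 11 1, .succ 12])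
    (block [.const 11 0])
  relax := seqs [block [.load 16 8 9], .branch (.eq 16 2)
    (block [.const 16 1, .store 8 9 16, .copy 16 15, .succ 16, .store 9 9 16, .store 10 13 9,
      .succ 13]) (block [])]
  save := block [.load 8 8 9, .store 4 9 8, .load 8 9 9, .store 5 9 8]
  compare := seqs [block [.load 8 8 9], .branch (.eq 8 2) (block [])
    (seqs [block [.load 8 9 9, .load 9 5 9], .branch (.lt 9 8) (block [.const 8 0])
      (block [.const 8 1])])]

/-- The label that is stored as a flag and a value. -/
def flagged {β : Type*} (a : ℕ) (b : β) : WithTop β := if a = 0 then ⊤ else (b : WithTop β)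

/-- The invariant of breadth-first search. -/
structure FifoInv (n : ℕ) (f : ℕ → WithTop ℕ) (P : Finset ℕ) (cur : ℕ) (s : State) : Prop where
  idle : ∀ r, s.arr 15 r = 0
  label : ∀ v < n, f v = flagged (s.arr 8 v) (s.arr 9 v)
  le : s.reg 12 ≤ s.reg 13
  mem : ∀ v, v ∈ P ↔ ∃ i, s.reg 12 ≤ i ∧ i < s.reg 13 ∧ s.arr 10 i = v
  lt : ∀ i, s.reg 12 ≤ i → i < s.reg 13 → s.arr 10 i < n
  flag : ∀ i, s.reg 12 ≤ i → i < s.reg 13 → s.arr 8 (s.arr 10 i) ≠ 0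
  inj : ∀ i j, s.reg 12 ≤ i → i < s.reg 13 → s.reg 12 ≤ j → j < s.reg 13 →
    s.arr 10 i = s.arr 10 j → i = j
  mono : ∀ i j, s.reg 12 ≤ i → i ≤ j → j < s.reg 13 → s.arr 9 (s.arr 10 i) ≤ s.arr 9 (s.arr 10 j)
  bound : ∀ i, s.reg 12 ≤ i → i < s.reg 13 → s.arr 9 (s.arr 10 i) ≤ cur + 1
  le_label : ∀ i, s.reg 12 ≤ i → i < s.reg 13 → cur ≤ s.arr 9 (s.arr 10 i)
  cur : s.reg 15 = cur

theorem wp_fifo_init {G : CSR ℕ} {wtOk : (ℕ → ℝ≥0) → Prop} {T K : ℕ} {s : State}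
    (hs : Input G wtOk s) (hidle : ∀ r, s.arr 15 r = 0) (hx : s.reg 4 < G.n)
    (hT : K + 20 * (G.n + 1) ≤ T) :
    WP fifo.init (fun T' s' => SameMain s s' ∧ FifoInv G.n
      (Function.update (fun _ => ⊤) (s.reg 4) (WithTop.some 0)) {s.reg 4} 0 s' ∧ K ≤ T') T s := by
  refine wp_seq (wp_block (by simp; omega) ?_)
  refine wp_seq (wp_loop (fun T' s' => SameMain s s' ∧ s'.reg 14 ≤ G.n ∧
    (∀ v < s'.reg 14, s'.arr 8 v = 0) ∧ (∀ r, s'.arr 15 r = 0) ∧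
    K + 10 + 4 * (G.n - s'.reg 14) ≤ T') ?_ ?_)
  · refine ⟨⟨?_, fun _ _ => rfl, fun _ _ => rfl⟩, ?_, ?_, ?_, ?_⟩
    · intro r hr
      simp [runs, Instr.run, show r ≠ 14 by omega]
    · simp [runs, Instr.run]
    · simp [runs, Instr.run]
    · simpa [runs, Instr.run] using hidle
    · simp [runs, Instr.run]
      omega
  · rintro T s1 ⟨hM, hle, h8, hi, hT⟩
    have h0 : s1.reg 0 = G.n := by rw [hM.reg 0 (by simp), hs.n]
    have h2 : s1.reg 2 = 0 := by rw [hM.reg 2 (by simp), hs.zero]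
    have h4 : s1.reg 4 = s.reg 4 := hM.reg 4 (by simp)
    refine ⟨by omega, fun hb => ?_, fun hb => ?_⟩
    · simp only [Test.Holds, h0] at hb
      refine wp_block (by simp; omega) ⟨hM.trans ⟨?_, ?_, fun _ _ => rfl⟩, ?_, ?_, ?_, ?_⟩
      · intro r hr
        simp [runs, Instr.run, show r ≠ 14 by omega]
      · intro a ha
        simp [runs, Instr.run, show a ≠ 8 by omega]
      · simp [runs, Instr.run]
        omega
      · intro v hv
        simp [runs, Instr.run] at hv
        by_cases h : v = s1.reg 14
        · simp [runs, Instr.run, h, h2]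
        · simp [runs, Instr.run, h, h8 v (by omega)]
      · simpa [runs, Instr.run] using hi
      · simp [runs, Instr.run]
        omega
    · simp only [Test.Holds, h0] at hb
      have h14 : s1.reg 14 = G.n := by omega
      rw [h14] at h8
      refine wp_block (by simp; omega) ⟨hM.trans ⟨?_, ?_, fun _ _ => rfl⟩, ?_, ?_⟩
      · intro r hr
        simp [runs, Instr.run, show r ≠ 16 by omega, show r ≠ 12 by omega, show r ≠ 13 by omega,
          show r ≠ 15 by omega]
      · intro a ha
        simp [runs, Instr.run, show a ≠ 8 by omega, show a ≠ 9 by omega, show a ≠ 10 by omega]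
      · constructor
        · simpa [runs, Instr.run] using hi
        · intro v hv
          by_cases h : v = s.reg 4
          · simp [runs, Instr.run, h, h4, h2, flagged]
          · simp [runs, Instr.run, h, h4, h2, flagged, h8 v hv]
        · simp [runs, Instr.run]
        · intro v
          simp [runs, Instr.run, h4]
          exact eq_comm
        · simp [runs, Instr.run, h4, hx]
        · simp [runs, Instr.run, h4]
        · simp [runs, Instr.run]
        · simp only [runs, Instr.run, List.foldl]
          simp
          rintro i j h rfl
          rw [Nat.le_zero.1 h]
        · simp [runs, Instr.run, h2]
        · simp [runs, Instr.run, h2]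
        · simp [runs, Instr.run]
      · simp
        omega

/-- Labels are nondecreasing along the queue, so its first vertex has the smallest label. -/
theorem wp_fifo_extract {n : ℕ} {T K : ℕ} {s : State} {f : ℕ → WithTop ℕ} {P : Finset ℕ} {cur : ℕ}
    (hA : FifoInv n f P cur s) (hT : K + 10 ≤ T) :
    WP fifo.extract (fun T' s' => SameMain s s' ∧
      ((P = ∅ ∧ s'.reg 11 = 0 ∧ FifoInv n f P cur s' ∧ K ≤ T') ∨
        ∃ u ∈ P, s'.reg 10 = u ∧ 0 < s'.reg 11 ∧ (∀ v ∈ P, f u ≤ f v) ∧ ∃ b, f u = WithTop.some b ∧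
          FifoInv n f (P.erase u) b s' ∧ K ≤ T')) T s := by
  refine wp_branch (by omega) (fun hb => ?_) (fun hb => ?_)
  · simp only [Test.Holds] at hb
    refine wp_block (by simp; omega) ⟨⟨?_, fun _ _ => rfl, fun _ _ => rfl⟩, Or.inr
      ⟨s.arr 10 (s.reg 12), (hA.mem _).2 ⟨_, le_rfl, hb, rfl⟩, ?_, ?_, ?_,
        s.arr 9 (s.arr 10 (s.reg 12)), ?_, ⟨?_, ?_, ?_, ?_, ?_, ?_, ?_, ?_, ?_, ?_, ?_⟩, ?_⟩⟩
    · intro r hr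
      simp [runs, Instr.run, show r ≠ 10 by omega, show r ≠ 11 by omega, show r ≠ 12 by omega,
        show r ≠ 15 by omega]
    · simp [runs, Instr.run]
    · simp [runs, Instr.run]
    · intro v hv
      obtain ⟨i, h1, h2, rfl⟩ := (hA.mem v).1 hv
      rw [hA.label _ (hA.lt _ le_rfl hb), hA.label _ (hA.lt _ h1 h2), flagged, flagged,
        if_neg (hA.flag _ le_rfl hb), if_neg (hA.flag _ h1 h2)]
      exact_mod_cast hA.mono _ _ le_rfl h1 h2
    · rw [hA.label _ (hA.lt _ le_rfl hb), flagged, if_neg (hA.flag _ le_rfl hb)]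
    · simpa [runs, Instr.run] using hA.idle
    · simpa [runs, Instr.run] using hA.label
    · simp [runs, Instr.run]
      omega
    · intro v
      simp only [runs, Instr.run, List.foldl, Finset.mem_erase, hA.mem]
      simp
      constructor
      · rintro ⟨h1, i, h2, h3, rfl⟩
        refine ⟨i, lt_of_le_of_ne h2 ?_, h3, rfl⟩
        rintro rfl
        exact h1 rfl
      · rintro ⟨i, h2, h3, rfl⟩
        refine ⟨fun h => ?_, i, by omega, h3, rfl⟩
        have := hA.inj _ _ (by omega) h3 le_rfl hb h
        omega
    · intro i h1 h2
      simp [runs, Instr.run] at h1 h2 ⊢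
      exact hA.lt i (by omega) h2
    · intro i h1 h2
      simp [runs, Instr.run] at h1 h2 ⊢
      exact hA.flag i (by omega) h2
    · intro i j h1 h2 h3 h4 h5
      simp [runs, Instr.run] at h1 h2 h3 h4 h5
      exact hA.inj i j (by omega) h2 (by omega) h4 h5
    · intro i j h1 h2 h3
      simp [runs, Instr.run] at h1 h3 ⊢
      exact hA.mono i j (by omega) h2 h3
    · intro i h1 h2
      simp [runs, Instr.run] at h1 h2 ⊢
      -- Labels in the queue are at most the old `cur` plus 1, and the new `cur`, the label of the
      -- removed vertex, is not smaller than the old one.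
      exact (hA.bound i (by omega) h2).trans (Nat.succ_le_succ (hA.le_label _ le_rfl hb))
    · intro i h1 h2
      simp [runs, Instr.run] at h1 h2 ⊢
      exact hA.mono _ i le_rfl (by omega) h2
    · simp [runs, Instr.run]
    · simp; omega
  · simp only [Test.Holds] at hb
    refine wp_block (by simp; omega) ⟨⟨?_, fun _ _ => rfl, fun _ _ => rfl⟩, Or.inl
      ⟨?_, ?_, ?_, ?_⟩⟩
    · intro r hr
      simp [runs, Instr.run, show r ≠ 11 by omega]
    · refine Finset.eq_empty_of_forall_notMem fun v hv => ?_
      obtain ⟨i, h1, h2, -⟩ := (hA.mem v).1 hv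
      omega
    · simp [runs, Instr.run]
    · exact { hA with }
    · simp; omega

/-- A vertex that has been reached has a label of at most `cur + 1`, whether or not it is still in
the queue, so no label is ever lowered and nothing has to be compared. A new vertex gets the label
`cur + 1`, which is maximal in the queue, and its place at the end keeps the queue sorted. -/
theorem wp_fifo_relax {G : CSR ℕ} {T K : ℕ} {s : State} {f : ℕ → WithTop ℕ}
    {P : Finset ℕ} {cur : ℕ} (hz : s.reg 2 = 0) (hA : FifoInv G.n f P cur s) (h9 : s.reg 9 < G.n)
    (h : s.reg 9 ∈ P ∨ f (s.reg 9) = ⊤ ∨ f (s.reg 9) ≤ (WithTop.some (cur + 1))) (hT : K + 12 ≤ T) :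
    WP fifo.relax (fun T' s' => SameMain s s' ∧ s'.reg 10 = s.reg 10 ∧ FifoInv G.n
      (Function.update f (s.reg 9) (min (f (s.reg 9)) (WithTop.some (cur + 1))))
      (if WithTop.some (cur + 1) < f (s.reg 9) then insert (s.reg 9) P else P) cur s' ∧
        K ≤ T') T s := by
  refine wp_seq (wp_block (by simp; omega) ?_)
  refine wp_branch (by simp; omega) (fun hb => ?_) (fun hb => ?_)
  · simp [Test.Holds, runs, Instr.run, hz] at hb
    have hf : f (s.reg 9) = ⊤ := by rw [hA.label _ h9, flagged, if_pos hb]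
    have hne : ∀ i, s.reg 12 ≤ i → i < s.reg 13 → s.arr 10 i ≠ s.reg 9 := by
      intro i h1 h2 h3
      exact hA.flag i h1 h2 (by rw [h3, hb])
    rw [hf, if_pos (WithTop.coe_lt_top _), min_eq_right le_top]
    refine wp_block (by simp; omega) ⟨⟨?_, ?_, fun _ _ => rfl⟩, ?_,
      ⟨?_, ?_, ?_, ?_, ?_, ?_, ?_, ?_, ?_, ?_, ?_⟩, ?_⟩
    · intro r hr
      simp [runs, Instr.run, show r ≠ 16 by omega, show r ≠ 13 by omega]
    · intro a ha
      simp [runs, Instr.run, show a ≠ 8 by omega, show a ≠ 9 by omega, show a ≠ 10 by omega]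
    · simp [runs, Instr.run]
    · simpa [runs, Instr.run] using hA.idle
    · intro v hv
      by_cases hv' : v = s.reg 9
      · simp [runs, Instr.run, hv', flagged, hA.cur]
      · simp [runs, Instr.run, hv', hA.label v hv]
    · simp [runs, Instr.run]
      exact hA.le.trans (Nat.le_succ _)
    · intro v
      simp only [runs, Instr.run, List.foldl, Finset.mem_insert, hA.mem]
      simp
      constructor
      · rintro (rfl | ⟨i, h1, h2, rfl⟩)
        · exact ⟨s.reg 13, hA.le, by omega, by simp⟩
        · exact ⟨i, h1, by omega, by rw [Function.update_of_ne (by omega)]⟩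
      · rintro ⟨i, h1, h2, rfl⟩
        by_cases hi : i = s.reg 13
        · left; simp [hi]
        · right; exact ⟨i, h1, by omega, by rw [Function.update_of_ne hi]⟩
    · intro i h1 h2
      simp [runs, Instr.run] at h1 h2 ⊢
      by_cases hi : i = s.reg 13
      · simpa [hi] using h9
      · rw [Function.update_of_ne hi]; exact hA.lt i h1 (by omega)
    · intro i h1 h2
      simp [runs, Instr.run] at h1 h2 ⊢
      by_cases hi : i = s.reg 13
      · simp [hi]
      · rw [Function.update_of_ne hi, Function.update_of_ne (hne i h1 (by omega))]
        exact hA.flag i h1 (by omega)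
    · intro i j h1 h2 h3 h4 h5
      simp [runs, Instr.run] at h1 h2 h3 h4 h5
      by_cases hi : i = s.reg 13
      · by_cases hj : j = s.reg 13
        · rw [hi, hj]
        · rw [hi, Function.update_self, Function.update_of_ne hj] at h5
          exact absurd h5.symm (hne j h3 (by omega))
      · by_cases hj : j = s.reg 13
        · rw [hj, Function.update_self, Function.update_of_ne hi] at h5
          exact absurd h5 (hne i h1 (by omega))
        · rw [Function.update_of_ne hi, Function.update_of_ne hj] at h5
          exact hA.inj i j h1 (by omega) h3 (by omega) h5
    · intro i j h1 h2 h3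
      simp [runs, Instr.run] at h1 h3 ⊢
      by_cases hj : j = s.reg 13
      · rw [hj, Function.update_self, Function.update_self, hA.cur]
        by_cases hi : i = s.reg 13
        · simp [hi]
        · rw [Function.update_of_ne hi, Function.update_of_ne (hne i h1 (by omega))]
          exact hA.bound i h1 (by omega)
      · rw [Function.update_of_ne hj, Function.update_of_ne (show i ≠ s.reg 13 by omega),
          Function.update_of_ne (hne i h1 (by omega)),
          Function.update_of_ne (hne j (by omega) (by omega))]
        exact hA.mono i j h1 h2 (by omega)
    · intro i h1 h2
      simp [runs, Instr.run] at h1 h2 ⊢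
      by_cases hi : i = s.reg 13
      · simp [hi, hA.cur]
      · rw [Function.update_of_ne hi, Function.update_of_ne (hne i h1 (by omega))]
        exact hA.bound i h1 (by omega)
    · intro i h1 h2
      simp [runs, Instr.run] at h1 h2 ⊢
      by_cases hi : i = s.reg 13
      · simp [hi, hA.cur]
      · rw [Function.update_of_ne hi, Function.update_of_ne (hne i h1 (by omega))]
        exact hA.le_label i h1 (by omega)
    · simp [runs, Instr.run, hA.cur]
    · simp; omega
  · simp [Test.Holds, runs, Instr.run, hz] at hb
    have hf : f (s.reg 9) = WithTop.some (s.arr 9 (s.reg 9)) := by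
      rw [hA.label _ h9, flagged, if_neg hb]
    have hle : f (s.reg 9) ≤ (WithTop.some (cur + 1)) := by
      rcases h with h | h | h
      · obtain ⟨i, h1, h2, h3⟩ := (hA.mem _).1 h
        have := hA.bound i h1 h2
        rw [h3] at this
        rw [hf]
        exact_mod_cast this
      · rw [hf] at h
        exact absurd h (WithTop.coe_ne_top)
      · exact h
    rw [min_eq_left hle, Function.update_eq_self, if_neg (not_lt.2 hle)]
    refine wp_block (by simp; omega) ⟨⟨?_, fun _ _ => rfl, fun _ _ => rfl⟩, ?_, ?_, ?_⟩
    · intro r hr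
      simp [runs, Instr.run, show r ≠ 16 by omega]
    · simp [runs, Instr.run]
    · exact { hA with }
    · simp; omega

/-- The queue of breadth-first search meets the specification. -/
def fifoSpec (G : CSR ℕ) (hwt : ∀ e, G.wt e = 1) : QueueSpec fifo G (fun _ => True) 20 10 where
  A _ f P cur _ s := FifoInv G.n f P cur s
  Saved s y g := g = flagged (s.arr 4 y) (s.arr 5 y)
  congr := by
    rintro - f P cur - s s' h ⟨hr, ha, hw, hw'⟩
    obtain ⟨h1, h2, h3, h4, h5, h6, h7, h8, h9, h10, h11⟩ := h
    constructor <;> simpa [hr, ha]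
  idle h := h.idle
  saved_congr h h4 h5 _ := by rw [h, h4, h5]
  -- All operations have constant worst-case cost; the potential is zero at the start and stays
  -- constant.
  init h1 h2 h3 h4 := (wp_fifo_init h1 h2 h3 h4).mono
    fun _ _ ⟨a, b, c⟩ => ⟨a, 0, b, c⟩
  extract {T s K j f P cur k} h1 h2 _ h4 := (wp_fifo_extract h2 (K := K + k) h4).mono (by
    rintro T' s' ⟨a, ⟨b, c, d, e⟩ | ⟨u, h1, h2, h3, h4, b, h5, h6, h7⟩⟩
    · exact ⟨a, Or.inl ⟨b, c, ⟨cur, k, d⟩, by omega⟩⟩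
    · exact ⟨a, Or.inr ⟨u, h1, h2, h3, h4, k, b, h5, h6, by omega⟩⟩)
  relax {T s K j f P cur k} h1 h2 _ _ h5 h6 h7 := by
    rw [hwt] at *
    exact (wp_fifo_relax h1.zero h2 h5 h6 (K := K + k) (by omega)).mono
      fun _ _ ⟨a, b, c, d⟩ => ⟨a, b, k, c, d⟩
  save {T s j f P cur k} h1 h2 h3 h4 := by
    refine wp_block (by simp; omega) ⟨⟨?_, ?_, fun _ _ => rfl, rfl⟩, ?_, ?_, rfl, ?_, ?_, ?_⟩
    · intro r hr
      simp [runs, Instr.run, show r ≠ 8 by omega]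
    · intro a ha
      simp [runs, Instr.run, show a ≠ 4 by omega, show a ≠ 5 by omega]
    · intro r hr
      simp [runs, Instr.run, show r ≠ 8 by omega]
    · intro a ha
      simp [runs, Instr.run, show a ≠ 4 by omega, show a ≠ 5 by omega]
    · simp [runs, Instr.run, h2.label _ h3]
    · intro z hz g hg
      simpa [runs, Instr.run, hz] using hg
    · simp; omega
  compare {T s j f P cur k g} h1 h2 h3 h4 h5 h6 := by
    have hf := h2.label _ h3
    have hz := h1.zero
    refine wp_seq (wp_block (by simp; omega) (wp_branch (by simp; omega) (fun hb => ?_)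
      (fun hb => ?_)))
    · simp [Test.Holds, runs, Instr.run, hz] at hb
      refine wp_block (by simp; omega) ⟨⟨?_, ?_, fun _ _ => rfl, rfl⟩, ?_, ?_, fun _ _ => rfl, ?_, ?_⟩
      · intro r hr
        simp [runs, Instr.run, show r ≠ 8 by omega]
      · intro a ha
        simp [runs, Instr.run]
      · intro r hr
        simp [runs, Instr.run, show r ≠ 8 by omega]
      · intro a ha
        simp [runs, Instr.run]
      · simp [runs, Instr.run, hf, hb, flagged]
      · simp; omega
    · simp [Test.Holds, runs, Instr.run, hz] at hb
      rw [flagged, if_neg hb] at hf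
      -- The saved label is at most the current one, which is finite here; hence it is finite too
      -- and the program need not look at its flag.
      have hg : s.arr 4 (s.reg 9) ≠ 0 := by
        intro h
        rw [h4, hf, flagged, if_pos h] at h5
        simp at h5
      rw [flagged, if_neg hg] at h4
      refine wp_seq (wp_block (by simp; omega) (wp_branch (by simp; omega) (fun hb => ?_)
        (fun hb => ?_)))
      all_goals
        simp [Test.Holds, runs, Instr.run] at hb
        refine wp_block (by simp; omega) ⟨⟨?_, ?_, fun _ _ => rfl, rfl⟩, ?_, ?_, fun _ _ => rfl,
          ?_, ?_⟩
        · intro r hr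
          simp [runs, Instr.run, show r ≠ 8 by omega, show r ≠ 9 by omega]
        · intro a ha
          simp [runs, Instr.run]
        · intro r hr
          simp [runs, Instr.run, show r ≠ 8 by omega, show r ≠ 9 by omega]
        · intro a ha
          simp [runs, Instr.run]
        · rw [hf, h4]
          simp [runs, Instr.run]
          exact hb
        · simp; omega

/-! ## Hollow heaps -/

/-- The tree structure of a hollow heap: `X` is the set of the nodes, `par` assigns to each node its
parent (`0` for roots), `rk` its rank and `dg` its number of children. The children of `u` have the
ranks `rk u - 1, …, rk u - dg u` and are listed, in this order, by `ch` (first child) and `nx` (next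
sibling). -/
structure HeapTree (X : Finset ℕ) (par rk dg ch nx : ℕ → ℕ) (key : ℕ → ℝ≥0) : Prop where
  pos : ∀ u ∈ X, u ≠ 0
  par_mem : ∀ c ∈ X, par c ≠ 0 → par c ∈ X
  par_lt : ∀ c ∈ X, par c ≠ 0 → rk c < rk (par c)
  par_le : ∀ c ∈ X, par c ≠ 0 → rk (par c) ≤ rk c + dg (par c)
  par_key : ∀ c ∈ X, par c ≠ 0 → key (par c) ≤ key c
  uniq : ∀ c ∈ X, ∀ c' ∈ X, par c ≠ 0 → par c = par c' → rk c = rk c' → c = c'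
  child : ∀ u ∈ X, dg u ≠ 0 → ch u ∈ X ∧ par (ch u) = u ∧ rk (ch u) + 1 = rk u
  next : ∀ c ∈ X, par c ≠ 0 → rk (par c) < rk c + dg (par c) →
    nx c ∈ X ∧ par (nx c) = par c ∧ rk (nx c) + 1 = rk c

/-- The roots of a hollow heap are stored in the stack `st` of size `k` and in the table `tb`, which
is indexed by ranks and contains only full roots; the root `ext` is stored elsewhere. -/
structure HeapRoots (X : Finset ℕ) (par : ℕ → ℕ) (ext k : ℕ) (nd it rk st tb : ℕ → ℕ) : Prop where
  root : ∀ c ∈ X, par c = 0 → c = ext ∨ (∃ i < k, st i = c) ∨ tb (rk c) = c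
  st_mem : ∀ i < k, st i ∈ X ∧ par (st i) = 0 ∧ st i ≠ ext ∧ tb (rk (st i)) ≠ st i
  st_inj : ∀ i < k, ∀ j < k, st i = st j → i = j
  tb_mem : ∀ r, tb r ≠ 0 → tb r ∈ X ∧ par (tb r) = 0 ∧ rk (tb r) = r ∧ tb r ≠ ext ∧
    nd (it (tb r)) = tb r
  ext_mem : ext ≠ 0 → ext ∈ X ∧ par ext = 0

/-- The node `u` belongs to the vertex `it u`; it is full if it is the latest node `nd (it u)` of
this vertex and hollow otherwise. All nodes have numbers below `cnt`. -/
structure HeapVerts (n : ℕ) (X : Finset ℕ) (ext cnt : ℕ) (nd it rk dg : ℕ → ℕ) : Prop where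
  cnt_pos : 0 < cnt
  lt_cnt : ∀ u ∈ X, u < cnt
  it_lt : ∀ u ∈ X, it u < n
  nd_it : ∀ v < n, nd v ≠ 0 → it (nd v) = v ∧ nd v < cnt
  full : ∀ u ∈ X, u ≠ ext → nd (it u) = u → dg u = rk u
  hollow : ∀ u ∈ X, u ≠ ext → nd (it u) ≠ u → dg u ≤ 2
  two : ∀ u ∈ X, u ≠ ext → rk u ≤ dg u ∨ 2 ≤ dg u

/-- The invariant of a hollow heap. -/
structure HeapInv (n : ℕ) (X : Finset ℕ) (par : ℕ → ℕ) (ext k cnt : ℕ)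
    (nd it rk dg ch nx st tb : ℕ → ℕ) (key : ℕ → ℝ≥0) : Prop where
  tree : HeapTree X par rk dg ch nx key
  roots : HeapRoots X par ext k nd it rk st tb
  verts : HeapVerts n X ext cnt nd it rk dg

section

variable {n : ℕ} {X : Finset ℕ} {par : ℕ → ℕ} {ext k cnt u : ℕ} {nd it rk dg ch nx st tb : ℕ → ℕ}
  {key : ℕ → ℝ≥0}

/-- The root `ext` is in transit: it is stored neither on the stack nor in the table, and it is
exempt from the conditions on numbers of children, which fail while its children are being removed.
Since no node has number 0, `ext = 0` means that there is no such root. -/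
theorem HeapInv.pop (h : HeapInv n X par 0 (k + 1) cnt nd it rk dg ch nx st tb key) :
    HeapInv n X par (st k) k cnt nd it rk dg ch nx st tb key := by
  obtain ⟨ht, hr, hv⟩ := h
  have h1 := hr.st_mem k (by omega)
  have hp := ht.pos
  refine ⟨ht, ?_, ?_⟩
  · obtain ⟨a, b, c, d, e⟩ := hr
    constructor <;> grind
  · obtain ⟨a, b, c, d, e, f, g⟩ := hv
    constructor <;> grind

theorem HeapRoots.push (h : HeapRoots X par u k nd it rk st tb) (hX : ∀ v ∈ X, v ≠ 0)
    (hu : u ≠ 0) :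
    HeapRoots X par 0 (k + 1) nd it rk (Function.update st k u) tb where
  root c hc h0 := by
    rcases h.root c hc h0 with rfl | ⟨i, hi, rfl⟩ | h1
    · exact Or.inr (Or.inl ⟨k, by omega, Function.update_self ..⟩)
    · exact Or.inr (Or.inl ⟨i, by omega, Function.update_of_ne (by omega) ..⟩)
    · exact Or.inr (Or.inr h1)
  st_mem i hi := by
    by_cases hik : i = k
    · rw [hik, Function.update_self]
      refine ⟨(h.ext_mem hu).1, (h.ext_mem hu).2, hu, fun h1 => ?_⟩
      exact (h.tb_mem (rk u) (by rw [h1]; exact hu)).2.2.2.1 h1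
    · rw [Function.update_of_ne hik]
      obtain ⟨h1, h2, h3, h4⟩ := h.st_mem i (by omega)
      exact ⟨h1, h2, hX _ h1, h4⟩
  st_inj i hi j hj hij := by
    by_cases hik : i = k <;> by_cases hjk : j = k
    · omega
    · rw [hik, Function.update_self, Function.update_of_ne hjk] at hij
      exact absurd hij.symm (h.st_mem j (by omega)).2.2.1
    · rw [hjk, Function.update_self, Function.update_of_ne hik] at hij
      exact absurd hij (h.st_mem i (by omega)).2.2.1
    · rw [Function.update_of_ne hik, Function.update_of_ne hjk] at hij
      exact h.st_inj i (by omega) j (by omega) hij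
  tb_mem r hr := by
    obtain ⟨h1, h2, h3, -, h5⟩ := h.tb_mem r hr
    exact ⟨h1, h2, h3, hr, h5⟩
  ext_mem h0 := absurd rfl h0

/-- A full root with as many children as its rank satisfies the conditions from which it was exempt,
so the exemption can be passed on to any other node. -/
theorem HeapVerts.setExt (h : HeapVerts n X u cnt nd it rk dg) (hf : nd (it u) = u)
    (hdg : dg u = rk u) (e : ℕ) : HeapVerts n X e cnt nd it rk dg where
  cnt_pos := h.cnt_pos
  lt_cnt := h.lt_cnt
  it_lt := h.it_lt
  nd_it := h.nd_it
  full v hv _ h1 := by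
    by_cases hvu : v = u
    · rw [hvu, hdg]
    · exact h.full v hv hvu h1
  hollow v hv _ h1 := by
    by_cases hvu : v = u
    · rw [hvu] at h1; exact absurd hf h1
    · exact h.hollow v hv hvu h1
  two v hv _ := by
    by_cases hvu : v = u
    · rw [hvu, hdg]; exact Or.inl le_rfl
    · exact h.two v hv hvu

theorem HeapInv.push (h : HeapInv n X par u k cnt nd it rk dg ch nx st tb key) (hu : u ≠ 0)
    (hf : nd (it u) = u) (hdg : dg u = rk u) :
    HeapInv n X par 0 (k + 1) cnt nd it rk dg ch nx (Function.update st k u) tb key :=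
  ⟨h.tree, h.roots.push h.tree.pos hu, h.verts.setExt hf hdg 0⟩

/-- The rank of `u` is lowered together with the number of its children: the remaining ones have the
ranks from `rk u - 2` on downwards, which is the required pattern for the rank `rk u - 1`. -/
theorem HeapTree.detach (h : HeapTree X par rk dg ch nx key) (hu : u ∈ X) (hp : par u = 0)
    (hdg : dg u ≠ 0) :
    HeapTree X (Function.update par (ch u) 0) (Function.update rk u (rk u - 1))
      (Function.update dg u (dg u - 1)) (Function.update ch u (nx (ch u))) nx key := by
  obtain ⟨hc1, hc2, hc3⟩ := h.child u hu hdg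
  have hu0 := h.pos u hu
  have hle := h.par_le _ hc1 (by rw [hc2]; exact hu0)
  rw [hc2] at hle
  have key : ∀ c ∈ X, Function.update par (ch u) 0 c ≠ 0 → c ≠ ch u ∧ par c ≠ 0 ∧
      Function.update par (ch u) 0 c = par c ∧ c ≠ u ∧ (par c = u → rk c + 1 < rk u) := by
    intro c hc h0
    have h1 : c ≠ ch u := by rintro rfl; simp at h0
    rw [Function.update_of_ne h1] at h0 ⊢
    refine ⟨h1, h0, rfl, by rintro rfl; exact h0 hp, fun h2 => ?_⟩
    have h3 := h.par_lt c hc h0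
    rw [h2] at h3
    have h4 : rk c ≠ rk (ch u) := fun h4 => h1 (h.uniq c hc _ hc1 h0 (h2.trans hc2.symm) h4)
    omega
  constructor
  · exact h.pos
  · intro c hc h0
    obtain ⟨k1, k2, k3, k4, k5⟩ := key c hc h0
    rw [k3]
    exact h.par_mem c hc k2
  · intro c hc h0
    obtain ⟨k1, k2, k3, k4, k5⟩ := key c hc h0
    have := h.par_lt c hc k2
    rw [k3, Function.update_of_ne k4]
    by_cases hpu : par c = u
    · rw [hpu, Function.update_self]
      have := k5 hpu
      omega
    · rwa [Function.update_of_ne hpu]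
  · intro c hc h0
    obtain ⟨k1, k2, k3, k4, k5⟩ := key c hc h0
    have := h.par_le c hc k2
    rw [k3, Function.update_of_ne k4]
    by_cases hpu : par c = u
    · rw [hpu] at this
      rw [hpu, Function.update_self, Function.update_self]
      omega
    · rwa [Function.update_of_ne hpu, Function.update_of_ne hpu]
  · intro c hc h0
    obtain ⟨k1, k2, k3, k4, k5⟩ := key c hc h0
    rw [k3]
    exact h.par_key c hc k2
  · intro c hc c' hc' h0 h1 h2
    obtain ⟨k1, k2, k3, k4, k5⟩ := key c hc h0
    obtain ⟨l1, l2, l3, l4, l5⟩ := key c' hc' (h1 ▸ h0)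
    rw [k3, l3] at h1
    rw [Function.update_of_ne k4, Function.update_of_ne l4] at h2
    exact h.uniq c hc c' hc' k2 h1 h2
  · intro v hv h0
    by_cases hvu : v = u
    · subst hvu
      rw [Function.update_self] at h0
      obtain ⟨n1, n2, n3⟩ := h.next (ch v) hc1 (by rw [hc2]; exact hu0) (by rw [hc2]; omega)
      have hne : nx (ch v) ≠ ch v := by intro h; rw [h] at n3; omega
      have hne' : nx (ch v) ≠ v := by intro h; rw [h] at n3; omega
      rw [Function.update_self, Function.update_of_ne hne, Function.update_of_ne hne',
        Function.update_self]
      exact ⟨n1, n2.trans hc2, by omega⟩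
    · rw [Function.update_of_ne hvu] at h0 ⊢
      obtain ⟨n1, n2, n3⟩ := h.child v hv h0
      have hne : ch v ≠ ch u := fun h => hvu (by rw [← n2, h, hc2])
      have hne' : ch v ≠ u := by
        intro h5
        rw [h5, hp] at n2
        exact h.pos v hv n2.symm
      rw [Function.update_of_ne hne, Function.update_of_ne hvu, Function.update_of_ne hne']
      exact ⟨n1, n2, n3⟩
  · intro c hc h0 h1
    obtain ⟨k1, k2, k3, k4, k5⟩ := key c hc h0
    rw [k3, Function.update_of_ne k4] at h1
    have h2 : rk (par c) < rk c + dg (par c) := by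
      by_cases hpu : par c = u
      · rw [hpu, Function.update_self, Function.update_self] at h1
        rw [hpu]
        omega
      · rwa [Function.update_of_ne hpu, Function.update_of_ne hpu] at h1
    obtain ⟨n1, n2, n3⟩ := h.next c hc k2 h2
    have hne : nx c ≠ ch u := by
      intro h
      have := k5 (by rw [← n2, h, hc2])
      rw [h] at n3
      omega
    have hne' : nx c ≠ u := by
      intro h
      rw [h, hp] at n2
      exact k2 n2.symm
    rw [k3, Function.update_of_ne hne, Function.update_of_ne hne', Function.update_of_ne k4]
    exact ⟨n1, n2, n3⟩

theorem HeapInv.detach (h : HeapInv n X par u k cnt nd it rk dg ch nx st tb key) (hu : u ≠ 0)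
    (hdg : dg u ≠ 0) :
    HeapInv n X (Function.update par (ch u) 0) u (k + 1) cnt nd it
      (Function.update rk u (rk u - 1)) (Function.update dg u (dg u - 1))
      (Function.update ch u (nx (ch u))) nx (Function.update st k (ch u)) tb key := by
  obtain ⟨ht, hr, hv⟩ := h
  obtain ⟨hu1, hu2⟩ := hr.ext_mem hu
  obtain ⟨hc1, hc2, hc3⟩ := ht.child u hu1 hdg
  have hcu : ch u ≠ u := fun h => by rw [h] at hc3; omega
  refine ⟨ht.detach hu1 hu2 hdg, ?_, ?_⟩
  · constructor
    · intro c hc h0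
      by_cases h1 : c = ch u
      · exact Or.inr (Or.inl ⟨k, by omega, by rw [Function.update_self, h1]⟩)
      · rw [Function.update_of_ne h1] at h0
        rcases hr.root c hc h0 with h2 | ⟨i, hi, rfl⟩ | h2
        · exact Or.inl h2
        · exact Or.inr (Or.inl ⟨i, by omega, Function.update_of_ne (by omega) ..⟩)
        · by_cases h3 : c = u
          · exact Or.inl h3
          · exact Or.inr (Or.inr (by rwa [Function.update_of_ne h3]))
    · intro i hi
      by_cases h1 : i = k
      · rw [h1, Function.update_self, Function.update_self, Function.update_of_ne hcu]
        refine ⟨hc1, rfl, hcu, fun h2 => hu ?_⟩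
        have := hr.tb_mem _ (by rw [h2]; exact ht.pos _ hc1)
        rw [h2, hc2] at this
        exact this.2.1
      · obtain ⟨h2, h3, h4, h5⟩ := hr.st_mem i (by omega)
        have h6 : st i ≠ ch u := fun h => hu (by rw [← hc2, ← h, h3])
        rw [Function.update_of_ne h1, Function.update_of_ne h6, Function.update_of_ne h4]
        exact ⟨h2, h3, h4, h5⟩
    · intro i hi j hj hij
      have hne : ∀ i < k, st i ≠ ch u := fun i hi h =>
        hu (by rw [← hc2, ← h, (hr.st_mem i hi).2.1])
      by_cases hik : i = k <;> by_cases hjk : j = k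
      · omega
      · rw [hik, Function.update_self, Function.update_of_ne hjk] at hij
        exact absurd hij.symm (hne j (by omega))
      · rw [hjk, Function.update_self, Function.update_of_ne hik] at hij
        exact absurd hij (hne i (by omega))
      · rw [Function.update_of_ne hik, Function.update_of_ne hjk] at hij
        exact hr.st_inj i (by omega) j (by omega) hij
    · intro r h0
      obtain ⟨h1, h2, h3, h4, h5⟩ := hr.tb_mem r h0
      have h6 : tb r ≠ ch u := fun h => hu (by rw [← hc2, ← h, h2])
      rw [Function.update_of_ne h6, Function.update_of_ne h4]
      exact ⟨h1, h2, h3, h4, h5⟩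
    · intro _
      exact ⟨hu1, by rw [Function.update_of_ne hcu.symm, hu2]⟩
  · refine ⟨hv.cnt_pos, hv.lt_cnt, hv.it_lt, hv.nd_it, ?_, ?_, ?_⟩
    all_goals
      intro v hvX hvu
      simp only [Function.update_of_ne hvu]
    · exact hv.full v hvX hvu
    · exact hv.hollow v hvX hvu
    · exact hv.two v hvX hvu

/-- Nodes with parent `u` would have a rank below `rk u` and at least `rk u - dg u`, so there are
none if `dg u = 0`. -/
theorem HeapInv.destroy (h : HeapInv n X par u k cnt nd it rk dg ch nx st tb key) (hu : u ≠ 0)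
    (hdg : dg u = 0) : HeapInv n (X.erase u) par 0 k cnt nd it rk dg ch nx st tb key := by
  obtain ⟨ht, hr, hv⟩ := h
  obtain ⟨hu1, hu2⟩ := hr.ext_mem hu
  have hne : ∀ c ∈ X, par c ≠ u := by
    intro c hc h
    have h1 := ht.par_lt c hc (by rw [h]; exact hu)
    have h2 := ht.par_le c hc (by rw [h]; exact hu)
    rw [h] at h1 h2
    omega
  refine ⟨?_, ?_, ?_⟩
  · constructor
    · exact fun v hv => ht.pos v (Finset.mem_of_mem_erase hv)
    · intro c hc h0
      have hc := Finset.mem_of_mem_erase hc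
      exact Finset.mem_erase.2 ⟨hne c hc, ht.par_mem c hc h0⟩
    · exact fun c hc => ht.par_lt c (Finset.mem_of_mem_erase hc)
    · exact fun c hc => ht.par_le c (Finset.mem_of_mem_erase hc)
    · exact fun c hc => ht.par_key c (Finset.mem_of_mem_erase hc)
    · exact fun c hc c' hc' => ht.uniq c (Finset.mem_of_mem_erase hc) c' (Finset.mem_of_mem_erase hc')
    · intro v hv h0
      obtain ⟨h1, h2, h3⟩ := ht.child v (Finset.mem_of_mem_erase hv) h0
      refine ⟨Finset.mem_erase.2 ⟨fun h => ?_, h1⟩, h2, h3⟩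
      rw [h, hu2] at h2
      exact ht.pos v (Finset.mem_of_mem_erase hv) h2.symm
    · intro c hc h0 h4
      obtain ⟨h1, h2, h3⟩ := ht.next c (Finset.mem_of_mem_erase hc) h0 h4
      refine ⟨Finset.mem_erase.2 ⟨fun h => ?_, h1⟩, h2, h3⟩
      rw [h, hu2] at h2
      exact h0 h2.symm
  · constructor
    · intro c hc h0
      rcases hr.root c (Finset.mem_of_mem_erase hc) h0 with h | h
      · exact absurd h (Finset.ne_of_mem_erase hc)
      · exact Or.inr h
    · intro i hi
      obtain ⟨h1, h2, h3, h4⟩ := hr.st_mem i hi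
      exact ⟨Finset.mem_erase.2 ⟨h3, h1⟩, h2, ht.pos _ h1, h4⟩
    · exact hr.st_inj
    · intro r h0
      obtain ⟨h1, h2, h3, h4, h5⟩ := hr.tb_mem r h0
      exact ⟨Finset.mem_erase.2 ⟨h4, h1⟩, h2, h3, h0, h5⟩
    · exact fun h => absurd rfl h
  · refine ⟨hv.cnt_pos, fun v hv' => hv.lt_cnt v (Finset.mem_of_mem_erase hv'),
      fun v hv' => hv.it_lt v (Finset.mem_of_mem_erase hv'), hv.nd_it, ?_, ?_, ?_⟩
    · exact fun v h1 _ => hv.full v (Finset.mem_of_mem_erase h1) (Finset.ne_of_mem_erase h1)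
    · exact fun v h1 _ => hv.hollow v (Finset.mem_of_mem_erase h1) (Finset.ne_of_mem_erase h1)
    · exact fun v h1 _ => hv.two v (Finset.mem_of_mem_erase h1) (Finset.ne_of_mem_erase h1)

end

/-! ### Linking, the table of roots, and the logarithmic bound on ranks -/

section

variable {n : ℕ} {X : Finset ℕ} {par : ℕ → ℕ} {ext k cnt u : ℕ} {nd it rk dg ch nx st tb : ℕ → ℕ}
  {key : ℕ → ℝ≥0}

/-- The new child has the old rank of its parent, one more than that of the former first child, so
it belongs in front of the list. If `a` had no children, then `nx b` becomes meaningless, but `next`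
does not speak of the last child. -/
theorem HeapTree.link (h : HeapTree X par rk dg ch nx key) {a b : ℕ} (ha : a ∈ X) (hb : b ∈ X)
    (hpa : par a = 0) (hpb : par b = 0) (hab : a ≠ b) (hrk : rk a = rk b) (hkey : key a ≤ key b) :
    HeapTree X (Function.update par b a) (Function.update rk a (rk a + 1))
      (Function.update dg a (dg a + 1)) (Function.update ch a b) (Function.update nx b (ch a))
      key := by
  have ha0 := h.pos a ha
  have hpar : ∀ c, par c ≠ 0 → c ≠ b ∧ c ≠ a := fun c hc =>
    ⟨fun h => hc (h ▸ hpb), fun h => hc (h ▸ hpa)⟩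
  have hold : ∀ c, c ≠ b → Function.update par b a c = par c := fun c hc => Function.update_of_ne hc ..
  constructor
  · exact h.pos
  · intro c hc h0
    by_cases hcb : c = b
    · rwa [hcb, Function.update_self]
    · rw [hold c hcb] at h0 ⊢
      exact h.par_mem c hc h0
  · intro c hc h0
    by_cases hcb : c = b
    · rw [hcb, Function.update_self, Function.update_self, Function.update_of_ne hab.symm]
      omega
    · rw [hold c hcb] at h0 ⊢
      rw [Function.update_of_ne (hpar c h0).2]
      have h1 := h.par_lt c hc h0
      by_cases h2 : par c = a
      · rw [h2] at h1
        rw [h2, Function.update_self]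
        omega
      · rwa [Function.update_of_ne h2]
  · intro c hc h0
    by_cases hcb : c = b
    · rw [hcb, Function.update_self, Function.update_self, Function.update_of_ne hab.symm,
        Function.update_self]
      omega
    · rw [hold c hcb] at h0 ⊢
      rw [Function.update_of_ne (hpar c h0).2]
      have h1 := h.par_le c hc h0
      by_cases h2 : par c = a
      · rw [h2] at h1
        rw [h2, Function.update_self, Function.update_self]
        omega
      · rwa [Function.update_of_ne h2, Function.update_of_ne h2]
  · intro c hc h0
    by_cases hcb : c = b
    · rwa [hcb, Function.update_self]
    · rw [hold c hcb] at h0 ⊢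
      exact h.par_key c hc h0
  · have haux : ∀ c ∈ X, c ≠ b → par c = a → rk c ≠ rk b := by
      intro c hc h0 h1 h2
      have := h.par_lt c hc (by rw [h1]; exact ha0)
      rw [h1] at this
      omega
    intro c hc c' hc' h0 h1 h2
    by_cases hcb : c = b <;> by_cases hcb' : c' = b
    · rw [hcb, hcb']
    · rw [hcb, Function.update_self, hold c' hcb'] at h1
      have h3 := (hpar c' (by rw [← h1]; exact ha0)).2
      rw [hcb, Function.update_of_ne hab.symm, Function.update_of_ne h3] at h2
      exact absurd h2.symm (haux c' hc' hcb' h1.symm)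
    · rw [hcb', Function.update_self, hold c hcb] at h1
      have h3 := (hpar c (by rw [h1]; exact ha0)).2
      rw [hcb', Function.update_of_ne hab.symm, Function.update_of_ne h3] at h2
      exact absurd h2 (haux c hc hcb h1)
    · rw [hold c hcb] at h0
      rw [hold c hcb, hold c' hcb'] at h1
      rw [Function.update_of_ne (hpar c h0).2, Function.update_of_ne (hpar c' (h1 ▸ h0)).2] at h2
      exact h.uniq c hc c' hc' h0 h1 h2
  · intro v hv h0
    by_cases hva : v = a
    · subst hva
      rw [Function.update_self, Function.update_self, Function.update_self,
        Function.update_of_ne hab.symm]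
      exact ⟨hb, rfl, by omega⟩
    · rw [Function.update_of_ne hva] at h0
      obtain ⟨h1, h2, h3⟩ := h.child v hv h0
      have h4 := hpar (ch v) (by rw [h2]; exact h.pos v hv)
      rw [Function.update_of_ne hva, Function.update_of_ne hva, Function.update_of_ne h4.1,
        Function.update_of_ne h4.2]
      exact ⟨h1, h2, h3⟩
  · intro c hc h0 h1
    by_cases hcb : c = b
    · subst hcb
      rw [Function.update_self, Function.update_self, Function.update_self,
        Function.update_of_ne hab.symm] at h1
      obtain ⟨h2, h3, h4⟩ := h.child a ha (by omega)
      have h5 := hpar (ch a) (by rw [h3]; exact ha0)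
      rw [Function.update_self, Function.update_self, Function.update_of_ne h5.1,
        Function.update_of_ne h5.2, Function.update_of_ne hab.symm]
      exact ⟨h2, h3, by omega⟩
    · rw [hold c hcb] at h0 h1 ⊢
      rw [Function.update_of_ne (hpar c h0).2] at h1
      have h2 : rk (par c) < rk c + dg (par c) := by
        by_cases h2 : par c = a
        · rw [h2, Function.update_self, Function.update_self] at h1
          rw [h2]
          omega
        · rwa [Function.update_of_ne h2, Function.update_of_ne h2] at h1
      obtain ⟨h3, h4, h5⟩ := h.next c hc h0 h2
      have h6 := hpar (nx c) (by rw [h4]; exact h0)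
      rw [Function.update_of_ne hcb, Function.update_of_ne h6.1, Function.update_of_ne h6.2,
        Function.update_of_ne (hpar c h0).2]
      exact ⟨h3, h4, h5⟩

/-- Linking the root `u` with the root `w` of the same rank from the table. -/
theorem HeapInv.link (h : HeapInv n X par u k cnt nd it rk dg ch nx st tb key) (hu : u ≠ 0)
    (hf : nd (it u) = u) (hdg : dg u = rk u) (hw : tb (rk u) ≠ 0) {a b : ℕ}
    (hab : a = u ∧ b = tb (rk u) ∨ a = tb (rk u) ∧ b = u) (hkey : key a ≤ key b) :
    HeapInv n X (Function.update par b a) a k cnt nd it (Function.update rk a (rk a + 1))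
      (Function.update dg a (dg a + 1)) (Function.update ch a b) (Function.update nx b (ch a)) st
      (Function.update tb (rk u) 0) key ∧ a ≠ 0 ∧ nd (it a) = a ∧ dg a = rk a ∧ rk a = rk u := by
  obtain ⟨ht, hr, hv⟩ := h
  obtain ⟨hu1, hu2⟩ := hr.ext_mem hu
  obtain ⟨w1, w2, w3, w4, w5⟩ := hr.tb_mem _ hw
  have hwdg := hv.full _ w1 w4 w5
  have hfacts : a ∈ X ∧ b ∈ X ∧ par a = 0 ∧ par b = 0 ∧ a ≠ b ∧ rk a = rk u ∧ rk b = rk u ∧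
      nd (it a) = a ∧ dg a = rk a := by
    rcases hab with ⟨rfl, rfl⟩ | ⟨rfl, rfl⟩
    · exact ⟨hu1, w1, hu2, w2, w4.symm, rfl, w3, hf, hdg⟩
    · exact ⟨w1, hu1, w2, hu2, w4, w3, rfl, w5, hwdg⟩
  obtain ⟨ha, hb, hpa, hpb, hne, hra, hrb, hfa, hda⟩ := hfacts
  have hrest : ∀ c, c ≠ u → c ≠ tb (rk u) → c ≠ a ∧ c ≠ b := by
    intro c h1 h2
    rcases hab with ⟨rfl, rfl⟩ | ⟨rfl, rfl⟩
    · exact ⟨h1, h2⟩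
    · exact ⟨h2, h1⟩
  refine ⟨⟨ht.link ha hb hpa hpb hne (hra.trans hrb.symm) hkey, ?_, ?_⟩, ht.pos a ha, hfa, hda, hra⟩
  · constructor
    · intro c hc h0
      by_cases hca : c = a
      · exact Or.inl hca
      by_cases hcb : c = b
      · rw [hcb, Function.update_self] at h0
        exact absurd h0 (ht.pos a ha)
      rw [Function.update_of_ne hcb] at h0
      have hc1 : c ≠ u ∧ c ≠ tb (rk u) := by
        rcases hab with ⟨rfl, rfl⟩ | ⟨rfl, rfl⟩
        · exact ⟨hca, hcb⟩
        · exact ⟨hcb, hca⟩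
      rcases hr.root c hc h0 with h1 | h1 | h1
      · exact absurd h1 hc1.1
      · exact Or.inr (Or.inl h1)
      · refine Or.inr (Or.inr ?_)
        rw [Function.update_of_ne hca, Function.update_of_ne, h1]
        intro h2
        exact hc1.2 (by rw [← h2, h1])
    · intro i hi
      obtain ⟨h1, h2, h3, h4⟩ := hr.st_mem i hi
      obtain ⟨h5, h6⟩ := hrest (st i) h3 (fun h => by rw [h, w3] at h4; exact h4 rfl)
      rw [Function.update_of_ne h5, Function.update_of_ne h6]
      refine ⟨h1, h2, h5, ?_⟩
      by_cases h7 : rk (st i) = rk u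
      · rw [h7, Function.update_self]
        exact (ht.pos _ h1).symm
      · rwa [Function.update_of_ne h7]
    · exact hr.st_inj
    · intro r h0
      have hru : r ≠ rk u := by rintro rfl; simp at h0
      rw [Function.update_of_ne hru] at h0 ⊢
      obtain ⟨h1, h2, h3, h4, h5⟩ := hr.tb_mem r h0
      obtain ⟨h6, h7⟩ := hrest (tb r) h4 (fun h => by rw [h, w3] at h3; exact hru h3.symm)
      rw [Function.update_of_ne h6, Function.update_of_ne h7]
      exact ⟨h1, h2, h3, h6, h5⟩
    · intro _
      rw [Function.update_of_ne hne]
      exact ⟨ha, hpa⟩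
  · have hv' := hv.setExt hf hdg a
    refine ⟨hv'.cnt_pos, hv'.lt_cnt, hv'.it_lt, hv'.nd_it, ?_, ?_, ?_⟩
    all_goals
      intro v hvX hvu
      simp only [Function.update_of_ne hvu]
    · exact hv'.full v hvX hvu
    · exact hv'.hollow v hvX hvu
    · exact hv'.two v hvX hvu

theorem HeapInv.toTable (h : HeapInv n X par u k cnt nd it rk dg ch nx st tb key) (hu : u ≠ 0)
    (hf : nd (it u) = u) (hdg : dg u = rk u) (htb : tb (rk u) = 0) :
    HeapInv n X par 0 k cnt nd it rk dg ch nx st (Function.update tb (rk u) u) key := by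
  obtain ⟨ht, hr, hv⟩ := h
  obtain ⟨hu1, hu2⟩ := hr.ext_mem hu
  refine ⟨ht, ?_, hv.setExt hf hdg 0⟩
  constructor
  · intro c hc h0
    rcases hr.root c hc h0 with rfl | h1 | h1
    · exact Or.inr (Or.inr (Function.update_self ..))
    · exact Or.inr (Or.inl h1)
    · refine Or.inr (Or.inr ?_)
      rw [Function.update_of_ne, h1]
      intro h2
      rw [h2, htb] at h1
      exact ht.pos c hc h1.symm
  · intro i hi
    obtain ⟨h1, h2, h3, h4⟩ := hr.st_mem i hi
    refine ⟨h1, h2, ht.pos _ h1, ?_⟩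
    by_cases h5 : rk (st i) = rk u
    · rw [h5, Function.update_self]; exact h3.symm
    · rwa [Function.update_of_ne h5]
  · exact hr.st_inj
  · intro r h0
    by_cases hru : r = rk u
    · rw [hru, Function.update_self]
      exact ⟨hu1, hu2, rfl, hu, hf⟩
    · rw [Function.update_of_ne hru] at h0 ⊢
      obtain ⟨h1, h2, h3, h4, h5⟩ := hr.tb_mem r h0
      exact ⟨h1, h2, h3, h0, h5⟩
  · exact fun h => absurd rfl h

theorem HeapInv.fromTable (h : HeapInv n X par 0 k cnt nd it rk dg ch nx st tb key) {r : ℕ}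
    (htb : tb r ≠ 0) :
    HeapInv n X par (tb r) k cnt nd it rk dg ch nx st (Function.update tb r 0) key := by
  obtain ⟨ht, hr, hv⟩ := h
  obtain ⟨w1, w2, w3, w4, w5⟩ := hr.tb_mem _ htb
  refine ⟨ht, ?_, ⟨hv.cnt_pos, hv.lt_cnt, hv.it_lt, hv.nd_it, fun v h _ => hv.full v h (ht.pos v h),
    fun v h _ => hv.hollow v h (ht.pos v h), fun v h _ => hv.two v h (ht.pos v h)⟩⟩
  · constructor
    · intro c hc h0
      rcases hr.root c hc h0 with rfl | h1 | h1
      · exact absurd rfl (ht.pos _ hc)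
      · exact Or.inr (Or.inl h1)
      · by_cases h2 : rk c = r
        · exact Or.inl (by rw [← h2, h1])
        · exact Or.inr (Or.inr (by rw [Function.update_of_ne h2, h1]))
    · intro i hi
      obtain ⟨h1, h2, h3, h4⟩ := hr.st_mem i hi
      refine ⟨h1, h2, fun h => h4 (by rw [h, w3]), ?_⟩
      by_cases h5 : rk (st i) = r
      · rw [h5, Function.update_self]; exact h3.symm
      · rwa [Function.update_of_ne h5]
    · exact hr.st_inj
    · intro q h0
      have hqr : q ≠ r := by rintro rfl; simp at h0
      rw [Function.update_of_ne hqr] at h0 ⊢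
      obtain ⟨h1, h2, h3, h4, h5⟩ := hr.tb_mem q h0
      exact ⟨h1, h2, h3, fun h => hqr (by rw [← h3, h, w3]), h5⟩
    · exact fun _ => ⟨w1, w2⟩

theorem HeapInv.tableToStack (h : HeapInv n X par ext k cnt nd it rk dg ch nx st tb key) {r : ℕ}
    (htb : tb r ≠ 0) :
    HeapInv n X par ext (k + 1) cnt nd it rk dg ch nx (Function.update st k (tb r))
      (Function.update tb r 0) key := by
  obtain ⟨ht, hr, hv⟩ := h
  obtain ⟨w1, w2, w3, w4, w5⟩ := hr.tb_mem _ htb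
  refine ⟨ht, ?_, hv⟩
  have hst : ∀ i < k, st i ≠ tb r := fun i hi h => (hr.st_mem i hi).2.2.2 (by rw [h, w3])
  constructor
  · intro c hc h0
    rcases hr.root c hc h0 with h1 | ⟨i, hi, h1⟩ | h1
    · exact Or.inl h1
    · exact Or.inr (Or.inl ⟨i, by omega, by rw [Function.update_of_ne (by omega), h1]⟩)
    · by_cases h2 : rk c = r
      · exact Or.inr (Or.inl ⟨k, by omega, by rw [Function.update_self, ← h2, h1]⟩)
      · exact Or.inr (Or.inr (by rw [Function.update_of_ne h2, h1]))
  · intro i hi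
    by_cases hik : i = k
    · rw [hik, Function.update_self, w3, Function.update_self]
      exact ⟨w1, w2, w4, htb.symm⟩
    · rw [Function.update_of_ne hik]
      obtain ⟨h1, h2, h3, h4⟩ := hr.st_mem i (by omega)
      refine ⟨h1, h2, h3, ?_⟩
      by_cases h5 : rk (st i) = r
      · rw [h5, Function.update_self]; exact (ht.pos _ h1).symm
      · rwa [Function.update_of_ne h5]
  · intro i hi j hj hij
    by_cases hik : i = k <;> by_cases hjk : j = k
    · omega
    · rw [hik, Function.update_self, Function.update_of_ne hjk] at hij
      exact absurd hij.symm (hst j (by omega))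
    · rw [hjk, Function.update_self, Function.update_of_ne hik] at hij
      exact absurd hij (hst i (by omega))
    · rw [Function.update_of_ne hik, Function.update_of_ne hjk] at hij
      exact hr.st_inj i (by omega) j (by omega) hij
  · intro q h0
    have hqr : q ≠ r := by rintro rfl; simp at h0
    rw [Function.update_of_ne hqr] at h0 ⊢
    exact hr.tb_mem q h0
  · exact hr.ext_mem

/-- Ranks strictly increase towards the root, so the ascent along parents ends; a counterexample of
maximal rank would have a parent that is not a counterexample. -/
theorem HeapTree.exists_root (h : HeapTree X par rk dg ch nx key) {z : ℕ} (hz : z ∈ X) :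
    ∃ r ∈ X, par r = 0 ∧ key r ≤ key z := by
  by_contra hcon
  have hne : (X.filter fun z => ¬ ∃ r ∈ X, par r = 0 ∧ key r ≤ key z).Nonempty :=
    ⟨z, Finset.mem_filter.2 ⟨hz, hcon⟩⟩
  obtain ⟨m, hm, hmax⟩ := Finset.exists_max_image _ rk hne
  rw [Finset.mem_filter] at hm
  obtain ⟨hmX, hm⟩ := hm
  have hp : par m ≠ 0 := fun h0 => hm ⟨m, hmX, h0, le_rfl⟩
  have hlt := h.par_lt m hmX hp
  by_cases hg : ∃ r ∈ X, par r = 0 ∧ key r ≤ key (par m)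
  · obtain ⟨r, h1, h2, h3⟩ := hg
    exact hm ⟨r, h1, h2, h3.trans (h.par_key m hmX hp)⟩
  · have := hmax (par m) (Finset.mem_filter.2 ⟨h.par_mem m hmX hp, hg⟩)
    omega

/-- A node of rank r ≥ 2 has children of the ranks r - 1 and r - 2, and each of their disjoint trees
has at least 2^⌊(r - 2)/2⌋ nodes. A tree enters the induction as a set of nodes of rank at most r
that is closed under taking parents, except at its top. -/
theorem HeapTree.two_pow_le_card (h : HeapTree X par rk dg ch nx key)
    (htwo : ∀ u ∈ X, rk u ≤ dg u ∨ 2 ≤ dg u) (hu : u ∈ X) : 2 ^ (rk u / 2) ≤ X.card := by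
  suffices hs : ∀ r, ∀ u ∈ X, rk u = r → ∃ T ⊆ X, u ∈ T ∧ 2 ^ (r / 2) ≤ T.card ∧
      ∀ z ∈ T, rk z ≤ r ∧ (z ≠ u → par z ∈ T) by
    obtain ⟨T, h1, -, h2, -⟩ := hs _ u hu rfl
    exact h2.trans (Finset.card_le_card h1)
  intro r
  induction r using Nat.strong_induction_on with
  | _ r ih =>
    intro u hu hr
    by_cases hr2 : r < 2
    · refine ⟨{u}, by simpa using hu, by simp, ?_, by simp [hr]⟩
      rw [Nat.div_eq_of_lt hr2]
      simp
    · have hdg : 2 ≤ dg u := by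
        rcases htwo u hu with h1 | h1 <;> omega
      have hu0 := h.pos u hu
      obtain ⟨c1, c2, c3⟩ := h.child u hu (by omega)
      obtain ⟨d1, d2, d3⟩ := h.next (ch u) c1 (by rw [c2]; exact hu0) (by rw [c2]; omega)
      rw [c2] at d2
      set c := ch u
      set d := nx c
      obtain ⟨T, t1, t2, t3, t4⟩ := ih (rk c) (by omega) c c1 rfl
      obtain ⟨U, u1, u2, u3, u4⟩ := ih (rk d) (by omega) d d1 rfl
      -- A common node of maximal rank is one of the tops, for otherwise its parent would be a
      -- common node of larger rank. If it is the top of one set, then the other set would contain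
      -- the parent `u`, whose rank is too large.
      have hdisj : Disjoint T U := by
        rw [Finset.disjoint_iff_inter_eq_empty]
        by_contra hne
        obtain ⟨m, hm, hmax⟩ := Finset.exists_max_image _ rk (Finset.nonempty_iff_ne_empty.2 hne)
        rw [Finset.mem_inter] at hm
        by_cases hmc : m = c
        · have h1 := (u4 m hm.2).2 (by rintro rfl; rw [hmc] at d3; omega)
          rw [hmc, c2] at h1
          have := (u4 u h1).1
          omega
        by_cases hmd : m = d
        · have h1 := (t4 m hm.1).2 hmc
          rw [hmd, d2] at h1
          have := (t4 u h1).1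
          omega
        have h1 := (t4 m hm.1).2 hmc
        have h2 := (u4 m hm.2).2 hmd
        have h3 := hmax _ (Finset.mem_inter.2 ⟨h1, h2⟩)
        have h4 := h.par_lt m (t1 hm.1) (h.pos _ (t1 h1))
        omega
      refine ⟨insert u (T ∪ U), ?_, by simp, ?_, ?_⟩
      · intro z hz
        simp only [Finset.mem_insert, Finset.mem_union] at hz
        rcases hz with rfl | hz | hz
        · exact hu
        · exact t1 hz
        · exact u1 hz
      · refine le_trans ?_ (Finset.card_le_card (Finset.subset_insert _ _))
        rw [Finset.card_union_of_disjoint hdisj]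
        have e1 : 2 ^ (rk d / 2) ≤ 2 ^ (rk c / 2) := Nat.pow_le_pow_right (by simp) (by omega)
        have e2 : r / 2 = rk d / 2 + 1 := by omega
        rw [e2, pow_succ]
        omega
      · intro z hz
        simp only [Finset.mem_insert, Finset.mem_union] at hz ⊢
        rcases hz with rfl | hz | hz
        · exact ⟨hr.le, fun h => absurd rfl h⟩
        · refine ⟨by have := (t4 z hz).1; omega, fun _ => ?_⟩
          by_cases hzc : z = c
          · left; rw [hzc, c2]
          · right; left; exact (t4 z hz).2 hzc
        · refine ⟨by have := (u4 z hz).1; omega, fun _ => ?_⟩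
          by_cases hzd : z = d
          · left; rw [hzd, d2]
          · right; right; exact (u4 z hz).2 hzd

/-- The pointers `ch` and `nx` of the new node need no initial values, since it has neither children
nor a parent. -/
theorem HeapTree.addLeaf (h : HeapTree X par rk dg ch nx key) {c : ℕ} (hc : c ∉ X) (hc0 : c ≠ 0)
    (x : ℝ≥0) :
    HeapTree (insert c X) (Function.update par c 0) (Function.update rk c 0)
      (Function.update dg c 0) ch nx (Function.update key c x) := by
  have hne : ∀ v ∈ X, v ≠ c := fun v hv hvc => hc (hvc ▸ hv)
  have hold : ∀ v ∈ insert c X, Function.update par c 0 v ≠ 0 →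
      v ∈ X ∧ v ≠ c ∧ par v ≠ 0 ∧ par v ∈ X ∧ par v ≠ c := by
    intro v hv h0
    have h1 : v ≠ c := by rintro rfl; simp at h0
    rw [Function.update_of_ne h1] at h0
    have h2 := Finset.mem_of_mem_insert_of_ne hv h1
    exact ⟨h2, h1, h0, h.par_mem v h2 h0, hne _ (h.par_mem v h2 h0)⟩
  constructor
  · intro v hv
    rcases Finset.mem_insert.1 hv with rfl | hv
    · exact hc0
    · exact h.pos v hv
  · intro v hv h0
    obtain ⟨h1, h2, h3, h4, h5⟩ := hold v hv h0
    rw [Function.update_of_ne h2]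
    exact Finset.mem_insert_of_mem h4
  · intro v hv h0
    obtain ⟨h1, h2, h3, h4, h5⟩ := hold v hv h0
    rw [Function.update_of_ne h2, Function.update_of_ne h2, Function.update_of_ne h5]
    exact h.par_lt v h1 h3
  · intro v hv h0
    obtain ⟨h1, h2, h3, h4, h5⟩ := hold v hv h0
    rw [Function.update_of_ne h2, Function.update_of_ne h2, Function.update_of_ne h5,
      Function.update_of_ne h5]
    exact h.par_le v h1 h3
  · intro v hv h0
    obtain ⟨h1, h2, h3, h4, h5⟩ := hold v hv h0
    rw [Function.update_of_ne h2, Function.update_of_ne h2, Function.update_of_ne h5]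
    exact h.par_key v h1 h3
  · intro v hv v' hv' h0 ha hb
    obtain ⟨h1, h2, h3, h4, h5⟩ := hold v hv h0
    obtain ⟨i1, i2, i3, i4, i5⟩ := hold v' hv' (ha ▸ h0)
    rw [Function.update_of_ne h2, Function.update_of_ne i2] at ha hb
    exact h.uniq v h1 v' i1 h3 ha hb
  · intro v hv h0
    have h1 : v ≠ c := by rintro rfl; simp at h0
    rw [Function.update_of_ne h1] at h0
    obtain ⟨h2, h3, h4⟩ := h.child v (Finset.mem_of_mem_insert_of_ne hv h1) h0
    have h5 := hne _ h2
    rw [Function.update_of_ne h1, Function.update_of_ne h5, Function.update_of_ne h5]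
    exact ⟨Finset.mem_insert_of_mem h2, h3, h4⟩
  · intro v hv h0 h6
    obtain ⟨h1, h2, h3, h4, h5⟩ := hold v hv h0
    rw [Function.update_of_ne h2, Function.update_of_ne h2, Function.update_of_ne h5,
      Function.update_of_ne h5] at h6
    obtain ⟨i1, i2, i3⟩ := h.next v h1 h3 h6
    have i4 := hne _ i1
    rw [Function.update_of_ne h2, Function.update_of_ne i4, Function.update_of_ne i4,
      Function.update_of_ne h2]
    exact ⟨Finset.mem_insert_of_mem i1, i2, i3⟩

/-- The new parents when the children of `u`, except for the two of largest rank, are moved to the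
node `c`. -/
def splitPar (par rk : ℕ → ℕ) (u c z : ℕ) : ℕ :=
  if par z = u ∧ rk z + 2 < rk u then c else par z

/-- The moved children have the ranks from `rk u - 3` down to `rk u - dg u`, which is the pattern of
a node of rank `rk u - 2` with `dg u - 2` children; heap order holds because the new key is at most
the old one. The sibling list is cut in two without writing to `nx`: the second child of `u` is now
the last one, so its pointer is no longer used. -/
theorem HeapTree.split (h : HeapTree X par rk dg ch nx key) {c : ℕ} (hu : u ∈ X) (hc : c ∈ X)
    (huc : u ≠ c) (hpc : par c = 0) (hdc : dg c = 0) (h2 : 2 ≤ dg u) (hkey : key c ≤ key u) :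
    HeapTree X (splitPar par rk u c) (Function.update rk c (rk u - 2))
      (Function.update (Function.update dg u 2) c (dg u - 2))
      (Function.update ch c (nx (nx (ch u)))) nx key := by
  have hu0 := h.pos u hu
  have hc0 := h.pos c hc
  have hpos := h.pos
  obtain ⟨a1, a2, a3⟩ := h.child u hu (by omega)
  have ale := h.par_le _ a1 (by rw [a2]; exact hu0)
  obtain ⟨b1, b2, b3⟩ := h.next (ch u) a1 (by rw [a2]; exact hu0) (by rw [a2]; omega)
  rw [a2] at b2 ale
  have hleaf : ∀ z ∈ X, par z ≠ c := by
    intro z hz hzc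
    have h3 := h.par_lt z hz (by rw [hzc]; exact hc0)
    have h4 := h.par_le z hz (by rw [hzc]; exact hc0)
    rw [hzc] at h3 h4
    omega
  have key : ∀ z ∈ X, splitPar par rk u c z ≠ 0 → par z ≠ 0 ∧ z ≠ c ∧
      (par z = u ∧ rk z + 2 < rk u ∧ splitPar par rk u c z = c ∨
        par z = u ∧ rk u ≤ rk z + 2 ∧ splitPar par rk u c z = u ∨
        par z ≠ u ∧ par z ≠ c ∧ splitPar par rk u c z = par z) := by
    intro z hz h0
    have hz' := hleaf z hz
    unfold splitPar at h0 ⊢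
    by_cases h3 : par z = u
    · have hzc : z ≠ c := by rintro rfl; omega
      by_cases h4 : rk z + 2 < rk u
      · exact ⟨by omega, hzc, Or.inl ⟨h3, h4, by rw [if_pos ⟨h3, h4⟩]⟩⟩
      · exact ⟨by omega, hzc, Or.inr (Or.inl ⟨h3, by omega, by rw [if_neg (by omega), h3]⟩)⟩
    · rw [if_neg (by tauto)] at h0 ⊢
      exact ⟨h0, by rintro rfl; exact h0 hpc, Or.inr (Or.inr ⟨h3, hz', rfl⟩)⟩
  have hsp : ∀ z, par z ≠ u → splitPar par rk u c z = par z := fun z hz =>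
    if_neg (fun h => hz h.1)
  have hsp1 : ∀ z, rk u ≤ rk z + 2 → splitPar par rk u c z = par z := fun z hz =>
    if_neg (fun h => by omega)
  have hsp2 : ∀ z, par z = u → rk z + 2 < rk u → splitPar par rk u c z = c := fun z hz hz' =>
    if_pos ⟨hz, hz'⟩
  constructor
  · exact h.pos
  · intro z hz h0
    obtain ⟨k1, k2, ⟨k3, k4, k5⟩ | ⟨k3, k4, k5⟩ | ⟨k3, k4, k5⟩⟩ := key z hz h0
    · rwa [k5]
    · rwa [k5]
    · rw [k5]; exact h.par_mem z hz k1
  · intro z hz h0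
    obtain ⟨k1, k2, ⟨k3, k4, k5⟩ | ⟨k3, k4, k5⟩ | ⟨k3, k4, k5⟩⟩ := key z hz h0
    · rw [k5, Function.update_self, Function.update_of_ne k2]
      omega
    · rw [k5, Function.update_of_ne huc, Function.update_of_ne k2, ← k3]
      exact h.par_lt z hz k1
    · rw [k5, Function.update_of_ne k4, Function.update_of_ne k2]
      exact h.par_lt z hz k1
  · intro z hz h0
    have hle := h.par_le z hz
    obtain ⟨k1, k2, ⟨k3, k4, k5⟩ | ⟨k3, k4, k5⟩ | ⟨k3, k4, k5⟩⟩ := key z hz h0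
    · have := hle k1
      rw [k3] at this
      rw [k5, Function.update_self, Function.update_of_ne k2, Function.update_self]
      omega
    · rw [k5, Function.update_of_ne huc, Function.update_of_ne k2, Function.update_of_ne huc,
        Function.update_self]
      exact k4
    · rw [k5, Function.update_of_ne k4, Function.update_of_ne k2, Function.update_of_ne k4,
        Function.update_of_ne k3]
      exact hle k1
  · intro z hz h0
    have hk := h.par_key z hz
    obtain ⟨k1, k2, ⟨k3, k4, k5⟩ | ⟨k3, k4, k5⟩ | ⟨k3, k4, k5⟩⟩ := key z hz h0
    · rw [k5]
      exact hkey.trans (k3 ▸ hk k1)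
    · rw [k5, ← k3]
      exact hk k1
    · rw [k5]
      exact hk k1
  · intro z hz z' hz' h0 h3 h4
    have l := key z' hz' (h3 ▸ h0)
    obtain ⟨k1, k2, k⟩ := key z hz h0
    obtain ⟨l1, l2, l⟩ := l
    rw [Function.update_of_ne k2, Function.update_of_ne l2] at h4
    -- The node `c` had no children before, so children of `c` now are former children of `u`; equal
    -- new parents come from equal old ones.
    have hp : par z = par z' := by
      rcases k with ⟨k3, k4, k5⟩ | ⟨k3, k4, k5⟩ | ⟨k3, k4, k5⟩ <;>
      rcases l with ⟨l3, l4, l5⟩ | ⟨l3, l4, l5⟩ | ⟨l3, l4, l5⟩ <;> omega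
    exact h.uniq z hz z' hz' k1 hp h4
  · intro z hz h0
    by_cases hzc : z = c
    · subst hzc
      rw [Function.update_self] at h0
      obtain ⟨d1, d2, d3⟩ := h.next (nx (ch u)) b1 (by rw [b2]; exact hu0) (by rw [b2]; omega)
      rw [b2] at d2
      have hne : nx (nx (ch u)) ≠ z := fun h => by rw [h] at d2; omega
      rw [Function.update_self, hsp2 _ d2 (by omega), Function.update_of_ne hne,
        Function.update_self]
      exact ⟨d1, rfl, by omega⟩
    · rw [Function.update_of_ne hzc] at h0
      have h0' : dg z ≠ 0 := by
        by_cases hzu : z = u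
        · rw [hzu]; omega
        · rwa [Function.update_of_ne hzu] at h0
      obtain ⟨d1, d2, d3⟩ := h.child z hz h0'
      have hne : ch z ≠ c := fun h => by
        rw [h, hpc] at d2
        exact hpos z hz d2.symm
      rw [Function.update_of_ne hzc, Function.update_of_ne hne, Function.update_of_ne hzc]
      refine ⟨d1, ?_, d3⟩
      by_cases hzu : z = u
      · subst hzu
        rw [hsp1 _ (by omega), d2]
      · rw [hsp _ (by rw [d2]; exact hzu), d2]
  · intro z hz h0 h3
    have hn := h.next z hz
    obtain ⟨k1, k2, k⟩ := key z hz h0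
    rw [Function.update_of_ne k2] at h3 ⊢
    have hcond : rk (par z) < rk z + dg (par z) := by
      rcases k with ⟨k3, k4, k5⟩ | ⟨k3, k4, k5⟩ | ⟨k3, k4, k5⟩
      · rw [k5, Function.update_self, Function.update_self] at h3
        rw [k3]
        omega
      · rw [k5, Function.update_of_ne huc, Function.update_of_ne huc, Function.update_self] at h3
        rw [k3]
        omega
      · rwa [k5, Function.update_of_ne k4, Function.update_of_ne k4, Function.update_of_ne k3] at h3
    obtain ⟨n1, n2, n3⟩ := hn k1 hcond
    have hne : nx z ≠ c := fun h => by rw [h, hpc] at n2; omega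
    rw [Function.update_of_ne hne]
    refine ⟨n1, ?_, n3⟩
    rcases k with ⟨k3, k4, k5⟩ | ⟨k3, k4, k5⟩ | ⟨k3, k4, k5⟩
    · rw [k5, hsp2 _ (n2.trans k3) (by omega)]
    · rw [k5, Function.update_of_ne huc, Function.update_of_ne huc, Function.update_self] at h3
      rw [k5, hsp1 _ (by omega), n2, k3]
    · rw [k5, hsp _ (by rw [n2]; exact k3), n2]

end

/-! ### New nodes: insertion and decrease of a key -/

section

variable {n : ℕ} {X : Finset ℕ} {par : ℕ → ℕ} {ext k cnt u v : ℕ}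
  {nd it rk dg ch nx st tb : ℕ → ℕ} {key : ℕ → ℝ≥0}

/-- Only the old node of `v`, if it is still in the heap, changes its status, from full to hollow;
`hdv` is what this requires. The new ranks and numbers of children are left open so as to cover new
leaves and split nodes alike. -/
theorem HeapVerts.insert (h : HeapVerts n X 0 cnt nd it rk dg) (hpos : ∀ u ∈ X, u ≠ 0) (hv : v < n)
    {rk' dg' : ℕ → ℕ} (hrk : ∀ w ∈ X, rk' w = rk w) (hc : dg' cnt = rk' cnt)
    (hdg : ∀ w ∈ X, w ≠ nd v → dg' w = dg w)
    (hdv : nd v ∈ X → dg' (nd v) ≤ 2 ∧ (rk (nd v) ≤ dg' (nd v) ∨ 2 ≤ dg' (nd v))) :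
    HeapVerts n (insert cnt X) 0 (cnt + 1) (Function.update nd v cnt) (Function.update it cnt v) rk'
      dg' := by
  have hne : ∀ w ∈ X, w ≠ cnt := fun w hw => (h.lt_cnt w hw).ne
  constructor
  · omega
  · intro w hw
    rcases Finset.mem_insert.1 hw with rfl | hw
    · omega
    · have := h.lt_cnt w hw
      omega
  · intro w hw
    rcases Finset.mem_insert.1 hw with rfl | hw
    · rwa [Function.update_self]
    · rw [Function.update_of_ne (hne w hw)]
      exact h.it_lt w hw
  · intro w hw h0
    by_cases hwv : w = v
    · rw [hwv, Function.update_self, Function.update_self]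
      exact ⟨rfl, by omega⟩
    · rw [Function.update_of_ne hwv] at h0 ⊢
      obtain ⟨h1, h2⟩ := h.nd_it w hw h0
      rw [Function.update_of_ne (by omega)]
      exact ⟨h1, by omega⟩
  · intro w hw _ h1
    by_cases hwc : w = cnt
    · rw [hwc, hc]
    · have hwX := Finset.mem_of_mem_insert_of_ne hw hwc
      rw [Function.update_of_ne hwc] at h1
      by_cases h2 : it w = v
      · rw [h2, Function.update_self] at h1
        exact absurd h1.symm hwc
      · rw [Function.update_of_ne h2] at h1
        rw [hrk w hwX, hdg w hwX, h.full w hwX (hpos w hwX) h1]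
        intro h3
        have := (h.nd_it v hv (h3 ▸ hpos w hwX)).1
        rw [← h3] at this
        exact h2 this
  · intro w hw _ h1
    by_cases hwc : w = cnt
    · rw [hwc, Function.update_self, Function.update_self] at h1
      exact absurd rfl h1
    · have hwX := Finset.mem_of_mem_insert_of_ne hw hwc
      by_cases h4 : w = nd v
      · rw [h4] at hwX ⊢
        exact (hdv hwX).1
      rw [hdg w hwX h4]
      refine h.hollow w hwX (hpos w hwX) fun h5 => ?_
      rw [Function.update_of_ne hwc] at h1
      by_cases h2 : it w = v
      · rw [h2] at h5
        exact h4 h5.symm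
      · rw [Function.update_of_ne h2] at h1
        exact h1 h5
  · intro w hw _
    by_cases hwc : w = cnt
    · left; rw [hwc, hc]
    · have hwX := Finset.mem_of_mem_insert_of_ne hw hwc
      by_cases h4 : w = nd v
      · rw [h4] at hwX ⊢
        rw [hrk _ hwX]
        exact (hdv hwX).2
      · rw [hdg w hwX h4, hrk w hwX]
        exact h.two w hwX (hpos w hwX)

theorem HeapRoots.insert (h : HeapRoots X par 0 k nd it rk st tb) (hX : ∀ u ∈ X, u < cnt)
    (htb : ∀ r, tb r = 0) (hcnt : cnt ≠ 0) {par' nd' it' rk' : ℕ → ℕ} (hpc : par' cnt = 0)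
    (hpar : ∀ w ∈ X, par' w = 0 ↔ par w = 0) (hpos : ∀ u ∈ X, u ≠ 0) :
    HeapRoots (insert cnt X) par' 0 (k + 1) nd' it' rk' (Function.update st k cnt) tb := by
  constructor
  · intro c hc h0
    by_cases hcc : c = cnt
    · exact Or.inr (Or.inl ⟨k, by omega, by rw [Function.update_self, hcc]⟩)
    · have hcX := Finset.mem_of_mem_insert_of_ne hc hcc
      rcases h.root c hcX ((hpar c hcX).1 h0) with h1 | ⟨i, hi, h1⟩ | h1
      · exact absurd h1 (hpos c hcX)
      · exact Or.inr (Or.inl ⟨i, by omega, by rw [Function.update_of_ne (by omega), h1]⟩)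
      · rw [htb] at h1
        exact absurd h1.symm (hpos c hcX)
  · intro i hi
    rw [htb]
    by_cases hik : i = k
    · rw [hik, Function.update_self]
      exact ⟨by simp, hpc, hcnt, hcnt.symm⟩
    · rw [Function.update_of_ne hik]
      obtain ⟨h1, h2, h3, h4⟩ := h.st_mem i (by omega)
      exact ⟨Finset.mem_insert_of_mem h1, (hpar _ h1).2 h2, h3, h3.symm⟩
  · intro i hi j hj hij
    have hne : ∀ i < k, st i ≠ cnt := fun i hi => (hX _ (h.st_mem i hi).1).ne
    by_cases hik : i = k <;> by_cases hjk : j = k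
    · omega
    · rw [hik, Function.update_self, Function.update_of_ne hjk] at hij
      exact absurd hij.symm (hne j (by omega))
    · rw [hjk, Function.update_self, Function.update_of_ne hik] at hij
      exact absurd hij (hne i (by omega))
    · rw [Function.update_of_ne hik, Function.update_of_ne hjk] at hij
      exact h.st_inj i (by omega) j (by omega) hij
  · exact fun r hr => absurd (htb r) hr
  · exact fun h => absurd rfl h

/-- A new node without children for the vertex `v`. -/
theorem HeapInv.insert (h : HeapInv n X par 0 k cnt nd it rk dg ch nx st tb key)
    (htb : ∀ r, tb r = 0) (hv : v < n) (hsmall : nd v ∈ X → dg (nd v) ≤ 2) (x : ℝ≥0) :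
    HeapInv n (insert cnt X) (Function.update par cnt 0) 0 (k + 1) (cnt + 1)
      (Function.update nd v cnt) (Function.update it cnt v) (Function.update rk cnt 0)
      (Function.update dg cnt 0) ch nx (Function.update st k cnt) tb
      (Function.update key cnt x) := by
  obtain ⟨ht, hr, hv'⟩ := h
  have hc0 : cnt ≠ 0 := hv'.cnt_pos.ne'
  have hne : ∀ w ∈ X, w ≠ cnt := fun w hw => (hv'.lt_cnt w hw).ne
  refine ⟨ht.addLeaf (fun h => hne cnt h rfl) hc0 x, hr.insert hv'.lt_cnt htb hc0 (by simp) ?_ ht.pos,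
    hv'.insert ht.pos hv ?_ (by simp) ?_ ?_⟩
  · intro w hw
    rw [Function.update_of_ne (hne w hw)]
  · intro w hw
    rw [Function.update_of_ne (hne w hw)]
  · intro w hw _
    rw [Function.update_of_ne (hne w hw)]
  · intro hX
    rw [Function.update_of_ne (hne _ hX)]
    exact ⟨hsmall hX, hv'.two _ hX (ht.pos _ hX)⟩

/-- A new node for the vertex `v`, which takes over the children of the old node `u`, except for the
two of largest rank. -/
theorem HeapInv.insertSplit (h : HeapInv n X par 0 k cnt nd it rk dg ch nx st tb key)
    (htb : ∀ r, tb r = 0) (hv : v < n) (hu : nd v = u) (huX : u ∈ X) (h2 : 2 ≤ dg u) {x : ℝ≥0}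
    (hx : x ≤ key u) :
    HeapInv n (Insert.insert cnt X)
      (splitPar (Function.update par cnt 0) (Function.update rk cnt 0) u cnt) 0 (k + 1) (cnt + 1)
      (Function.update nd v cnt) (Function.update it cnt v) (Function.update rk cnt (rk u - 2))
      (Function.update (Function.update dg u 2) cnt (dg u - 2))
      (Function.update ch cnt (nx (nx (ch u)))) nx (Function.update st k cnt) tb
      (Function.update key cnt x) := by
  obtain ⟨ht, hr, hv'⟩ := h
  have hc0 : cnt ≠ 0 := hv'.cnt_pos.ne'
  have hne : ∀ w ∈ X, w ≠ cnt := fun w hw => (hv'.lt_cnt w hw).ne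
  have huc := hne u huX
  have hu0 := ht.pos u huX
  have hit : it u = v := hu ▸ (hv'.nd_it v hv (by rwa [hu])).1
  -- The old node is full until now, so the new one gets as many children as its rank `rk u - 2`, as
  -- a full node must have.
  have hfull : dg u = rk u := hv'.full u huX hu0 (by rw [hit, hu])
  have hs := (ht.addLeaf (fun h => hne cnt h rfl) hc0 x).split (u := u) (c := cnt)
    (Finset.mem_insert_of_mem huX) (Finset.mem_insert_self ..) huc (by simp) (by simp)
    (by rwa [Function.update_of_ne huc])
    (by rwa [Function.update_self, Function.update_of_ne huc])
  rw [Function.update_of_ne huc, Function.update_of_ne huc, Function.update_idem,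
    Function.update_comm huc.symm, Function.update_idem] at hs
  refine ⟨hs, hr.insert hv'.lt_cnt htb hc0 ?_ ?_ ht.pos, hv'.insert ht.pos hv ?_ ?_ ?_ ?_⟩
  · unfold splitPar
    rw [Function.update_self, if_neg (by omega)]
  · intro w hw
    unfold splitPar
    rw [Function.update_of_ne (hne w hw)]
    by_cases h3 : par w = u ∧ Function.update rk cnt 0 w + 2 < Function.update rk cnt 0 u
    · rw [if_pos h3]
      exact iff_of_false hc0 (by omega)
    · rw [if_neg h3]
  · intro w hw
    rw [Function.update_of_ne (hne w hw)]
  · rw [Function.update_self, Function.update_self, hfull]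
  · intro w hw h3
    rw [Function.update_of_ne (hne w hw), Function.update_of_ne (hu ▸ h3)]
  · intro _
    rw [hu, Function.update_of_ne huc, Function.update_self]
    exact ⟨le_rfl, Or.inr le_rfl⟩

theorem HeapInv.empty (n : ℕ) (par : ℕ → ℕ) (it rk dg ch nx st : ℕ → ℕ) (key : ℕ → ℝ≥0)
    (hnd : ∀ v < n, nd v = 0) (htb : ∀ r, tb r = 0) :
    HeapInv n ∅ par 0 0 1 nd it rk dg ch nx st tb key := by
  refine ⟨?_, ?_, ?_⟩
  · constructor <;> simp
  · constructor <;> simp [htb]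
  · constructor <;> simp
    exact fun v hv h => absurd (hnd v hv) h

end

/-! ## Hollow heaps as priority queues for weighted digraphs -/

/-- Move the children of the root in register `16` to the stack. -/
def heapDetach : Prog :=
  seqs [block [.load 17 11 16], .loop (.lt 2 17) (block [.load 18 12 16, .store 14 13 18, .succ 13,
    .load 19 13 18, .store 12 16 19, .pred 17, .store 11 16 17, .load 20 10 16, .pred 20,
    .store 10 16 20])]

/-- Make the root in register `b` the first child of the root in register `a`. -/
def heapLink (a b : ℕ) : List Instr :=
  [.load 19 12 a, .store 13 b 19, .store 12 a b, .load 19 10 a, .succ 19, .store 10 a 19,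
    .load 19 11 a, .succ 19, .store 11 a 19]

/-- Insert the full root in register `16` into the table, after linking it with the roots of the
same rank that it meets there. Register `21` bounds the ranks in the table. -/
def heapCarry : Prog :=
  seqs [block [.load 17 10 16, .load 18 15 17],
    .loop (.lt 2 18) (seqs [block [.store 15 17 2, .wload 2 2 16, .wload 3 2 18],
      .branch (.wle 2 3) (block (heapLink 16 18)) (block (heapLink 18 16 ++ [.copy 16 18])),
      block [.succ 17, .load 18 15 17]]),
    block [.store 15 17 16], .branch (.lt 21 17) (block [.copy 21 17]) (block [])]

/-- Empty the stack: destroy the hollow roots and insert the full roots into the table. -/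
def heapConsolidate : Prog :=
  seqs [block [.const 21 0], .loop (.lt 2 13)
    (seqs [block [.pred 13, .load 16 14 13, .load 17 9 16, .load 18 8 17],
      .branch (.eq 18 16) heapCarry heapDetach])]

/-- Move the roots from the table to the stack, except for a root of smallest key, which is put into
register `16`. -/
def heapFindMin : Prog :=
  seqs [block [.const 16 0, .const 17 0, .succ 21], .loop (.lt 17 21)
    (seqs [block [.load 18 15 17], .branch (.eq 18 2) (block []) (seqs [block [.store 15 17 2],
      .branch (.eq 16 2) (block [.copy 16 18]) (seqs [block [.wload 2 2 16, .wload 3 2 18],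
        .branch (.wle 2 3) (block [.store 14 13 18, .succ 13])
          (block [.store 14 13 16, .succ 13, .copy 16 18])])]),
      block [.succ 17]])]

/-- Store the new node, whose number is in register `14`, for the vertex in register `9` with the
key in weight register `0`. -/
def heapStore : List Instr :=
  [.store 8 9 14, .store 9 14 9, .store 14 13 14, .wstore 2 14 0, .succ 13, .succ 14]

/-- A hollow heap: array `8` holds the nodes of the vertices (`0` for vertices that have not been
reached), array `9` the vertices of the nodes, the arrays `10`, `11`, `12`, `13` the ranks, numbers
of children, first children and next siblings of the nodes, weight array `2` their keys; array `14`
is the stack of the roots, whose size is in register `13`, array `15` is the table of roots by rank,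
and register `14` holds the number of the next node. -/
def hollowHeap : QueueProgs where
  init := seqs [block [.const 14 0], .loop (.lt 14 0) (block [.store 8 14 2, .succ 14]),
    block [.const 13 0, .const 14 1, .store 8 4 14, .store 9 14 4, .store 10 14 2, .store 11 14 2,
      .store 14 13 14, .wzero 0, .wstore 2 14 0, .succ 13, .succ 14, .wzero 1]]
  extract := seqs [heapConsolidate, heapFindMin, .branch (.eq 16 2) (block [.const 11 0])
    (seqs [block [.load 10 9 16, .wload 1 2 16, .const 11 1], heapDetach])]
  relax := seqs [block [.wload 0 0 5, .wadd 0 1 0, .load 16 8 9],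
    .branch (.eq 16 2) (block ([.store 10 14 2, .store 11 14 2] ++ heapStore))
      (seqs [block [.wload 2 2 16], .branch (.wle 2 0) (block [])
        (seqs [block [.load 17 11 16, .const 18 2], .branch (.lt 17 18)
          (block ([.store 10 14 2, .store 11 14 2] ++ heapStore))
          (block ([.load 19 10 16, .pred 19, .pred 19, .store 10 14 19, .store 11 16 18, .pred 17,
            .pred 17, .store 11 14 17, .load 20 12 16, .load 20 13 20, .load 20 13 20,
            .store 12 14 20] ++ heapStore))])])]
  save := block [.load 8 8 9, .store 4 9 8, .wload 4 2 8, .wstore 1 9 4]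
  compare := seqs [block [.load 8 8 9], .branch (.eq 8 2) (block [])
    (seqs [block [.wload 4 2 8, .wload 5 1 9], .branch (.wle 4 5) (block [.const 8 1])
      (block [.const 8 0])])]

/-- The memory holds a hollow heap. -/
def HeapState (n : ℕ) (X : Finset ℕ) (par : ℕ → ℕ) (ext : ℕ) (s : State) : Prop :=
  HeapInv n X par ext (s.reg 13) (s.reg 14) (s.arr 8) (s.arr 9) (s.arr 10) (s.arr 11) (s.arr 12)
    (s.arr 13) (s.arr 14) (s.arr 15) (s.warr 2)

/-- The memories agree on the nodes of the vertices, on the keys and on the main program. -/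
structure SameNodes (s s' : State) : Prop where
  main : SameMain s s'
  cnt : s'.reg 14 = s.reg 14
  nd : s'.arr 8 = s.arr 8
  it : s'.arr 9 = s.arr 9
  warr : s'.warr = s.warr

theorem SameNodes.trans {s s' s'' : State} (h : SameNodes s s') (h' : SameNodes s' s'') :
    SameNodes s s'' :=
  ⟨h.main.trans h'.main, h'.cnt.trans h.cnt, h'.nd.trans h.nd, h'.it.trans h.it,
    h'.warr.trans h.warr⟩

/-! ### Verification of the heap programs, with their potential -/

section

variable {n : ℕ} {X : Finset ℕ} {par : ℕ → ℕ} {u : ℕ}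

/-- Each child costs 12 steps: ten instructions, the end of the block and the loop test. -/
theorem wp_heapDetach {T K : ℕ} {s : State} (h : HeapState n X par u s) (hu : s.reg 16 = u)
    (hu0 : u ≠ 0) (hz : s.reg 2 = 0) (hT : K + 12 * s.arr 11 u + 3 ≤ T) :
    WP heapDetach (fun T' s' => SameNodes s s' ∧ s'.arr 15 = s.arr 15 ∧ s'.wreg = s.wreg ∧
      s'.reg 10 = s.reg 10 ∧ s'.reg 11 = s.reg 11 ∧ s'.reg 21 = s.reg 21 ∧
      s'.reg 13 = s.reg 13 + s.arr 11 u ∧ (∃ par', HeapState n X par' u s') ∧ s'.arr 11 u = 0 ∧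
      K ≤ T') T s := by
  refine wp_seq (wp_block (by simp; omega) ?_)
  refine wp_loop (fun T' s' => SameNodes s s' ∧ s'.arr 15 = s.arr 15 ∧ s'.wreg = s.wreg ∧
      s'.reg 10 = s.reg 10 ∧ s'.reg 11 = s.reg 11 ∧ s'.reg 21 = s.reg 21 ∧ s'.reg 16 = u ∧
      s'.reg 17 = s'.arr 11 u ∧ s'.reg 13 + s'.arr 11 u = s.reg 13 + s.arr 11 u ∧
      (∃ par', HeapState n X par' u s') ∧ K + 12 * s'.arr 11 u + 1 ≤ T') ?_ ?_
  · generalize hs1 : runs _ s = s1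
    have r1 : ∀ r, r ≠ 17 → s1.reg r = s.reg r := by
      intro r hr
      rw [← hs1]; simp [runs, Instr.run, hr]
    have r17 : s1.reg 17 = s.arr 11 u := by rw [← hs1]; simp [runs, Instr.run, hu]
    have a1 : s1.arr = s.arr := by rw [← hs1]; rfl
    have w1 : s1.warr = s.warr := by rw [← hs1]; rfl
    have v1 : s1.wreg = s.wreg := by rw [← hs1]; rfl
    refine ⟨⟨⟨fun r hr => r1 r (by omega), fun _ _ => by rw [a1], fun _ _ => by rw [w1]⟩,
      r1 14 (by simp), by rw [a1], by rw [a1], w1⟩, by rw [a1], v1, r1 10 (by simp), r1 11 (by simp),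
      r1 21 (by simp), by rw [r1 16 (by simp), hu], by rw [r17, a1], by rw [r1 13 (by simp), a1],
      ⟨par, ?_⟩, by rw [a1]; simp; omega⟩
    unfold HeapState
    rw [r1 13 (by simp), r1 14 (by simp), a1, w1]
    exact h
  · rintro T s1 ⟨hN, h15, hw, h10, h11, h21, h16, h17, h13, ⟨par', hH⟩, hT⟩
    have hz1 : s1.reg 2 = 0 := by rw [hN.main.reg 2 (by simp), hz]
    refine ⟨by omega, fun hb => ?_, fun hb => ?_⟩
    · simp only [Test.Holds, hz1] at hb
      rw [h17] at hb
      have hD := HeapInv.detach hH hu0 hb.ne'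
      refine wp_block (by simp; omega) ?_
      generalize hs2 : runs _ s1 = s2
      have r2 : ∀ r, r ≠ 13 → r ≠ 17 → r ≠ 18 → r ≠ 19 → r ≠ 20 → s2.reg r = s1.reg r := by
        intro r i1 i2 i3 i4 i5
        rw [← hs2]; simp [runs, Instr.run, i1, i2, i3, i4, i5]
      have r13 : s2.reg 13 = s1.reg 13 + 1 := by rw [← hs2]; simp [runs, Instr.run]
      have r17 : s2.reg 17 = s1.arr 11 u - 1 := by rw [← hs2]; simp [runs, Instr.run, h17]
      have a10 : s2.arr 10 = Function.update (s1.arr 10) u (s1.arr 10 u - 1) := by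
        rw [← hs2]; simp [runs, Instr.run, h16]
      have a11 : s2.arr 11 = Function.update (s1.arr 11) u (s1.arr 11 u - 1) := by
        rw [← hs2]; simp [runs, Instr.run, h16, h17]
      have a12 : s2.arr 12 = Function.update (s1.arr 12) u (s1.arr 13 (s1.arr 12 u)) := by
        rw [← hs2]; simp [runs, Instr.run, h16]
      have a14 : s2.arr 14 = Function.update (s1.arr 14) (s1.reg 13) (s1.arr 12 u) := by
        rw [← hs2]; simp [runs, Instr.run, h16]
      have a2 : ∀ a, a ≠ 10 → a ≠ 11 → a ≠ 12 → a ≠ 14 → s2.arr a = s1.arr a := by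
        intro a i1 i2 i3 i4
        rw [← hs2]; simp [runs, Instr.run, i1, i2, i3, i4]
      have w2 : s2.warr = s1.warr := by rw [← hs2]; rfl
      have v2 : s2.wreg = s1.wreg := by rw [← hs2]; rfl
      clear hs2
      refine ⟨hN.trans ⟨⟨fun r hr => r2 r (by omega) (by omega) (by omega) (by omega) (by omega),
        fun a ha => a2 a (by omega) (by omega) (by omega) (by omega), fun _ _ => by rw [w2]⟩,
        r2 14 (by simp) (by simp) (by simp) (by simp) (by simp), a2 8 (by simp) (by simp) (by simp)
        (by simp), a2 9 (by simp) (by simp) (by simp) (by simp), w2⟩, ?_, by rw [v2, hw], ?_, ?_, ?_,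
        ?_, ?_, ?_, ⟨Function.update par' (s1.arr 12 u) 0, ?_⟩, ?_⟩
      · rw [a2 15 (by simp) (by simp) (by simp) (by simp), h15]
      · rw [r2 10 (by simp) (by simp) (by simp) (by simp) (by simp), h10]
      · rw [r2 11 (by simp) (by simp) (by simp) (by simp) (by simp), h11]
      · rw [r2 21 (by simp) (by simp) (by simp) (by simp) (by simp), h21]
      · rw [r2 16 (by simp) (by simp) (by simp) (by simp) (by simp), h16]
      · rw [r17, a11, Function.update_self]
      · rw [r13, a11, Function.update_self]
        omega
      · unfold HeapState
        rw [r13, r2 14 (by simp) (by simp) (by simp) (by simp) (by simp), a10, a11, a12, a14,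
          a2 8 (by simp) (by simp) (by simp) (by simp), a2 9 (by simp) (by simp) (by simp) (by simp),
          a2 13 (by simp) (by simp) (by simp) (by simp),
          a2 15 (by simp) (by simp) (by simp) (by simp), w2]
        exact hD
      · rw [a11, Function.update_self]
        simp
        omega
    · simp only [Test.Holds, hz1] at hb
      have h0 : s1.arr 11 u = 0 := by omega
      exact ⟨hN, h15, hw, h10, h11, h21, by omega, ⟨par', hH⟩, h0, by omega⟩

end

section

variable {n : ℕ} {X : Finset ℕ} {par : ℕ → ℕ} {u : ℕ}

/-- This is the increment of a binary counter whose digits are the occupied cells `I` of the table.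
Every occupied cell holds a credit of 20; a link empties a cell, and its credit pays for the round
of the loop. Of the initial 29 units, 20 become the credit of the cell that is filled at the end. -/
theorem wp_heapCarry {T K R : ℕ} {s : State} {I : Finset ℕ} (h : HeapState n X par u s)
    (hu : s.reg 16 = u) (hu0 : u ≠ 0) (hf : s.arr 8 (s.arr 9 u) = u)
    (hdg : s.arr 11 u = s.arr 10 u) (hz : s.reg 2 = 0) (hI : ∀ r, r ∈ I ↔ s.arr 15 r ≠ 0)
    (hIle : ∀ r ∈ I, r ≤ s.reg 21) (hR : 2 * Nat.log 2 X.card + 1 ≤ R) (h21 : s.reg 21 ≤ R)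
    (hT : K + 20 * I.card + 29 ≤ T) :
    WP heapCarry (fun T' s' => SameNodes s s' ∧ s'.reg 13 = s.reg 13 ∧ ∃ par', ∃ I' : Finset ℕ,
      HeapState n X par' 0 s' ∧ (∀ r, r ∈ I' ↔ s'.arr 15 r ≠ 0) ∧ (∀ r ∈ I', r ≤ s'.reg 21) ∧
        s'.reg 21 ≤ R ∧ K + 20 * I'.card ≤ T') T s := by
  refine wp_seq (wp_block (by simp; omega) ?_)
  refine wp_seq (wp_loop (fun T' s' => SameNodes s s' ∧ s'.reg 13 = s.reg 13 ∧
    s'.reg 21 = s.reg 21 ∧ ∃ par' u', ∃ I' : Finset ℕ, HeapState n X par' u' s' ∧ s'.reg 16 = u' ∧ u' ≠ 0 ∧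
      s'.arr 8 (s'.arr 9 u') = u' ∧ s'.arr 11 u' = s'.arr 10 u' ∧ s'.reg 17 = s'.arr 10 u' ∧
      s'.reg 18 = s'.arr 15 (s'.arr 10 u') ∧ (∀ r, r ∈ I' ↔ s'.arr 15 r ≠ 0) ∧
      (∀ r ∈ I', r ≤ s'.reg 21) ∧ K + 20 * I'.card + 26 ≤ T') ?_ ?_)
  · generalize hs1 : runs _ s = s1
    have r1 : ∀ r, r ≠ 17 → r ≠ 18 → s1.reg r = s.reg r := by
      intro r hr hr'
      rw [← hs1]; simp [runs, Instr.run, hr, hr']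
    have r17 : s1.reg 17 = s.arr 10 u := by rw [← hs1]; simp [runs, Instr.run, hu]
    have r18 : s1.reg 18 = s.arr 15 (s.arr 10 u) := by rw [← hs1]; simp [runs, Instr.run, hu]
    have a1 : s1.arr = s.arr := by rw [← hs1]; rfl
    have w1 : s1.warr = s.warr := by rw [← hs1]; rfl
    refine ⟨⟨⟨fun r hr => r1 r (by omega) (by omega), fun _ _ => by rw [a1], fun _ _ => by rw [w1]⟩,
      r1 14 (by simp) (by simp), by rw [a1], by rw [a1], w1⟩, r1 13 (by simp) (by simp),
      r1 21 (by simp) (by simp), par, u, I, ?_, ?_⟩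
    · unfold HeapState
      rw [r1 13 (by simp) (by simp), r1 14 (by simp) (by simp), a1, w1]
      exact h
    · rw [a1, r17, r18, r1 16 (by simp) (by simp), r1 21 (by simp) (by simp)]
      exact ⟨hu, hu0, hf, hdg, rfl, rfl, hI, hIle, by simp; omega⟩
  · rintro T s1 ⟨hN, h13, h21', par', u', I', hH, h16, hu', hf', hdg', h17, h18, hI', hIle', hT⟩
    have hz1 : s1.reg 2 = 0 := by rw [hN.main.reg 2 (by simp), hz]
    refine ⟨by omega, fun hb => ?_, fun hb => ?_⟩
    · simp only [Test.Holds, hz1] at hb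
      have hw0 : s1.arr 15 (s1.arr 10 u') ≠ 0 := by rw [← h18]; omega
      have hmem : s1.arr 10 u' ∈ I' := (hI' _).2 hw0
      have hcard := Finset.card_erase_add_one hmem
      have key : ∀ (a b : ℕ) (T' : ℕ) (s4 : State), (a = u' ∧ b = s1.arr 15 (s1.arr 10 u') ∨
          a = s1.arr 15 (s1.arr 10 u') ∧ b = u') → s1.warr 2 a ≤ s1.warr 2 b →
          s4.arr = Function.update (Function.update (Function.update (Function.update
            (Function.update s1.arr 15 (Function.update (s1.arr 15) (s1.arr 10 u') 0))
            13 (Function.update (s1.arr 13) b (s1.arr 12 a)))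
            12 (Function.update (s1.arr 12) a b))
            10 (Function.update (s1.arr 10) a (s1.arr 10 a + 1)))
            11 (Function.update (s1.arr 11) a (s1.arr 11 a + 1)) →
          s4.warr = s1.warr → s4.reg 16 = a → s4.reg 17 = s1.reg 17 + 1 →
          s4.reg 18 = s4.arr 15 (s1.reg 17 + 1) →
          (∀ r, r ≠ 16 → r ≠ 17 → r ≠ 18 → r ≠ 19 → s4.reg r = s1.reg r) → T ≤ T' + 20 →
          SameNodes s s4 ∧ s4.reg 13 = s.reg 13 ∧
          s4.reg 21 = s.reg 21 ∧ ∃ par' u', ∃ I' : Finset ℕ, HeapState n X par' u' s4 ∧ s4.reg 16 = u' ∧ u' ≠ 0 ∧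
          s4.arr 8 (s4.arr 9 u') = u' ∧ s4.arr 11 u' = s4.arr 10 u' ∧ s4.reg 17 = s4.arr 10 u' ∧
          s4.reg 18 = s4.arr 15 (s4.arr 10 u') ∧ (∀ r, r ∈ I' ↔ s4.arr 15 r ≠ 0) ∧
          (∀ r ∈ I', r ≤ s4.reg 21) ∧ K + 20 * I'.card + 26 ≤ T' := by
        intro a b T' s4 hab hkey ha hw i16 i17 i18 ir hTT
        obtain ⟨l1, l2, l3, l4, l5⟩ := HeapInv.link hH hu' hf' hdg' hw0 hab hkey
        have b8 : s4.arr 8 = s1.arr 8 := by rw [ha]; simp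
        have b9 : s4.arr 9 = s1.arr 9 := by rw [ha]; simp
        have b10 : s4.arr 10 = Function.update (s1.arr 10) a (s1.arr 10 a + 1) := by rw [ha]; simp
        have b11 : s4.arr 11 = Function.update (s1.arr 11) a (s1.arr 11 a + 1) := by rw [ha]; simp
        have b12 : s4.arr 12 = Function.update (s1.arr 12) a b := by rw [ha]; simp
        have b13 : s4.arr 13 = Function.update (s1.arr 13) b (s1.arr 12 a) := by rw [ha]; simp
        have b14 : s4.arr 14 = s1.arr 14 := by rw [ha]; simp
        have b15 : s4.arr 15 = Function.update (s1.arr 15) (s1.arr 10 u') 0 := by rw [ha]; simp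
        have j13 := ir 13 (by simp) (by simp) (by simp) (by simp)
        have j14 := ir 14 (by simp) (by simp) (by simp) (by simp)
        have j21 := ir 21 (by simp) (by simp) (by simp) (by simp)
        have i17' : s4.reg 17 = s4.arr 10 a := by
          rw [i17, h17, b10, Function.update_self, l5]
        refine ⟨hN.trans ⟨⟨fun r hr => ir r (by omega) (by omega) (by omega) (by omega),
          fun r hr => ?_, fun _ _ => by rw [hw]⟩, j14, b8, b9, hw⟩, j13.trans h13, j21.trans h21',
          Function.update par' b a, a, I'.erase (s1.arr 10 u'), ?_, i16, l2, ?_, ?_, i17', ?_, ?_, ?_, ?_⟩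
        · rw [ha]
          simp [show r ≠ 10 by omega, show r ≠ 11 by omega, show r ≠ 12 by omega,
            show r ≠ 13 by omega, show r ≠ 15 by omega]
        · unfold HeapState
          rw [j13, j14, b8, b9, b10, b11, b12, b13, b14, b15, hw]
          exact l1
        · rw [b8, b9, l3]
        · rw [b10, b11, Function.update_self, Function.update_self, l4]
        · rw [i18, ← i17', i17]
        · intro r
          rw [Finset.mem_erase, hI', b15]
          by_cases hr : r = s1.arr 10 u'
          · simp [hr]
          · simp [hr]
        · intro r hr
          rw [j21]
          exact hIle' r (Finset.mem_of_mem_erase hr)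
        · omega
      refine wp_seq (wp_block (by simp; omega) ?_)
      refine wp_seq (wp_branch (by simp; omega) (fun hb => ?_) (fun hb => ?_))
      · simp [Test.Holds, runs, Instr.run, h16, h18] at hb
        refine wp_block (by simp [heapLink]; omega) (wp_block (by simp [heapLink]; omega) ?_)
        refine key u' (s1.arr 15 (s1.arr 10 u')) _ _ (Or.inl ⟨rfl, rfl⟩) hb ?_ ?_ ?_ ?_ ?_ ?_ ?_
        · simp [runs, Instr.run, heapLink, h16, h17, h18, hz1]
        · simp [runs, Instr.run, heapLink]
        · simp [runs, Instr.run, heapLink, h16]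
        · simp [runs, Instr.run, heapLink, h17]
        · simp [runs, Instr.run, heapLink, h17]
        · intro r i1 i2 i3 i4
          simp [runs, Instr.run, heapLink, i2, i3, i4]
        · simp [heapLink]
          omega
      · simp [Test.Holds, runs, Instr.run, h16, h18] at hb
        refine wp_block (by simp [heapLink]; omega) (wp_block (by simp [heapLink]; omega) ?_)
        refine key (s1.arr 15 (s1.arr 10 u')) u' _ _ (Or.inr ⟨rfl, rfl⟩) hb.le ?_ ?_ ?_ ?_ ?_ ?_ ?_
        · simp [runs, Instr.run, heapLink, h16, h17, h18, hz1]
        · simp [runs, Instr.run, heapLink]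
        · simp [runs, Instr.run, heapLink, h18]
        · simp [runs, Instr.run, heapLink, h17]
        · simp [runs, Instr.run, heapLink, h17]
        · intro r i1 i2 i3 i4
          simp [runs, Instr.run, heapLink, i1, i2, i3, i4]
        · simp [heapLink]
          omega
    · simp only [Test.Holds, hz1] at hb
      have h0 : s1.arr 15 (s1.arr 10 u') = 0 := by omega
      have hH2 := HeapInv.toTable hH hu' hf' hdg' h0
      -- Once the root is in the table, no node is exempt from the conditions on numbers of
      -- children, and the exponential lower bound on tree sizes applies to it.
      have hrank : s1.arr 10 u' ≤ R := by
        have h2 : 2 ^ (s1.arr 10 u' / 2) ≤ X.card := hH2.tree.two_pow_le_card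
          (fun v hv => hH2.verts.two v hv (hH2.tree.pos v hv)) (hH.roots.ext_mem hu').1
        have h3 := Nat.le_log_of_pow_le (by norm_num) h2
        omega
      refine wp_seq (wp_block (by simp; omega) ?_)
      have key : ∀ (T' : ℕ) (s3 : State),
          s3.arr = Function.update s1.arr 15 (Function.update (s1.arr 15) (s1.arr 10 u') u') →
          s3.warr = s1.warr → (∀ r, r ≠ 21 → s3.reg r = s1.reg r) →
          s3.reg 21 = max (s1.reg 21) (s1.arr 10 u') → T ≤ T' + 6 →
          SameNodes s s3 ∧ s3.reg 13 = s.reg 13 ∧ ∃ par', ∃ I' : Finset ℕ,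
            HeapState n X par' 0 s3 ∧ (∀ r, r ∈ I' ↔ s3.arr 15 r ≠ 0) ∧ (∀ r ∈ I', r ≤ s3.reg 21) ∧
            s3.reg 21 ≤ R ∧ K + 20 * I'.card ≤ T' := by
        intro T' s3 ha hw ir i21 hTT
        have b15 : s3.arr 15 = Function.update (s1.arr 15) (s1.arr 10 u') u' := by rw [ha]; simp
        have ba : ∀ a, a ≠ 15 → s3.arr a = s1.arr a := by
          intro a h15
          rw [ha, Function.update_of_ne h15]
        have hc := Finset.card_insert_le (s1.arr 10 u') I'
        refine ⟨hN.trans ⟨⟨fun r hr => ir r (by omega), fun r hr => ba r (by omega),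
          fun _ _ => by rw [hw]⟩, ir 14 (by simp), ba 8 (by simp), ba 9 (by simp), hw⟩,
          (ir 13 (by simp)).trans h13, par', insert (s1.arr 10 u') I', ?_, ?_, ?_, ?_, by omega⟩
        · unfold HeapState
          rw [ir 13 (by simp), ir 14 (by simp), b15, ba 8 (by simp), ba 9 (by simp),
            ba 10 (by simp), ba 11 (by simp), ba 12 (by simp), ba 13 (by simp), ba 14 (by simp), hw]
          exact hH2
        · intro r
          rw [Finset.mem_insert, hI', b15]
          by_cases hr : r = s1.arr 10 u'
          · simp [hr, hu']
          · simp [hr]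
        · intro r hr
          rw [i21]
          rcases Finset.mem_insert.1 hr with rfl | hr
          · exact le_max_right _ _
          · exact (hIle' r hr).trans (le_max_left _ _)
        · rw [i21, h21']
          exact max_le h21 hrank
      refine wp_branch (by simp; omega) (fun hb => ?_) (fun hb => ?_)
      · simp [Test.Holds, runs, Instr.run, h17] at hb
        refine wp_block (by simp; omega) (key _ _ ?_ ?_ ?_ ?_ ?_)
        · simp [runs, Instr.run, h17, h16]
        · simp [runs, Instr.run]
        · intro r hr
          simp [runs, Instr.run, hr]
        · simp [runs, Instr.run, h17, hb.le]
        · simp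
          omega
      · simp [Test.Holds, runs, Instr.run, h17] at hb
        refine wp_block (by simp; omega) (key _ _ ?_ ?_ ?_ ?_ ?_)
        · simp [runs, Instr.run, h17, h16]
        · simp [runs, Instr.run]
        · intro r hr
          simp [runs, Instr.run]
        · simp [runs, Instr.run, hb]
        · simp
          omega

end

section

variable {n : ℕ} {X : Finset ℕ} {par : ℕ → ℕ} {u : ℕ}

theorem HeapState.congr {s s' : State} (h : HeapState n X par u s) (h13 : s'.reg 13 = s.reg 13)
    (h14 : s'.reg 14 = s.reg 14) (ha : ∀ a, 8 ≤ a → s'.arr a = s.arr a)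
    (hw : s'.warr 2 = s.warr 2) : HeapState n X par u s' := by
  unfold HeapState
  rw [h13, h14, ha 8 (by simp), ha 9 (by simp), ha 10 (by simp), ha 11 (by simp), ha 12 (by simp),
    ha 13 (by simp), ha 14 (by simp), ha 15 (by simp), hw]
  exact h

/-- A root on the stack holds 36 units, a node 70, and an occupied cell of the table 20. A popped
full root pays with its 36 units for the call of `heapCarry`. A destroyed hollow root releases 36 +
70 units: at most 72 go to the two children it can have, which are pushed, and 34 cover the steps.
Full nodes are never destroyed here. -/
theorem wp_heapConsolidate {T K R : ℕ} {s : State} (h : HeapState n X par 0 s) (hz : s.reg 2 = 0)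
    (htb : ∀ r, s.arr 15 r = 0) (hR : 2 * Nat.log 2 X.card + 1 ≤ R)
    (hT : K + 36 * s.reg 13 + 70 * X.card + 3 ≤ T) :
    WP heapConsolidate (fun T' s' => SameNodes s s' ∧ s'.reg 13 = 0 ∧ ∃ X' ⊆ X, ∃ par',
      HeapState n X' par' 0 s' ∧ (∀ v ∈ X, s.arr 8 (s.arr 9 v) = v → v ∈ X') ∧
        (∀ r, s'.arr 15 r ≠ 0 → r ≤ s'.reg 21) ∧ s'.reg 21 ≤ R ∧ K + 70 * X'.card ≤ T') T s := by
  refine wp_seq (wp_block (by simp; omega) ?_)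
  refine wp_loop (fun T' s' => SameNodes s s' ∧ ∃ X' ⊆ X, ∃ par', ∃ I : Finset ℕ,
      HeapState n X' par' 0 s' ∧ (∀ v ∈ X, s.arr 8 (s.arr 9 v) = v → v ∈ X') ∧
        (∀ r, r ∈ I ↔ s'.arr 15 r ≠ 0) ∧ (∀ r ∈ I, r ≤ s'.reg 21) ∧ s'.reg 21 ≤ R ∧
        K + 36 * s'.reg 13 + 70 * X'.card + 20 * I.card + 1 ≤ T') ?_ ?_
  · generalize hs1 : runs _ s = s1
    have r1 : ∀ r, r ≠ 21 → s1.reg r = s.reg r := by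
      intro r hr
      rw [← hs1]; simp [runs, Instr.run, hr]
    have r21 : s1.reg 21 = 0 := by rw [← hs1]; simp [runs, Instr.run]
    have a1 : s1.arr = s.arr := by rw [← hs1]; rfl
    have w1 : s1.warr = s.warr := by rw [← hs1]; rfl
    refine ⟨⟨⟨fun r hr => r1 r (by omega), fun _ _ => by rw [a1], fun _ _ => by rw [w1]⟩,
      r1 14 (by simp), by rw [a1], by rw [a1], w1⟩, X, Finset.Subset.refl X, par, ∅,
      h.congr (r1 13 (by simp)) (r1 14 (by simp)) (fun _ _ => by rw [a1]) (by rw [w1]),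
      fun _ hv _ => hv, ?_, by simp, by omega, ?_⟩
    · intro r
      rw [a1]
      simp [htb]
    · rw [r1 13 (by simp)]
      simp
      omega
  · rintro T s1 ⟨hN, X', hX', par', I, hH, hfull, hI, hIle, h21, hT⟩
    have hz1 : s1.reg 2 = 0 := by rw [hN.main.reg 2 (by simp), hz]
    refine ⟨by omega, fun hb => ?_, fun hb => ?_⟩
    · simp only [Test.Holds, hz1] at hb
      obtain ⟨d, hd⟩ : ∃ d, s1.reg 13 = d + 1 := ⟨_, (Nat.succ_pred hb.ne').symm⟩
      rw [hd, mul_add, mul_one] at hT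
      have hH1 : HeapInv n X' par' 0 (d + 1) (s1.reg 14) (s1.arr 8) (s1.arr 9) (s1.arr 10)
        (s1.arr 11) (s1.arr 12) (s1.arr 13) (s1.arr 14) (s1.arr 15) (s1.warr 2) := hd ▸ hH
      obtain ⟨huX, -, hu0, -⟩ := hH1.roots.st_mem d (by omega)
      have hf := hH1.verts.full _ huX hu0
      have hh := hH1.verts.hollow _ huX hu0
      have hP := hH1.pop
      set u := s1.arr 14 d with hu
      refine wp_seq (wp_block (by simp; omega) ?_)
      generalize hs2 : runs _ s1 = s2
      have r2 : ∀ r, r ≠ 13 → r ≠ 16 → r ≠ 17 → r ≠ 18 → s2.reg r = s1.reg r := by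
        intro r i1 i2 i3 i4
        rw [← hs2]; simp [runs, Instr.run, i1, i2, i3, i4]
      have i13 : s2.reg 13 = d := by rw [← hs2]; simp [runs, Instr.run, hd]
      have i16 : s2.reg 16 = u := by rw [← hs2]; simp [runs, Instr.run, hd, hu]
      have i18 : s2.reg 18 = s1.arr 8 (s1.arr 9 u) := by
        rw [← hs2]; simp [runs, Instr.run, hd, hu]
      have a2 : s2.arr = s1.arr := by rw [← hs2]; rfl
      have w2 : s2.warr = s1.warr := by rw [← hs2]; rfl
      clear hs2
      have hN2 : SameNodes s s2 := hN.trans ⟨⟨fun r hr => r2 r (by omega) (by omega) (by omega)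
        (by omega), fun _ _ => by rw [a2], fun _ _ => by rw [w2]⟩,
        r2 14 (by simp) (by simp) (by simp) (by simp), by rw [a2], by rw [a2], w2⟩
      have hH2 : HeapState n X' par' u s2 := by
        unfold HeapState
        rw [i13, r2 14 (by simp) (by simp) (by simp) (by simp), a2, w2]
        exact hP
      have hz2 : s2.reg 2 = 0 := by rw [hN2.main.reg 2 (by simp), hz]
      have h212 : s2.reg 21 = s1.reg 21 := r2 21 (by simp) (by simp) (by simp) (by simp)
      have hcard := Finset.card_le_card hX'
      have hlog := Nat.log_mono_right (b := 2) hcard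
      refine wp_branch (by simp; omega) (fun hb => ?_) (fun hb => ?_)
      · simp only [Test.Holds, i18, i16] at hb
        refine (wp_heapCarry (K := K + 36 * d + 70 * X'.card + 1) (I := I) (R := R) hH2 i16 hu0
          (by rw [a2]; exact hb) (by rw [a2]; exact hf hb) hz2 (by rw [a2]; exact hI)
          (by rw [h212]; exact hIle) (by omega) (by omega) (by simp; omega)).mono ?_
        rintro T3 s3 ⟨hN3, h13, par3, I3, hH3, hI3, hle3, h213, hT3⟩
        exact ⟨hN2.trans hN3, X', hX', par3, I3, hH3, hfull, hI3, hle3, h213, by omega⟩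
      · simp only [Test.Holds, i18, i16] at hb
        have hdg := hh hb
        refine (wp_heapDetach (K := K + 36 * d + 70 * X'.card + 20 * I.card + 3) hH2 i16 hu0 hz2
          (by rw [a2]; simp; omega)).mono ?_
        rintro T3 s3 ⟨hN3, h15, -, -, -, h213, h13, ⟨par3, hH3⟩, hdg3, hT3⟩
        rw [a2] at h13
        have hcard := Finset.card_erase_add_one huX
        refine ⟨hN2.trans hN3, X'.erase u, (Finset.erase_subset _ _).trans hX', par3, I,
          HeapInv.destroy hH3 hu0 hdg3, ?_, ?_, ?_, by omega, by omega⟩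
        · intro v hv hv'
          refine Finset.mem_erase.2 ⟨?_, hfull v hv hv'⟩
          rintro rfl
          rw [hN.nd, hN.it] at hb
          exact hb hv'
        · rw [h15, a2]
          exact hI
        · rw [h213, h212]
          exact hIle
    · simp only [Test.Holds, hz1] at hb
      exact ⟨hN, by omega, X', hX', par', hH, hfull, fun r hr => hIle r ((hI r).2 hr), h21, by omega⟩

end

section

variable {n : ℕ} {X : Finset ℕ} {par : ℕ → ℕ} {u : ℕ}

/-- The invariant of `heapFindMin`: `e` is the best root that has been found. -/
structure FindMinInv (n : ℕ) (X : Finset ℕ) (par : ℕ → ℕ) (e : ℕ) (s : State) : Prop where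
  state : HeapState n X par e s
  best : s.reg 16 = e
  table_zero : ∀ r < s.reg 17, s.arr 15 r = 0
  table_lt : ∀ r, s.arr 15 r ≠ 0 → r < s.reg 21
  full : e ≠ 0 → s.arr 8 (s.arr 9 e) = e
  deg : e ≠ 0 → s.arr 11 e = s.arr 10 e
  key_le : e ≠ 0 → ∀ i < s.reg 13, s.warr 2 e ≤ s.warr 2 (s.arr 14 i)
  none : e = 0 → s.reg 13 = 0
  size : s.reg 13 ≤ s.reg 17
  le : s.reg 17 ≤ s.reg 21

/-- Each rank contributes at most one root, so at most `R + 1` roots come onto the stack, and 20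
steps per cell suffice. The search leaves the table zero, so later extractions and later
computations do not have to clear it. -/
theorem wp_heapFindMin {T K R : ℕ} {s : State} (h : HeapState n X par 0 s) (hz : s.reg 2 = 0)
    (h13 : s.reg 13 = 0) (htb : ∀ r, s.arr 15 r ≠ 0 → r ≤ s.reg 21) (hR : s.reg 21 ≤ R)
    (hT : K + 20 * (R + 1) + 5 ≤ T) :
    WP heapFindMin (fun T' s' => SameNodes s s' ∧ ∃ e, FindMinInv n X par e s' ∧
      (∀ r, s'.arr 15 r = 0) ∧ s'.reg 13 ≤ R + 1 ∧ K ≤ T') T s := by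
  refine wp_seq (wp_block (by simp; omega) ?_)
  refine wp_loop (fun T' s' => SameNodes s s' ∧ s'.reg 21 ≤ R + 1 ∧ ∃ e, FindMinInv n X par e s' ∧
    K + 20 * (s'.reg 21 - s'.reg 17) + 1 ≤ T') ?_ ?_
  · generalize hs1 : runs _ s = s1
    have r1 : ∀ r, r ≠ 16 → r ≠ 17 → r ≠ 21 → s1.reg r = s.reg r := by
      intro r i1 i2 i3
      rw [← hs1]; simp [runs, Instr.run, i1, i2, i3]
    have r16 : s1.reg 16 = 0 := by rw [← hs1]; simp [runs, Instr.run]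
    have r17 : s1.reg 17 = 0 := by rw [← hs1]; simp [runs, Instr.run]
    have r21 : s1.reg 21 = s.reg 21 + 1 := by rw [← hs1]; simp [runs, Instr.run]
    have a1 : s1.arr = s.arr := by rw [← hs1]; rfl
    have w1 : s1.warr = s.warr := by rw [← hs1]; rfl
    clear hs1
    have r13 : s1.reg 13 = 0 := by rw [r1 13 (by simp) (by simp) (by simp), h13]
    refine ⟨⟨⟨fun r hr => r1 r (by omega) (by omega) (by omega), fun _ _ => by rw [a1],
      fun _ _ => by rw [w1]⟩, r1 14 (by simp) (by simp) (by simp), by rw [a1], by rw [a1], w1⟩,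
      by omega, 0, ⟨?_, r16, by omega, ?_, fun h => absurd rfl h, fun h => absurd rfl h,
      fun h => absurd rfl h, fun _ => r13, by omega, by omega⟩, ?_⟩
    · exact h.congr (by rw [r13, h13]) (r1 14 (by simp) (by simp) (by simp))
        (fun _ _ => by rw [a1]) (by rw [w1])
    · intro r hr
      rw [a1] at hr
      have := htb r hr
      omega
    · simp only [List.length_cons, List.length_nil]
      omega
  · rintro T s1 ⟨hN, h21, e, hI, hT⟩
    have hz1 : s1.reg 2 = 0 := by rw [hN.main.reg 2 (by simp), hz]
    have hle := hI.le
    refine ⟨by omega, fun hb => ?_, fun hb => ?_⟩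
    · simp only [Test.Holds] at hb
      obtain ⟨d, hd⟩ : ∃ d, s1.reg 21 - s1.reg 17 = d + 1 := ⟨_, (Nat.succ_pred (by omega)).symm⟩
      rw [hd, mul_add, mul_one] at hT
      set r := s1.reg 17 with hr
      have key : ∀ (T' e' : ℕ) (s2 : State), HeapInv n X par e' (s2.reg 13) (s1.reg 14) (s1.arr 8)
          (s1.arr 9) (s1.arr 10) (s1.arr 11) (s1.arr 12) (s1.arr 13) (s2.arr 14)
          (Function.update (s1.arr 15) r 0) (s1.warr 2) → s2.reg 16 = e' →
          s2.arr 15 = Function.update (s1.arr 15) r 0 →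
          (∀ a, a ≠ 14 → a ≠ 15 → s2.arr a = s1.arr a) → s2.warr = s1.warr →
          (∀ r, r ≠ 13 → r ≠ 16 → r ≠ 17 → r ≠ 18 → s2.reg r = s1.reg r) → s2.reg 17 = r + 1 →
          (e' ≠ 0 → s1.arr 8 (s1.arr 9 e') = e') → (e' ≠ 0 → s1.arr 11 e' = s1.arr 10 e') →
          (e' ≠ 0 → ∀ i < s2.reg 13, s1.warr 2 e' ≤ s1.warr 2 (s2.arr 14 i)) →
          (e' = 0 → s2.reg 13 = 0) → s2.reg 13 ≤ s1.reg 13 + 1 → T ≤ T' + 20 →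
          SameNodes s s2 ∧ s2.reg 21 ≤ R + 1 ∧ ∃ e, FindMinInv n X par e s2 ∧
            K + 20 * (s2.reg 21 - s2.reg 17) + 1 ≤ T' := by
        intro T' e' s2 hH i16 i15 ia iw ir i17 hf hdg hk hn h13 hTT
        have j14 := ir 14 (by simp) (by simp) (by simp) (by simp)
        have j21 := ir 21 (by simp) (by simp) (by simp) (by simp)
        have hsz := hI.size
        refine ⟨hN.trans ⟨⟨fun r hr => ir r (by omega) (by omega) (by omega) (by omega),
          fun r hr => ia r (by omega) (by omega), fun _ _ => by rw [iw]⟩, j14, ia 8 (by simp)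
          (by simp), ia 9 (by simp) (by simp), iw⟩, by omega, e', ⟨?_, i16, ?_, ?_, ?_, ?_, ?_, hn,
          by omega, by omega⟩, ?_⟩
        · unfold HeapState
          rw [j14, ia 8 (by simp) (by simp), ia 9 (by simp) (by simp), ia 10 (by simp) (by simp),
            ia 11 (by simp) (by simp), ia 12 (by simp) (by simp), ia 13 (by simp) (by simp), i15, iw]
          exact hH
        · intro q hq
          rw [i15]
          by_cases hqr : q = r
          · simp [hqr]
          · rw [Function.update_of_ne hqr]
            exact hI.table_zero q (by omega)
        · intro q hq
          rw [j21]
          rw [i15] at hq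
          by_cases hqr : q = r
          · simp [hqr] at hq
          · rw [Function.update_of_ne hqr] at hq
            exact hI.table_lt q hq
        · rw [ia 8 (by simp) (by simp), ia 9 (by simp) (by simp)]
          exact hf
        · rw [ia 10 (by simp) (by simp), ia 11 (by simp) (by simp)]
          exact hdg
        · rw [iw]
          exact hk
        · rw [i17, j21, show s1.reg 21 - (r + 1) = d by omega]
          omega
      have hH : HeapInv n X par e (s1.reg 13) (s1.reg 14) (s1.arr 8) (s1.arr 9) (s1.arr 10)
        (s1.arr 11) (s1.arr 12) (s1.arr 13) (s1.arr 14) (s1.arr 15) (s1.warr 2) := hI.state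
      refine wp_seq (wp_block (by simp; omega) ?_)
      refine wp_seq (wp_branch (by simp; omega) (fun hb => ?_) (fun hb => ?_))
      · simp only [Test.Holds, runs, Instr.run, List.foldl, Function.update_self] at hb
        simp [hz1, ← hr] at hb
        have hupd : Function.update (s1.arr 15) r 0 = s1.arr 15 := by
          rw [← hb, Function.update_eq_self]
        refine wp_block (by simp; omega) (wp_block (by simp; omega) (key _ e _ ?_ ?_ ?_ ?_ ?_ ?_ ?_
          hI.full hI.deg ?_ ?_ ?_ ?_))
        · rw [hupd]
          simpa [runs, Instr.run] using hH
        · simpa [runs, Instr.run] using hI.best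
        · rw [hupd]
          simp [runs, Instr.run]
        · simp [runs, Instr.run]
        · simp [runs, Instr.run]
        · intro q i1 i2 i3 i4
          simp [runs, Instr.run, i3, i4]
        · simp [runs, Instr.run, hr]
        · simpa [runs, Instr.run] using hI.key_le
        · simpa [runs, Instr.run] using hI.none
        · simp [runs, Instr.run]
        · simp
          omega
      · simp only [Test.Holds, runs, Instr.run, List.foldl, Function.update_self] at hb
        simp [hz1, ← hr] at hb
        obtain ⟨t1, t2, t3, t4, t5⟩ := hH.roots.tb_mem r hb
        have t6 := hH.verts.full _ t1 t4 t5
        refine wp_seq (wp_block (by simp; omega) ?_)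
        refine wp_branch (by simp; omega) (fun hc => ?_) (fun hc => ?_)
        · simp [Test.Holds, runs, Instr.run, hI.best, hz1] at hc
          subst hc
          refine wp_block (by simp; omega) (wp_block (by simp; omega) (key _ (s1.arr 15 r) _ ?_ ?_ ?_
            ?_ ?_ ?_ ?_ (fun _ => t5) (fun _ => t6) ?_ ?_ ?_ ?_))
          · simpa [runs, Instr.run] using hH.fromTable hb
          · simp [runs, Instr.run, ← hr]
          · simp [runs, Instr.run, ← hr, hz1]
          · intro a i1 i2
            simp [runs, Instr.run, i2]
          · simp [runs, Instr.run]
          · intro q i1 i2 i3 i4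
            simp [runs, Instr.run, i2, i3, i4]
          · simp [runs, Instr.run, hr]
          · simp [runs, Instr.run, hI.none rfl]
          · exact fun h => absurd h hb
          · simp [runs, Instr.run]
          · simp
            omega
        · simp [Test.Holds, runs, Instr.run, hI.best, hz1] at hc
          refine wp_seq (wp_block (by simp; omega) ?_)
          refine wp_branch (by simp; omega) (fun hk => ?_) (fun hk => ?_)
          · simp [Test.Holds, runs, Instr.run, hI.best, ← hr] at hk
            refine wp_block (by simp; omega) (wp_block (by simp; omega) (key _ e _ ?_ ?_ ?_
              ?_ ?_ ?_ ?_ hI.full hI.deg ?_ ?_ ?_ ?_))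
            · simpa [runs, Instr.run, ← hr] using hH.tableToStack hb
            · simp [runs, Instr.run, hI.best]
            · simp [runs, Instr.run, ← hr, hz1]
            · intro a i1 i2
              simp [runs, Instr.run, i1, i2]
            · simp [runs, Instr.run]
            · intro q i1 i2 i3 i4
              simp [runs, Instr.run, i1, i3, i4]
            · simp [runs, Instr.run, hr]
            · intro _ i hi
              simp [runs, Instr.run] at hi
              by_cases hik : i = s1.reg 13
              · simpa [runs, Instr.run, hik, ← hr] using hk
              · simpa [runs, Instr.run, hik] using hI.key_le hc i (by omega)
            · exact fun h => absurd h hc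
            · simp [runs, Instr.run]
            · simp
              omega
          · simp [Test.Holds, runs, Instr.run, hI.best, ← hr] at hk
            refine wp_block (by simp; omega) (wp_block (by simp; omega) (key _ (s1.arr 15 r) _ ?_ ?_
              ?_ ?_ ?_ ?_ ?_ (fun _ => t5) (fun _ => t6) ?_ ?_ ?_ ?_))
            · simpa [runs, Instr.run, hI.best] using
                (hH.push hc (hI.full hc) (hI.deg hc)).fromTable hb
            · simp [runs, Instr.run, ← hr]
            · simp [runs, Instr.run, ← hr, hz1]
            · intro a i1 i2
              simp [runs, Instr.run, i1, i2]
            · simp [runs, Instr.run]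
            · intro q i1 i2 i3 i4
              simp [runs, Instr.run, i1, i2, i3, i4]
            · simp [runs, Instr.run, hr]
            · intro _ i hi
              simp [runs, Instr.run] at hi
              by_cases hik : i = s1.reg 13
              · simpa [runs, Instr.run, hik, hI.best] using hk.le
              · simpa [runs, Instr.run, hik] using hk.le.trans (hI.key_le hc i (by omega))
            · exact fun h => absurd h hb
            · simp [runs, Instr.run]
            · simp
              omega
    · simp only [Test.Holds] at hb
      refine ⟨hN, e, hI, fun r => ?_, by have := hI.size; omega, by omega⟩
      by_contra h0
      exact h0 (hI.table_zero r (by have := hI.table_lt r h0; omega))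

end

/-! ### Extraction of a minimum -/

section

variable {n : ℕ} {X : Finset ℕ} {par : ℕ → ℕ} {e : ℕ}

theorem FindMinInv.eq_empty {s : State} (h : FindMinInv n X par 0 s) (htb : ∀ r, s.arr 15 r = 0) :
    X = ∅ := by
  refine Finset.eq_empty_of_forall_notMem fun z hz => ?_
  obtain ⟨r, hr, hp, -⟩ := h.state.tree.exists_root hz
  have h0 := h.state.tree.pos r hr
  rcases h.state.roots.root r hr hp with h1 | ⟨i, hi, -⟩ | h1
  · exact h0 h1
  · rw [h.none rfl] at hi
    omega
  · rw [htb] at h1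
    exact h0 h1.symm

/-- By heap order some root is at least as good as `z`; the table being empty, this root is `e` or
has been compared with the best root on its way to the stack. -/
theorem FindMinInv.key_le_key {s : State} (h : FindMinInv n X par e s) (he : e ≠ 0)
    (htb : ∀ r, s.arr 15 r = 0) {z : ℕ} (hz : z ∈ X) : s.warr 2 e ≤ s.warr 2 z := by
  obtain ⟨r, hr, hp, hk⟩ := h.state.tree.exists_root hz
  refine le_trans ?_ hk
  have h0 := h.state.tree.pos r hr
  rcases h.state.roots.root r hr hp with h1 | ⟨i, hi, h1⟩ | h1
  · rw [h1]
  · rw [← h1]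
    exact h.key_le he i hi
  · rw [htb] at h1
    exact absurd h1.symm h0

/-- The root `e` in transit is exempt from the conditions on children, but being full it satisfies
them, so the bound on ranks still applies. -/
theorem FindMinInv.deg_le {R : ℕ} {s : State} (h : FindMinInv n X par e s) (he : e ≠ 0)
    (hR : 2 * Nat.log 2 X.card + 1 ≤ R) : s.arr 11 e ≤ R := by
  have h1 : 2 ^ (s.arr 10 e / 2) ≤ X.card := by
    refine h.state.tree.two_pow_le_card (fun v hv => ?_) (h.state.roots.ext_mem he).1
    by_cases hve : v = e
    · rw [hve, h.deg he]
      exact Or.inl le_rfl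
    · exact h.state.verts.two v hv hve
  have h2 := Nat.le_log_of_pow_le (by norm_num) h1
  rw [h.deg he]
  omega

/-- After consolidation the cost is linear in the rank bound: 20 per cell of the table, 36 of
potential per root that returns to the stack, and 12 + 36 per child of the extracted root. This is
less than 110 per rank. -/
theorem wp_hollowHeap_extract {T K R : ℕ} {s : State} (h : HeapState n X par 0 s)
    (hz : s.reg 2 = 0) (htb : ∀ r, s.arr 15 r = 0) (hR : 2 * Nat.log 2 X.card + 1 ≤ R)
    (hT : K + (36 * s.reg 13 + 70 * X.card) + 110 * (R + 1) ≤ T) :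
    WP hollowHeap.extract (fun T' s' => SameNodes s s' ∧ (∀ r, s'.arr 15 r = 0) ∧
      ((s'.reg 11 = 0 ∧ (∀ v ∈ X, s.arr 8 (s.arr 9 v) ≠ v) ∧ ∃ par', HeapState n ∅ par' 0 s' ∧
        K + 36 * s'.reg 13 ≤ T') ∨
      ∃ e ∈ X, s.arr 8 (s.arr 9 e) = e ∧ s'.reg 10 = s.arr 9 e ∧ 0 < s'.reg 11 ∧
        s'.wreg 1 = s.warr 2 e ∧ (∀ v ∈ X, s.arr 8 (s.arr 9 v) = v → s.warr 2 e ≤ s.warr 2 v) ∧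
        ∃ X' ⊆ X, e ∉ X' ∧ (∀ v ∈ X, s.arr 8 (s.arr 9 v) = v → v ≠ e → v ∈ X') ∧
          ∃ par', HeapState n X' par' 0 s' ∧ K + (36 * s'.reg 13 + 70 * X'.card) ≤ T')) T s := by
  refine wp_seq ((wp_heapConsolidate (K := K + 110 * R + 100) h hz htb hR (by omega)).mono ?_)
  rintro T1 s1 ⟨hN1, h113, X', hX', par1, hH1, hfull, htb1, h121, hT1⟩
  have hlog := Nat.log_mono_right (b := 2) (Finset.card_le_card hX')
  have hz1 : s1.reg 2 = 0 := by rw [hN1.main.reg 2 (by simp), hz]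
  refine wp_seq ((wp_heapFindMin (K := K + 90 * R + 70 + 70 * X'.card) hH1 hz1 h113 htb1 h121
    (by omega)).mono ?_)
  rintro T2 s2 ⟨hN2', e, hI, htb2, h213, hT2⟩
  have hN2 := hN1.trans hN2'
  have hz2 : s2.reg 2 = 0 := by rw [hN2.main.reg 2 (by simp), hz]
  refine wp_branch (by omega) (fun hb => ?_) (fun hb => ?_)
  · simp only [Test.Holds, hI.best, hz2] at hb
    subst hb
    have hem := hI.eq_empty htb2
    refine wp_block (by simp; omega) ?_
    have hir : ∀ r, r ≠ 11 → (runs [Instr.const 11 0] s2).reg r = s2.reg r := by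
      intro r hr
      simp [runs, Instr.run, hr]
    refine ⟨hN2.trans ⟨⟨fun r hr => hir r (by omega), fun _ _ => rfl, fun _ _ => rfl⟩,
      hir 14 (by simp), rfl, rfl, rfl⟩, htb2, Or.inl ⟨by simp [runs, Instr.run], ?_, par1, ?_, ?_⟩⟩
    · intro v hv hv'
      have := hfull v hv hv'
      rw [hem] at this
      simp at this
    · rw [← hem]
      exact hI.state.congr (hir 13 (by simp)) (hir 14 (by simp)) (fun _ _ => rfl) rfl
    · rw [hir 13 (by simp), hI.none rfl]
      simp
      omega
  · simp only [Test.Holds, hI.best, hz2] at hb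
    obtain ⟨heX, -⟩ := hI.state.roots.ext_mem hb
    have hdeg := hI.deg_le hb (R := R) (by omega)
    have hmin := fun v hv hv' => hI.key_le_key hb htb2 (hfull v hv hv')
    have hef := hI.full hb
    rw [hN2.nd, hN2.it] at hef
    rw [hN2.warr] at hmin
    refine wp_seq (wp_block (by simp; omega) ?_)
    generalize hs3 : runs _ s2 = s3
    have r3 : ∀ r, r ≠ 10 → r ≠ 11 → s3.reg r = s2.reg r := by
      intro r i1 i2
      rw [← hs3]; simp [runs, Instr.run, i1, i2]
    have r10 : s3.reg 10 = s.arr 9 e := by rw [← hs3]; simp [runs, Instr.run, hI.best, hN2.it]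
    have r11 : s3.reg 11 = 1 := by rw [← hs3]; simp [runs, Instr.run]
    have v3 : s3.wreg 1 = s.warr 2 e := by rw [← hs3]; simp [runs, Instr.run, hI.best, hN2.warr]
    have a3 : s3.arr = s2.arr := by rw [← hs3]; rfl
    have w3 : s3.warr = s2.warr := by rw [← hs3]; rfl
    clear hs3
    have hN3 : SameNodes s s3 := hN2.trans ⟨⟨fun r hr => r3 r (by omega) (by omega),
      fun _ _ => by rw [a3], fun _ _ => by rw [w3]⟩, r3 14 (by simp) (by simp), by rw [a3],
      by rw [a3], w3⟩
    have hH3 : HeapState n X' par1 e s3 := hI.state.congr (r3 13 (by simp) (by simp))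
      (r3 14 (by simp) (by simp)) (fun _ _ => by rw [a3]) (by rw [w3])
    refine (wp_heapDetach (K := K + 78 * R + 50 + 70 * X'.card) hH3
      (by rw [r3 16 (by simp) (by simp), hI.best]) hb
      (by rw [r3 2 (by simp) (by simp), hz2]) (by rw [a3]; simp; omega)).mono ?_
    rintro T4 s4 ⟨hN4, h15, hw, h10, h11, -, h13, ⟨par4, hH4⟩, hdg4, hT4⟩
    have hcard := Finset.card_erase_add_one heX
    refine ⟨hN3.trans hN4, by rw [h15, a3]; exact htb2, Or.inr ⟨e, hX' heX, hef, by rw [h10, r10],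
      by omega, by rw [hw, v3], hmin, X'.erase e, (Finset.erase_subset _ _).trans hX',
      Finset.notMem_erase _ _, fun v hv hv' hve => Finset.mem_erase.2 ⟨hve, hfull v hv hv'⟩, par4,
      HeapInv.destroy hH4 hb hdg4, ?_⟩⟩
    rw [a3, r3 13 (by simp) (by simp)] at h13
    omega

end

/-! ### Hollow heaps as queues of labelled vertices -/

section

variable {n : ℕ} {f : ℕ → WithTop ℝ≥0} {P : Finset ℕ} {cur : ℝ≥0} {j k : ℕ}

/-- The memory holds a hollow heap with the labels `f` and the elements `P`; the number of nodes
that have been made is at most `j + 1` and the potential of the heap is at most `k`. -/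
def HollowInv (n j : ℕ) (f : ℕ → WithTop ℝ≥0) (P : Finset ℕ) (cur : ℝ≥0) (k : ℕ) (s : State) :
    Prop :=
  ∃ X par, HeapState n X par 0 s ∧ (∀ r, s.arr 15 r = 0) ∧
    (∀ v < n, f v = flagged (s.arr 8 v) (s.warr 2 (s.arr 8 v))) ∧
    (∀ v, v ∈ P ↔ v < n ∧ s.arr 8 v ∈ X) ∧ s.wreg 1 = cur ∧ s.reg 14 ≤ j + 2 ∧
    36 * s.reg 13 + 70 * X.card ≤ k

theorem HollowInv.congr {s s' : State} (h : HollowInv n j f P cur k s) (hQ : SameQueue s s') :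
    HollowInv n j f P cur k s' := by
  obtain ⟨X, par, h1, h2, h3, h4, h5, h6, h7⟩ := h
  refine ⟨X, par, h1.congr (hQ.reg 13 (by simp)) (hQ.reg 14 (by simp)) hQ.arr (hQ.warr 2 (by simp)),
    ?_⟩
  rw [hQ.reg 13 (by simp), hQ.reg 14 (by simp), hQ.arr 8 (by simp), hQ.arr 15 (by simp),
    hQ.warr 2 (by simp), hQ.wreg]
  exact ⟨h2, h3, h4, h5, h6, h7⟩

theorem HeapState.card_le {X : Finset ℕ} {par : ℕ → ℕ} {e : ℕ} {s : State}
    (h : HeapState n X par e s) : X.card ≤ s.reg 14 := by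
  have : X ⊆ Finset.range (s.reg 14) := fun v hv => Finset.mem_range.2 (h.verts.lt_cnt v hv)
  simpa using Finset.card_le_card this

/-- Node numbers are never reused, so the counter in register `14` bounds the size of the heap by `j
+ 2 ≤ m + 2`, and 2 log(m + 2) + 1 bounds the ranks. The extracted vertex keeps its node number and
its key; it leaves `P` because its node leaves `X`, while its label remains readable. -/
theorem wp_hollowHeap_extract_inv {T K m : ℕ} {s : State} (h : HollowInv n j f P cur k s)
    (hz : s.reg 2 = 0) (hj : j ≤ m) (hT : K + k + 220 * (Nat.log 2 (m + 2) + 1) ≤ T) :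
    WP hollowHeap.extract (fun T' s' => SameMain s s' ∧
      ((P = ∅ ∧ s'.reg 11 = 0 ∧ (∃ b k', HollowInv n j f P b k' s') ∧ K ≤ T') ∨
        ∃ u ∈ P, s'.reg 10 = u ∧ 0 < s'.reg 11 ∧ (∀ v ∈ P, f u ≤ f v) ∧
          ∃ k' b, f u = WithTop.some b ∧ HollowInv n j f (P.erase u) b k' s' ∧ K + k' ≤ T')) T s := by
  obtain ⟨X, par, h1, h2, h3, h4, h5, h6, h7⟩ := h
  have hlog := Nat.log_mono_right (b := 2) (show X.card ≤ m + 2 from h1.card_le.trans (by omega))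
  have hfull : ∀ v < n, s.arr 8 v ∈ X → s.arr 9 (s.arr 8 v) = v := fun v hv hX =>
    (h1.verts.nd_it v hv (h1.tree.pos _ hX)).1
  refine (wp_hollowHeap_extract (K := K) (R := 2 * Nat.log 2 (m + 2) + 1) h1 hz h2 (by omega)
    (by omega)).mono ?_
  rintro T' s' ⟨hN, htb, ⟨h11, hem, par', hH, hT'⟩ |
    ⟨e, heX, hef, h10, h11, hw1, hmin, X', hX', heX', hfull', par', hH, hT'⟩⟩
  · have hP : P = ∅ := by
      refine Finset.eq_empty_of_forall_notMem fun v hv => ?_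
      obtain ⟨hv1, hv2⟩ := (h4 v).1 hv
      exact hem _ hv2 (by rw [hfull v hv1 hv2])
    refine ⟨hN.main, Or.inl ⟨hP, h11, ⟨_, 36 * s'.reg 13, ∅, par', hH, htb, ?_, ?_, rfl, ?_, by simp⟩,
      by omega⟩⟩
    · rw [hN.nd, hN.warr]
      exact h3
    · simp [hP]
    · rw [hN.cnt]
      exact h6
  · have hen := h1.verts.it_lt e heX
    have he0 := h1.tree.pos e heX
    have hlab : ∀ v < n, s.arr 8 v ∈ X → f v = WithTop.some (s.warr 2 (s.arr 8 v)) := by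
      intro v hv hvX
      rw [h3 v hv, flagged, if_neg (h1.tree.pos _ hvX)]
    have hfe : f (s.arr 9 e) = WithTop.some (s.warr 2 e) := by
      rw [hlab _ hen (by rwa [hef]), hef]
    refine ⟨hN.main, Or.inr ⟨s.arr 9 e, (h4 _).2 ⟨hen, by rwa [hef]⟩, h10, h11, ?_,
      36 * s'.reg 13 + 70 * X'.card, s.warr 2 e, hfe, ⟨X', par', hH, htb, ?_, ?_, hw1, ?_, le_rfl⟩,
      hT'⟩⟩
    · intro v hv
      obtain ⟨hv1, hv2⟩ := (h4 v).1 hv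
      rw [hfe, hlab v hv1 hv2]
      exact WithTop.coe_le_coe.2 (hmin _ hv2 (by rw [hfull v hv1 hv2]))
    · rw [hN.nd, hN.warr]
      exact h3
    · intro v
      rw [hN.nd, Finset.mem_erase, h4]
      constructor
      · rintro ⟨i1, i2, i3⟩
        refine ⟨i2, hfull' _ i3 (by rw [hfull v i2 i3]) fun hve => i1 ?_⟩
        rw [← hve, hfull v i2 i3]
      · rintro ⟨i1, i2⟩
        refine ⟨?_, i1, hX' i2⟩
        rintro rfl
        rw [hef] at i2
        exact heX' i2
    · rw [hN.cnt]
      exact h6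

/-- One new root and one new node raise the potential by 36 + 70 = 106. The new number differs from
those of all current and former nodes of the vertices, so the other labels are unaffected. -/
theorem HollowInv.insert {X : Finset ℕ} {par : ℕ → ℕ} {s s' : State} {v : ℕ} {x : ℝ≥0}
    (h : HeapState n X par 0 s) (h3 : ∀ v < n, f v = flagged (s.arr 8 v) (s.warr 2 (s.arr 8 v)))
    (h4 : ∀ v, v ∈ P ↔ v < n ∧ s.arr 8 v ∈ X) (h6 : s.reg 14 ≤ j + 1)
    (h7 : 36 * s.reg 13 + 70 * X.card ≤ k) (hv : v < n) {par' : ℕ → ℕ}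
    (hH : HeapState n (insert (s.reg 14) X) par' 0 s') (htb : ∀ r, s'.arr 15 r = 0)
    (hnd : s'.arr 8 = Function.update (s.arr 8) v (s.reg 14))
    (hkey : s'.warr 2 = Function.update (s.warr 2) (s.reg 14) x) (hcur : s'.wreg 1 = cur)
    (hcnt : s'.reg 14 = s.reg 14 + 1) (hk : s'.reg 13 = s.reg 13 + 1) :
    HollowInv n j (Function.update f v x) (Insert.insert v P) cur (k + 106) s' := by
  have hpos := h.verts.cnt_pos
  have hne : ∀ w < n, s.arr 8 w ≠ s.reg 14 := by
    intro w hw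
    by_cases h0 : s.arr 8 w = 0
    · omega
    · exact (h.verts.nd_it w hw h0).2.ne
  have hcard := Finset.card_insert_le (s.reg 14) X
  refine ⟨_, par', hH, htb, ?_, ?_, hcur, by omega, by omega⟩
  · intro w hw
    rw [hnd, hkey]
    by_cases hwv : w = v
    · rw [hwv, Function.update_self, Function.update_self, Function.update_self, flagged,
        if_neg hpos.ne']
    · rw [Function.update_of_ne hwv, Function.update_of_ne hwv, Function.update_of_ne (hne w hw),
        h3 w hw]
  · intro w
    rw [hnd, Finset.mem_insert, Finset.mem_insert, h4]
    by_cases hwv : w = v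
    · rw [hwv, Function.update_self]
      simp [hv]
    · rw [Function.update_of_ne hwv]
      constructor
      · rintro (i1 | ⟨i1, i2⟩)
        · exact absurd i1 hwv
        · exact ⟨i1, Or.inr i2⟩
      · rintro ⟨i1, i2 | i2⟩
        · exact absurd i2 (hne w i1)
        · exact Or.inr ⟨i1, i2⟩

/-- There are three cases: the label is not improved; it is improved and a new leaf suffices,
because the vertex is new or its old node has fewer than two children and can keep them as a hollow
node; or the old node is split. Of the 150 units, 106 are reserved as potential of the new node. -/
theorem wp_hollowHeap_relax {T K : ℕ} {s : State} {v : ℕ} {x : ℝ≥0}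
    (h : HollowInv n j f P cur k s) (hz : s.reg 2 = 0) (hv9 : s.reg 9 = v) (hv : v < n)
    (hx : cur + s.warr 0 (s.reg 5) = x)
    (hcases : v ∈ P ∨ f v = ⊤ ∨ f v ≤ WithTop.some x) (hT : K + k + 150 ≤ T) :
    WP hollowHeap.relax (fun T' s' => SameMain s s' ∧ s'.reg 10 = s.reg 10 ∧ ∃ k',
      HollowInv n (j + 1) (Function.update f v (min (f v) (WithTop.some x)))
        (if WithTop.some x < f v then insert v P else P) cur k' s' ∧ K + k' ≤ T') T s := by
  obtain ⟨X, par, h1, h2, h3, h4, h5, h6, h7⟩ := h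
  have hfv := h3 v hv
  have key : ∀ (T' : ℕ) (s' : State), SameMain s s' → s'.reg 10 = s.reg 10 → s'.wreg 1 = s.wreg 1 →
      s'.arr 15 = s.arr 15 → WithTop.some x < f v →
      (∃ par', HeapState n (Insert.insert (s.reg 14) X) par' 0 s') →
      s'.arr 8 = Function.update (s.arr 8) v (s.reg 14) →
      s'.warr 2 = Function.update (s.warr 2) (s.reg 14) x →
      s'.reg 14 = s.reg 14 + 1 → s'.reg 13 = s.reg 13 + 1 → K + k + 106 ≤ T' →
      SameMain s s' ∧ s'.reg 10 = s.reg 10 ∧ ∃ k',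
        HollowInv n (j + 1) (Function.update f v (min (f v) (WithTop.some x)))
          (if WithTop.some x < f v then insert v P else P) cur k' s' ∧ K + k' ≤ T' := by
    rintro T' s' hM h10 hw h15 hlt ⟨par', hH⟩ hnd hkey hcnt hk hT'
    refine ⟨hM, h10, k + 106, ?_, by omega⟩
    rw [min_eq_right hlt.le, if_pos hlt]
    exact HollowInv.insert h1 h3 h4 h6 h7 hv hH (by rw [h15]; exact h2) hnd hkey (by rw [hw, h5])
      hcnt hk
  have leaf : ∀ (T' : ℕ) (s1 : State), s1.arr = s.arr → s1.warr = s.warr → s1.wreg 0 = x →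
      s1.wreg 1 = s.wreg 1 → (∀ r < 16, s1.reg r = s.reg r) → WithTop.some x < f v →
      (s.arr 8 v ∈ X → s.arr 11 (s.arr 8 v) ≤ 2) → K + k + 106 + 9 ≤ T' →
      WP (block ([.store 10 14 2, .store 11 14 2] ++ heapStore)) (fun T' s' => SameMain s s' ∧
        s'.reg 10 = s.reg 10 ∧ ∃ k',
        HollowInv n (j + 1) (Function.update f v (min (f v) (WithTop.some x)))
          (if WithTop.some x < f v then insert v P else P) cur k' s' ∧ K + k' ≤ T') T' s1 := by
    intro T' s1 a1 w1 v0 v1 r1 hlt hdg hT'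
    have hI := HeapInv.insert h1 h2 hv hdg x
    have i2 := r1 2 (by simp)
    have i9 := r1 9 (by simp)
    have i10 := r1 10 (by simp)
    have i13 := r1 13 (by simp)
    have i14 := r1 14 (by simp)
    refine wp_block (by simp [heapStore]; omega) (key _ _ ⟨?_, ?_, ?_⟩ ?_ ?_ ?_ hlt
      ⟨Function.update par (s.reg 14) 0, ?_⟩ ?_ ?_ ?_ ?_ ?_)
    · intro r hr
      simp [runs, Instr.run, heapStore, show r ≠ 13 by omega, show r ≠ 14 by omega,
        r1 r (by omega)]
    · intro a ha
      simp [runs, Instr.run, heapStore, show a ≠ 8 by omega, show a ≠ 9 by omega,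
        show a ≠ 10 by omega, show a ≠ 11 by omega, show a ≠ 14 by omega, a1]
    · intro a ha
      simp [runs, Instr.run, heapStore, show a ≠ 2 by omega, w1]
    · simp [runs, Instr.run, heapStore, i10]
    · simp [runs, Instr.run, heapStore, v1]
    · simp [runs, Instr.run, heapStore, a1]
    · unfold HeapState
      simpa [runs, Instr.run, heapStore, a1, w1, i2, i9, i13, i14, hz, hv9, v0] using hI
    · simp [runs, Instr.run, heapStore, a1, i9, i14, hv9]
    · simp [runs, Instr.run, heapStore, w1, i14, v0]
    · simp [runs, Instr.run, heapStore, i14]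
    · simp [runs, Instr.run, heapStore, i13]
    · simp [heapStore]
      omega
  refine wp_seq (wp_block (by simp; omega) ?_)
  generalize hs1 : runs _ s = s1
  have r1 : ∀ r, r ≠ 16 → s1.reg r = s.reg r := by
    intro r hr
    rw [← hs1]; simp [runs, Instr.run, hr]
  have i16 : s1.reg 16 = s.arr 8 v := by rw [← hs1]; simp [runs, Instr.run, hv9]
  have v0 : s1.wreg 0 = x := by rw [← hs1]; simp [runs, Instr.run, h5, hx]
  have v1 : s1.wreg 1 = s.wreg 1 := by rw [← hs1]; simp [runs, Instr.run]
  have a1 : s1.arr = s.arr := by rw [← hs1]; rfl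
  have w1 : s1.warr = s.warr := by rw [← hs1]; rfl
  clear hs1
  have i2 := r1 2 (by simp)
  have i13 := r1 13 (by simp)
  have i14 := r1 14 (by simp)
  refine wp_branch (by simp; omega) (fun hb => ?_) (fun hb => ?_)
  · simp only [Test.Holds, i16, i2, hz] at hb
    refine leaf _ s1 a1 w1 v0 v1 (fun r hr => r1 r (by omega)) ?_ ?_ (by simp; omega)
    · rw [hfv, hb, flagged, if_pos rfl]
      exact WithTop.coe_lt_top x
    · intro hX
      exact absurd hb (h1.tree.pos _ hX)
  · simp only [Test.Holds, i16, i2, hz] at hb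
    rw [flagged, if_neg hb] at hfv
    refine wp_seq (wp_block (by simp; omega) ?_)
    refine wp_branch (by simp; omega) (fun hc => ?_) (fun hc => ?_)
    · simp [Test.Holds, runs, Instr.run, i16, w1, v0] at hc
      have hle : f v ≤ WithTop.some x := by
        rw [hfv]
        exact WithTop.coe_le_coe.2 hc
      refine wp_block (by simp; omega) ⟨⟨?_, ?_, ?_⟩, ?_, k, ?_, ?_⟩
      · intro r hr
        simp [runs, Instr.run, r1 r (by omega)]
      · intro a _
        simp [runs, Instr.run, a1]
      · intro a _
        simp [runs, Instr.run, w1]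
      · simp [runs, Instr.run, r1 10]
      · rw [min_eq_left hle, if_neg (not_lt.2 hle), Function.update_eq_self]
        refine ⟨X, par, h1.congr ?_ ?_ ?_ ?_, ?_, ?_, ?_, ?_, ?_, ?_⟩
        · simp [runs, Instr.run, i13]
        · simp [runs, Instr.run, i14]
        · simp [runs, Instr.run, a1]
        · simp [runs, Instr.run, w1]
        · simpa [runs, Instr.run, a1] using h2
        · simpa [runs, Instr.run, a1, w1] using h3
        · simpa [runs, Instr.run, a1] using h4
        · simp [runs, Instr.run, v1, h5]
        · simp [runs, Instr.run, i14]
          omega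
        · simpa [runs, Instr.run, i13] using h7
      · simp
        omega
    · simp [Test.Holds, runs, Instr.run, i16, w1, v0] at hc
      have hlt : WithTop.some x < f v := by
        rw [hfv]
        exact WithTop.coe_lt_coe.2 hc
      -- An improved vertex with a finite label is still in the queue, so its present node belongs
      -- to the heap and may be turned into a hollow one.
      have hvP : v ∈ P := by
        rcases hcases with i | i | i
        · exact i
        · rw [hfv] at i
          exact absurd i (WithTop.coe_ne_top)
        · exact absurd hlt (not_lt.2 i)
      have hvX := ((h4 v).1 hvP).2
      refine wp_seq (wp_block (by simp; omega) ?_)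
      refine wp_branch (by simp; omega) (fun hd => ?_) (fun hd => ?_)
      · simp [Test.Holds, runs, Instr.run, i16, a1] at hd
        refine leaf _ _ ?_ ?_ ?_ ?_ ?_ hlt (fun _ => le_trans hd (by simp)) ?_
        · simp [runs, Instr.run, a1]
        · simp [runs, Instr.run, w1]
        · simp [runs, Instr.run, v0]
        · simp [runs, Instr.run, v1]
        · intro r hr
          simp [runs, Instr.run, show r ≠ 17 by omega, show r ≠ 18 by omega, r1 r (by omega)]
        · simp
          omega
      · simp [Test.Holds, runs, Instr.run, i16, a1] at hd
        have hI := HeapInv.insertSplit h1 h2 hv rfl hvX hd hc.le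
        have hvc := (h1.verts.lt_cnt _ hvX).ne
        have i9 := r1 9 (by simp)
        refine wp_block (by simp [heapStore]; omega) (key _ _ ⟨?_, ?_, ?_⟩ ?_ ?_ ?_ hlt
          ⟨splitPar (Function.update par (s.reg 14) 0) (Function.update (s.arr 10) (s.reg 14) 0)
            (s.arr 8 v) (s.reg 14), ?_⟩ ?_ ?_ ?_ ?_ ?_)
        · intro r hr
          simp [runs, Instr.run, heapStore, show r ≠ 13 by omega, show r ≠ 14 by omega,
            show r ≠ 17 by omega, show r ≠ 18 by omega, show r ≠ 19 by omega,
            show r ≠ 20 by omega, r1 r (by omega)]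
        · intro a ha
          simp [runs, Instr.run, heapStore, show a ≠ 8 by omega, show a ≠ 9 by omega,
            show a ≠ 10 by omega, show a ≠ 11 by omega, show a ≠ 12 by omega,
            show a ≠ 14 by omega, a1]
        · intro a ha
          simp [runs, Instr.run, heapStore, show a ≠ 2 by omega, w1]
        · simp [runs, Instr.run, heapStore, r1 10]
        · simp [runs, Instr.run, heapStore, v1]
        · simp [runs, Instr.run, heapStore, a1]
        · unfold HeapState
          simpa [runs, Instr.run, heapStore, a1, w1, i2, i9, i13, i14, i16, hz, hv9, v0,
            Nat.sub_sub] using hI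
        · simp [runs, Instr.run, heapStore, a1, i9, i14, hv9]
        · simp [runs, Instr.run, heapStore, w1, i14, v0]
        · simp [runs, Instr.run, heapStore, i14]
        · simp [runs, Instr.run, heapStore, i13]
        · simp [heapStore]
          omega

end

theorem wp_hollowHeap_init {β : Type*} {G : CSR β} {wtOk : (ℕ → ℝ≥0) → Prop} {T K : ℕ} {s : State}
    (hs : Input G wtOk s) (hidle : ∀ r, s.arr 15 r = 0) (hx : s.reg 4 < G.n)
    (hT : K + 200 * (G.n + 1) ≤ T) :
    WP hollowHeap.init (fun T' s' => SameMain s s' ∧ ∃ k, HollowInv G.n 0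
      (Function.update (fun _ => ⊤) (s.reg 4) (WithTop.some 0)) {s.reg 4} 0 k s' ∧ K + k ≤ T') T
      s := by
  refine wp_seq (wp_block (by simp; omega) ?_)
  refine wp_seq (wp_loop (fun T' s' => SameMain s s' ∧ s'.reg 14 ≤ G.n ∧
    (∀ v < s'.reg 14, s'.arr 8 v = 0) ∧ (∀ r, s'.arr 15 r = 0) ∧
    K + 120 + 4 * (G.n - s'.reg 14) ≤ T') ?_ ?_)
  · refine ⟨⟨?_, fun _ _ => rfl, fun _ _ => rfl⟩, ?_, ?_, ?_, ?_⟩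
    · intro r hr
      simp [runs, Instr.run, show r ≠ 14 by omega]
    · simp [runs, Instr.run]
    · simp [runs, Instr.run]
    · simpa [runs, Instr.run] using hidle
    · simp [runs, Instr.run]
      omega
  · rintro T s1 ⟨hM, hle, h8, hi, hT⟩
    have h0 : s1.reg 0 = G.n := by rw [hM.reg 0 (by simp), hs.n]
    have h2 : s1.reg 2 = 0 := by rw [hM.reg 2 (by simp), hs.zero]
    have h4 : s1.reg 4 = s.reg 4 := hM.reg 4 (by simp)
    refine ⟨by omega, fun hb => ?_, fun hb => ?_⟩
    · simp only [Test.Holds, h0] at hb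
      refine wp_block (by simp; omega) ⟨hM.trans ⟨?_, ?_, fun _ _ => rfl⟩, ?_, ?_, ?_, ?_⟩
      · intro r hr
        simp [runs, Instr.run, show r ≠ 14 by omega]
      · intro a ha
        simp [runs, Instr.run, show a ≠ 8 by omega]
      · simp [runs, Instr.run]
        omega
      · intro v hv
        simp [runs, Instr.run] at hv
        by_cases h : v = s1.reg 14
        · simp [runs, Instr.run, h, h2]
        · simp [runs, Instr.run, h, h8 v (by omega)]
      · simpa [runs, Instr.run] using hi
      · simp [runs, Instr.run]
        omega
    · simp only [Test.Holds, h0] at hb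
      -- Numbering starts with 1, since 0 stands for the absence of a node. The source is then
      -- inserted into the empty heap like any other vertex.
      have hE : HeapState G.n ∅ (fun _ => 0) 0 (runs [.const 13 0, .const 14 1] s1) := by
        unfold HeapState
        simpa [runs, Instr.run] using HeapInv.empty G.n (fun _ => 0) (s1.arr 9) (s1.arr 10)
          (s1.arr 11) (s1.arr 12) (s1.arr 13) (s1.arr 14) (s1.warr 2) (fun v hv => h8 v (by omega)) hi
      have hI := HeapInv.insert hE (by simpa [runs, Instr.run] using hi) (v := s.reg 4) hx
        (by simp) 0
      refine wp_block (by simp; omega) ⟨hM.trans ⟨?_, ?_, ?_⟩, _, HollowInv.insert (P := ∅) (k := 0)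
        hE (x := 0) ?_ (by simp) ?_ ?_ hx (par' := Function.update (fun _ => 0) 1 0) ?_ ?_ ?_ ?_ ?_
        ?_ ?_, ?_⟩
      · intro r hr
        simp [runs, Instr.run, show r ≠ 13 by omega, show r ≠ 14 by omega]
      · intro a ha
        simp [runs, Instr.run, show a ≠ 8 by omega, show a ≠ 9 by omega, show a ≠ 10 by omega,
          show a ≠ 11 by omega, show a ≠ 14 by omega]
      · intro a ha
        simp [runs, Instr.run, show a ≠ 2 by omega]
      · intro v hv
        simp [runs, Instr.run, h8 v (by omega), flagged]
      · simp [runs, Instr.run]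
      · simp [runs, Instr.run]
      · unfold HeapState
        simpa [runs, Instr.run, h2, h4] using hI
      · simpa [runs, Instr.run] using hi
      · simp [runs, Instr.run, h4]
      · simp [runs, Instr.run]
      · simp [runs, Instr.run]
      · simp [runs, Instr.run]
      · simp [runs, Instr.run]
      · simp
        omega

/-- Hollow heaps meet the specification of priority queues, with logarithmic amortized cost of
extractions. -/
def hollowSpec (G : CSR ℝ≥0) : QueueSpec hollowHeap G (fun a => a = G.wt) 200
    (220 * (Nat.log 2 (G.off G.n + 2) + 1)) where
  A j f P cur k s := HollowInv G.n j f P cur k s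
  Saved s y g := g = flagged (s.arr 4 y) (s.warr 1 y)
  congr h hQ := h.congr hQ
  idle := fun ⟨_, _, _, h, _⟩ => h
  saved_congr h h4 _ hw := by rw [h, h4, hw]
  init h1 h2 h3 h4 := wp_hollowHeap_init h1 h2 h3 h4
  extract h1 h2 h3 h4 := wp_hollowHeap_extract_inv h2 h1.zero h3 h4
  relax {T s K j f P cur k} h1 h2 _ _ h5 h6 h7 :=
    wp_hollowHeap_relax h2 h1.zero rfl h5 (by rw [h1.wt]) h6 (by omega)
  save {T s j f P cur k} h1 h2 h3 h4 := by
    obtain ⟨X, par, i1, i2, i3, -⟩ := h2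
    refine wp_block (by simp; omega) ⟨⟨?_, ?_, ?_, ?_⟩, ?_, ?_, ?_, ?_, ?_, ?_⟩
    · intro r hr
      simp [runs, Instr.run, show r ≠ 8 by omega]
    · intro a ha
      simp [runs, Instr.run, show a ≠ 4 by omega]
    · intro a ha
      simp [runs, Instr.run, show a ≠ 1 by omega]
    · simp [runs, Instr.run]
    · intro r hr
      simp [runs, Instr.run, show r ≠ 8 by omega]
    · intro a ha
      simp [runs, Instr.run, show a ≠ 4 by omega]
    · simp [runs, Instr.run]
    · simp [runs, Instr.run, i3 _ h3]
    · intro z hz g hg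
      simpa [runs, Instr.run, hz] using hg
    · simp; omega
  compare {T s j f P cur k g} h1 h2 h3 h4 h5 h6 := by
    obtain ⟨X, par, i1, i2, i3, -⟩ := h2
    have hf := i3 _ h3
    have hz := h1.zero
    refine wp_seq (wp_block (by simp; omega) (wp_branch (by simp; omega) (fun hb => ?_)
      (fun hb => ?_)))
    · simp [Test.Holds, runs, Instr.run, hz] at hb
      refine wp_block (by simp; omega) ⟨⟨?_, ?_, fun _ _ => rfl, rfl⟩, ?_, ?_, fun _ _ => rfl, ?_, ?_⟩
      · intro r hr
        simp [runs, Instr.run, show r ≠ 8 by omega]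
      · intro a ha
        simp [runs, Instr.run]
      · intro r hr
        simp [runs, Instr.run, show r ≠ 8 by omega]
      · intro a ha
        simp [runs, Instr.run]
      · simp [runs, Instr.run, hf, hb, flagged]
      · simp; omega
    · simp [Test.Holds, runs, Instr.run, hz] at hb
      rw [flagged, if_neg hb] at hf
      have hg : s.arr 4 (s.reg 9) ≠ 0 := by
        intro h
        -- As for breadth-first search, a finite current label forces a finite saved one, so the
        -- saved flag need not be tested.
        rw [h4, hf, flagged, if_pos h] at h5
        exact absurd h5 (not_le.2 (WithTop.coe_lt_top _))
      rw [flagged, if_neg hg] at h4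
      refine wp_seq (wp_block (by simp; omega) (wp_branch (by simp; omega) (fun hb => ?_)
        (fun hb => ?_)))
      all_goals
        simp [Test.Holds, runs, Instr.run] at hb
        refine wp_block (by simp; omega) ⟨⟨?_, ?_, fun _ _ => rfl, ?_⟩, ?_, ?_, fun _ _ => rfl,
          ?_, ?_⟩
        · intro r hr
          simp [runs, Instr.run, show r ≠ 8 by omega]
        · intro a ha
          simp [runs, Instr.run]
        · simp [runs, Instr.run]
        · intro r hr
          simp [runs, Instr.run, show r ≠ 8 by omega]
        · intro a ha
          simp [runs, Instr.run]
        · rw [hf, h4]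
          simp [runs, Instr.run]
          first
          | exact ⟨WithTop.coe_ne_top, WithTop.coe_le_coe.2 hb⟩
          | exact fun _ => not_le.2 (WithTop.coe_lt_coe.2 hb)
        · simp; omega

/-! ## The input format -/

theorem sum_lt_succ {n : ℕ} (g : Fin n → ℕ) (u : Fin n) :
    ∑ v : Fin n with v.val < u.val + 1, g v = ∑ v : Fin n with v.val < u.val, g v + g u := by
  have h : (Finset.univ.filter fun v : Fin n => v.val < u.val + 1) =
      insert u (Finset.univ.filter fun v : Fin n => v.val < u.val) := by
    ext v
    simp [Fin.ext_iff]
    omega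
  rw [h, Finset.sum_insert (by simp), add_comm]

/-- This serves both the array of heads and the array of weights, which are concatenated in the same
order. -/
theorem flatMap_finRange_getElem? {α : Type*} {n : ℕ} (f : Fin n → List α) (u : Fin n) {i : ℕ}
    (hi : i < (f u).length) :
    ((List.finRange n).flatMap f)[∑ v : Fin n with v.val < u.val, (f v).length + i]? =
      (f u)[i]? := by
  induction n with
  | zero => exact u.elim0
  | succ n ih =>
    rw [List.finRange_succ, List.flatMap_cons, List.flatMap_map, Finset.sum_filter,
      Fin.sum_univ_succ]
    induction u using Fin.cases with
    | zero =>
      simp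
      rw [List.getElem?_append_left hi]
    | succ u =>
      have := ih (fun v => f v.succ) u hi
      rw [Finset.sum_filter] at this
      simp only [Fin.val_zero, Fin.val_succ, Nat.zero_lt_succ, if_true, Nat.add_lt_add_iff_right]
      rw [List.getElem?_append_right (by omega), ← this]
      congr 1
      omega

/-- The compressed form of the digraph with the adjacency lists `adj`. -/
noncomputable def adjCSR {β : Type*} {n : ℕ} (adj : Fin n → List (Fin n)) (wt : ℕ → β) : CSR β where
  n := n
  off := (inputState adj (fun _ _ => 0) []).arr 0
  head := (inputState adj (fun _ _ => 0) []).arr 1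
  wt := wt

section

variable {β : Type*} {n : ℕ} {D : Digraph (Fin n)} {adj : Fin n → List (Fin n)} {wt : ℕ → β}

theorem adjCSR_off {i : ℕ} (hi : i ≤ n) :
    (adjCSR adj wt).off i = ∑ u : Fin n with u.val < i, (adj u).length := by
  simp [adjCSR, inputState, hi]

theorem adjCSR_head (e : ℕ) : (adjCSR adj wt).head e =
    (((List.finRange n).flatMap adj).map (fun v : Fin n => v.val)).getD e 0 := by
  simp [adjCSR, inputState]

theorem adjCSR_off_succ (u : Fin n) :
    (adjCSR adj wt).off (u + 1) = (adjCSR adj wt).off u + (adj u).length := by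
  rw [adjCSR_off (by omega), adjCSR_off (by omega), sum_lt_succ]

theorem adjCSR_head_add (u : Fin n) {i : ℕ} (hi : i < (adj u).length) :
    (adjCSR adj wt).head ((adjCSR adj wt).off u + i) = ((adj u)[i]).val := by
  rw [adjCSR_head, adjCSR_off (by omega), List.getD_eq_getElem?_getD, List.getElem?_map,
    flatMap_finRange_getElem? adj u hi]
  simp [hi]

theorem adjCSR_valid : (adjCSR adj wt).Valid where
  mono u hu := by
    have := adjCSR_off_succ (adj := adj) (wt := wt) ⟨u, hu⟩
    simp only at this
    omega
  head_lt e he := by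
    change _ < n
    have hn : 0 < n := by
      rcases Nat.eq_zero_or_pos n with rfl | h
      · simp [adjCSR, inputState] at he
      · exact h
    -- A cell beyond the list would hold the default value 0, which is a vertex because n is
    -- positive; so positions need not be compared with the length.
    rw [adjCSR_head, List.getD_eq_getElem?_getD, List.getElem?_map]
    cases ((List.finRange n).flatMap adj)[e]? with
    | none => simpa using hn
    | some v => simp

theorem adjCSR_represents (hadj : IsAdjacencyList D adj) {w : Fin n → Fin n → β}
    (hw : ∀ (u : Fin n) (i : ℕ) (hi : i < (adj u).length),
      wt ((adjCSR adj wt).off u + i) = w u ((adj u)[i])) : Represents (adjCSR adj wt) D w where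
  n_eq := rfl
  exists_arc u v huv := by
    obtain ⟨i, hi, rfl⟩ := List.getElem_of_mem (((hadj u).2 v).2 huv)
    exact ⟨(adjCSR adj wt).off u + i, by omega, by rw [adjCSR_off_succ]; omega,
      adjCSR_head_add u hi, hw u i hi⟩
  arc u e h1 h2 := by
    obtain ⟨i, rfl⟩ := Nat.exists_eq_add_of_le h1
    rw [adjCSR_off_succ] at h2
    have hi : i < (adj u).length := by omega
    exact ⟨(adj u)[i], adjCSR_head_add u hi, ((hadj u).2 _).1 (List.getElem_mem hi), hw u i hi⟩

theorem adjCSR_off_eq_sum : (adjCSR adj wt).off n = ∑ u : Fin n, (adj u).length := by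
  rw [adjCSR_off le_rfl]
  simp

theorem adjCSR_off_eq_arcCount (hadj : IsAdjacencyList D adj) :
    (adjCSR adj wt).off n = arcCount D := by
  have h : {a : Fin n × Fin n | D.Adj a.1 a.2} =
      ↑(Finset.univ.filter fun a : Fin n × Fin n => a.2 ∈ adj a.1) := by
    ext a
    simp [(hadj a.1).2]
  rw [adjCSR_off_eq_sum, arcCount, h, Set.ncard_coe_finset, Finset.card_filter,
    Fintype.sum_prod_type]
  refine Finset.sum_congr rfl fun u _ => ?_
  rw [← Finset.card_filter, ← List.toFinset_card_of_nodup (hadj u).1]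
  congr 1
  ext v
  simp

theorem adjCSR_off_le (hadj : IsAdjacencyList D adj) : (adjCSR adj wt).off n ≤ n ^ 2 := by
  rw [adjCSR_off_eq_sum]
  refine (Finset.sum_le_card_nsmul _ _ n fun u _ => ?_).trans (by simp [sq])
  simpa using (hadj u).1.length_le_card

end

/-! ### From the input format to the decision, and the final time bounds -/

theorem IsListing.card {n : ℕ} {S : Finset (Fin n)} {l : List (Fin n)} (hl : IsListing S l) :
    l.length = S.card := by
  rw [← List.toFinset_card_of_nodup hl.1]
  congr 1
  ext v
  simp [hl.2]

/-- This joins the two halves of the argument: the abstract predicate of the program verification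
becomes the existence of a shortest path that meets S only in its ends. -/
theorem decidesWithin_decideMV {β : Type*} [AddCommMonoid β] [LinearOrder β] [IsOrderedAddMonoid β]
    [CanonicallyOrderedAdd β] {n : ℕ} {D : Digraph (Fin n)} {S : Finset (Fin n)}
    {adj : Fin n → List (Fin n)} {l : List (Fin n)} (hl : IsListing S l) {q : QueueProgs}
    {wtOk : (ℕ → ℝ≥0) → Prop} {c L : ℕ} {wt : ℕ → β} {w : Fin n → Fin n → β}
    {w' : Fin n → Fin n → ℝ≥0} (hq : QueueSpec q (adjCSR adj wt) wtOk c L)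
    (hR : Represents (adjCSR adj wt) D w) (hwt : wtOk ((inputState adj w' l).warr 0)) {T : ℝ}
    (hT : ((S.card * (testCost (adjCSR adj wt) c L S.card + 1) + 6 : ℕ) : ℝ) ≤ T) :
    DecidesWithin (decideMV q) (inputState adj w' l) T
      (IsMutualVisibilitySet D (pathLen w) (S : Set (Fin n))) := by
  have h1 : (inputState adj w' l).reg 1 = S.card := by simp [inputState, hl.card]
  have h2 : ∀ i (hi : i < S.card), (inputState adj w' l).arr 2 i = l[i]'(hl.card ▸ hi) := by
    intro i hi
    simp [inputState, hl.card, hi]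
  have hS : ∀ z, z ∈ S ↔ ∃ (i : ℕ) (hi : i < S.card), l[i]'(hl.card ▸ hi) = z := by
    intro z
    rw [← hl.2, List.mem_iff_getElem]
    simp only [hl.card]
  have hin : Input (adjCSR adj wt) wtOk (inputState adj w' l) :=
    ⟨by simp [inputState, adjCSR], by simp [inputState], by simp [inputState, adjCSR],
      by simp [inputState, adjCSR], hwt⟩
  obtain ⟨t, s', he, ht, hy, hn⟩ := wp_decideMV hq adjCSR_valid hin (by simp [inputState])
    (by
      intro i hi
      rw [h1] at hi
      rw [h2 i hi]
      exact Fin.is_lt _)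
    (fun a b => ∃ x y : Fin n, (x : ℕ) = a ∧ (y : ℕ) = b ∧
      ∃ p, IsShortestPath D (pathLen w) x y p ∧ (S : Set (Fin n)) ∩ {z | z ∈ p} = {x, y})
    (by
      intro i hi f g hf hg j hj
      rw [h1] at hi hj hg
      rw [h2 i hi] at hf hg ⊢
      rw [h2 j hj]
      have hB : {v | v ≠ (l[i]'(hl.card ▸ hi) : ℕ) ∧
          ∃ j < S.card, (inputState adj w' l).arr 2 j = v} =
          {v | v ≠ (l[i]'(hl.card ▸ hi) : ℕ) ∧ ∃ z ∈ S, (z : ℕ) = v} := by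
        ext v
        simp only [Set.mem_ofPred_eq, hS]
        refine and_congr_right fun _ => ⟨?_, ?_⟩
        · rintro ⟨j, hj, rfl⟩
          exact ⟨_, ⟨j, hj, rfl⟩, (h2 j hj).symm⟩
        · rintro ⟨_, ⟨j, hj, rfl⟩, rfl⟩
          exact ⟨j, hj, h2 j hj⟩
      rw [hB] at hg
      rw [← isShortestPath_iff_dist hR ((hS _).2 ⟨i, hi, rfl⟩) ((hS _).2 ⟨j, hj, rfl⟩) hf hg]
      constructor
      · exact fun h => ⟨_, _, rfl, rfl, h⟩
      · rintro ⟨x, y, hx, hy, h⟩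
        rwa [Fin.ext hx, Fin.ext hy] at h)
    (T := S.card * (testCost (adjCSR adj wt) c L S.card + 1) + 6) (by rw [h1])
  have hiff : (∀ i < (inputState adj w' l).reg 1, ∀ j < (inputState adj w' l).reg 1,
      ∃ x y : Fin n, (x : ℕ) = (inputState adj w' l).arr 2 i ∧
        (y : ℕ) = (inputState adj w' l).arr 2 j ∧ ∃ p, IsShortestPath D (pathLen w) x y p ∧
          (S : Set (Fin n)) ∩ {z | z ∈ p} = {x, y}) ↔
      IsMutualVisibilitySet D (pathLen w) (S : Set (Fin n)) := by
    rw [isMutualVisibilitySet_iff, h1]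
    constructor
    · intro h x hx y hy
      obtain ⟨i, hi, rfl⟩ := (hS x).1 hx
      obtain ⟨j, hj, rfl⟩ := (hS y).1 hy
      obtain ⟨x, y, hx, hy, h⟩ := h i hi j hj
      rw [h2 i hi] at hx
      rw [h2 j hj] at hy
      rwa [Fin.ext hx, Fin.ext hy] at h
    · intro h i hi j hj
      exact ⟨_, _, (h2 i hi).symm, (h2 j hj).symm,
        h _ ((hS _).2 ⟨i, hi, rfl⟩) _ ((hS _).2 ⟨j, hj, rfl⟩)⟩
  rw [hiff] at hy hn
  exact ⟨t, s', he, le_trans (by exact_mod_cast ht) hT, hy, hn⟩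

theorem decidesWithin_fifo {n : ℕ} {D : Digraph (Fin n)} {S : Finset (Fin n)}
    {adj : Fin n → List (Fin n)} {l : List (Fin n)} (hadj : IsAdjacencyList D adj)
    (hl : IsListing S l) :
    DecidesWithin (decideMV fifo) (inputState adj (fun _ _ => 0) l)
      (250 * ((S.card : ℝ) * ((n : ℝ) + (arcCount D : ℝ)) + 1))
      (IsMutualVisibilitySet D numArcs (S : Set (Fin n))) := by
  have hm := adjCSR_off_eq_arcCount (wt := fun _ => 1) hadj
  have hS : S.card ≤ n := by simpa using S.card_le_univ
  rw [show (numArcs : List (Fin n) → ℕ) = pathLen (fun _ _ => 1) from funext numArcs_eq_pathLen]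
  refine decidesWithin_decideMV hl (fifoSpec (adjCSR adj fun _ => 1) fun _ => rfl)
    (adjCSR_represents hadj fun _ _ _ => rfl) trivial ?_
  unfold testCost ssspCost
  change ((S.card * (2 * ((20 + 5) * (adjCSR adj fun _ => 1).off n + (20 + 10 + 12) * (n + 1)) +
    4 * n + (20 + 6) * S.card + (20 + 8) * S.card + 16 + 1) + 6 : ℕ) : ℝ) ≤ _
  rw [hm]
  generalize arcCount D = m
  generalize S.card = N at *
  have h : N * (2 * ((20 + 5) * m + (20 + 10 + 12) * (n + 1)) + 4 * n + (20 + 6) * N +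
      (20 + 8) * N + 16 + 1) + 6 ≤ 250 * (N * (n + m) + 1) := by
    rcases Nat.eq_zero_or_pos N with rfl | hN
    · simp
    -- A nonempty S forces n ≥ 1 and satisfies |S| ≤ n, so the constants and the terms in |S| are
    -- absorbed by n.
    · calc _ ≤ N * (250 * (n + m)) + 6 :=
            Nat.add_le_add_right (Nat.mul_le_mul_left _ (by omega)) _
        _ ≤ _ := by rw [Nat.mul_left_comm]; omega
  exact_mod_cast h

/-- For n ≥ 2 one has m + 2 ≤ n² + 2 ≤ n³, so the binary logarithm is at most 3 log n / log 2, and 3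
/ log 2 < 5. -/
theorem log_arcs_le {n m : ℕ} (hn : 2 ≤ n) (hm : m ≤ n ^ 2) :
    (Nat.log 2 (m + 2) : ℝ) ≤ 5 * Real.log n := by
  have h1 : 2 ^ Nat.log 2 (m + 2) ≤ n ^ 3 :=
    (Nat.pow_log_le_self 2 (by omega)).trans (by nlinarith [Nat.mul_le_mul hn hn])
  have h2 : ((2 : ℝ) ^ Nat.log 2 (m + 2)) ≤ (n : ℝ) ^ 3 := by exact_mod_cast h1
  have h3 := Real.log_le_log (by positivity) h2
  rw [Real.log_pow, Real.log_pow] at h3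
  have h4 := Real.log_two_gt_d9
  push_cast at h3
  have h5 : (0 : ℝ) ≤ Nat.log 2 (m + 2) := Nat.cast_nonneg _
  nlinarith

theorem decidesWithin_hollowHeap {n : ℕ} {D : Digraph (Fin n)} {w : Fin n → Fin n → ℝ≥0}
    {S : Finset (Fin n)} {adj : Fin n → List (Fin n)} {l : List (Fin n)}
    (hadj : IsAdjacencyList D adj) (hl : IsListing S l) :
    DecidesWithin (decideMV hollowHeap) (inputState adj w l)
      (9000 * ((S.card : ℝ) * ((arcCount D : ℝ) + (n : ℝ) * Real.log (n : ℝ)) + 1))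
      (IsMutualVisibilitySet D (pathWeight w) (S : Set (Fin n))) := by
  have hm := adjCSR_off_eq_arcCount (wt := (inputState adj w l).warr 0) hadj
  have hm2 := adjCSR_off_le (wt := (inputState adj w l).warr 0) hadj
  have hS : S.card ≤ n := by simpa using S.card_le_univ
  rw [show pathWeight w = pathLen w from funext (pathWeight_eq_pathLen w)]
  refine decidesWithin_decideMV hl (hollowSpec (adjCSR adj ((inputState adj w l).warr 0)))
    (adjCSR_represents hadj fun u i hi => ?_) rfl ?_
  · have h := flatMap_finRange_getElem? (fun u => (adj u).map (w u)) u (i := i) (by simpa using hi)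
    simp only [List.length_map] at h
    rw [adjCSR_off (by omega)]
    simp only [inputState, if_true]
    rw [List.getD_eq_getElem?_getD, h]
    simp [hi]
    rfl
  unfold testCost ssspCost
  change ((S.card * (2 * ((200 + 5) * (adjCSR adj ((inputState adj w l).warr 0)).off n +
    (200 + (220 * (Nat.log 2 ((adjCSR adj ((inputState adj w l).warr 0)).off n + 2) + 1)) + 12) *
      (n + 1)) + 4 * n + (200 + 6) * S.card + (200 + 8) * S.card + 16 + 1) + 6 : ℕ) : ℝ) ≤ _
  rw [hm] at hm2 ⊢
  generalize arcCount D = m at *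
  generalize S.card = N at *
  rcases Nat.eq_zero_or_pos N with rfl | hN
  · norm_num
  rcases Nat.lt_or_ge n 2 with hn | hn
  -- Here log n = 0 and the main term does not see the vertices; but there is at most one arc, so
  -- the whole cost is below the constant.
  · obtain rfl : n = 1 := by omega
    obtain rfl : N = 1 := by omega
    have h : Nat.log 2 (m + 2) ≤ 1 := (Nat.log_mono_right (by omega : m + 2 ≤ 3)).trans (by decide)
    have h' : 1 * (2 * ((200 + 5) * m + (200 + (220 * (Nat.log 2 (m + 2) + 1)) + 12) * (1 + 1)) +
        4 * 1 + (200 + 6) * 1 + (200 + 8) * 1 + 16 + 1) + 6 ≤ 9000 := by omega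
    refine le_trans (Nat.cast_le.2 h') ?_
    have : (0 : ℝ) ≤ m := Nat.cast_nonneg m
    norm_num
  · have h1 := log_arcs_le hn hm2
    have h2 : Real.log 2 ≤ Real.log n := Real.log_le_log (by norm_num) (by exact_mod_cast hn)
    have h3 := Real.log_two_gt_d9
    have h4 : (2 : ℝ) ≤ n := by exact_mod_cast hn
    have h5 : (N : ℝ) ≤ n := by exact_mod_cast hS
    have h6 : (0 : ℝ) ≤ N := Nat.cast_nonneg N
    push_cast
    generalize (Nat.log 2 (m + 2) : ℝ) = r at *
    generalize Real.log n = y at *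
    -- With r ≤ 5y, the first factor is at most 432 + 1100y, and 432 ≤ 670y because y ≥ log 2; the
    -- second factor is at most 2n.
    have h7 : (200 + 220 * (r + 1) + 12) * ((n : ℝ) + 1) ≤ 1770 * y * (2 * n) :=
      mul_le_mul (by linarith) (by linarith) (by linarith) (by linarith)
    have h8 : (n : ℝ) ≤ 2 * y * n := by nlinarith
    have h9 : (m : ℝ) ≥ 0 := Nat.cast_nonneg m
    have h10 : 2 * ((200 + 5) * (m : ℝ) + (200 + 220 * (r + 1) + 12) * (n + 1)) + 4 * n +
        (200 + 6) * N + (200 + 8) * N + 16 + 1 ≤ 9000 * (m + n * y) := by nlinarith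
    have h11 := mul_le_mul_of_nonneg_left h10 h6
    linarith

end MutualVisibility

theorem mainTheorem7 :
    -- unweighted digraphs: all weight cells of the input are zero and carry no information
    (∃ (p : MutualVisibility.Prog) (C : ℝ),
      ∀ (n : ℕ) (D : Digraph (Fin n)) (S : Finset (Fin n))
        (adj : Fin n → List (Fin n)) (l : List (Fin n)),
        (∀ v, ¬ D.Adj v v) →
        MutualVisibility.IsAdjacencyList D adj →
        MutualVisibility.IsListing S l →
        MutualVisibility.DecidesWithin p
          (MutualVisibility.inputState adj (fun _ _ => 0) l)
          (C * ((S.card : ℝ) * ((n : ℝ) + (MutualVisibility.arcCount D : ℝ)) + 1))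
          (MutualVisibility.IsMutualVisibilitySet D MutualVisibility.numArcs (S : Set (Fin n)))) ∧
    -- digraphs with nonnegative real arc weights
    (∃ (p : MutualVisibility.Prog) (C : ℝ),
      ∀ (n : ℕ) (D : Digraph (Fin n)) (w : Fin n → Fin n → NNReal) (S : Finset (Fin n))
        (adj : Fin n → List (Fin n)) (l : List (Fin n)),
        (∀ v, ¬ D.Adj v v) →
        MutualVisibility.IsAdjacencyList D adj →
        MutualVisibility.IsListing S l →
        MutualVisibility.DecidesWithin p
          (MutualVisibility.inputState adj w l)
          (C * ((S.card : ℝ) * ((MutualVisibility.arcCount D : ℝ) + (n : ℝ) * Real.log (n : ℝ))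
            + 1))
          (MutualVisibility.IsMutualVisibilitySet D (MutualVisibility.pathWeight w)
            (S : Set (Fin n)))) :=
  ⟨⟨_, _, fun _ _ _ _ _ _ hadj hl => MutualVisibility.decidesWithin_fifo hadj hl⟩,
    ⟨_, _, fun _ _ _ _ _ _ _ hadj hl => MutualVisibility.decidesWithin_hollowHeap hadj hl⟩⟩
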